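/- Let $k$ be a field; all tensor products without subscript are over $k$. For coalgebras and comodules we write $\Delta(h)=h_1\otimes h_2$ and $\rho(v)=v_0\otimes v_1$, summation understood; functionals on a coalgebra form an algebra under convolution. A *coquasi-Hopf algebra* is a $k$-coalgebra $(H,\Delta,\varepsilon)$ with coalgebra maps $H\otimes H\to H$, $h\otimes g\mapsto hg$ (not assumed associative) and $k\to H$, $1_k\mapsto 1$, a convolution-invertible $\omega\in(H\otimes H\otimes H)^*$, a coalgebra antihomomorphism $S:H\to H$ (the antipode) and functionals $\alpha,\beta\in H^*$ such that, for all $h,g,p,l\in H$, $$1h=h=h1,\qquad h_1(g_1p_1)\,\omega(h_2,g_2,p_2)=\omega(h_1,g_1,p_1)\,(h_2g_2)p_2,$$ $$\omega(h_1,g_1,p_1l_1)\,\omega(h_2g_2,p_2,l_2)=\omega(g_1,p_1,l_1)\,\omega(h_1,g_2p_2,l_2)\,\omega(h_2,g_3,p_3),\qquad \omega(h,1,g)=\varepsilon(h)\varepsilon(g),$$ $$S(h_1)\alpha(h_2)h_3=\alpha(h)1,\qquad h_1\beta(h_2)S(h_3)=\beta(h)1,$$ $$\omega(h_1\beta(h_2),S(h_3),\alpha(h_4)h_5)=\varepsilon(h)=\omega^{-1}(S(h_1),\alpha(h_2)h_3\beta(h_4),S(h_5)).$$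 A *right $H$-comodule algebra* is a right $H$-comodule $A$ with a bilinear multiplication (not assumed associative) with two-sided unit $1$ such that $\rho(ab)=a_0b_0\otimes a_1b_1$, $\rho(1)=1\otimes1$ and $(ab)c=a_0(b_0c_0)\,\omega(a_1,b_1,c_1)$. For a right $H$-comodule $V$ put $V^{\mathrm{co}H}=\{v\in V:\rho(v)=v\otimes 1\}$. Then $B=A^{\mathrm{co}H}$ is an associative unital algebra, and multiplication makes $A$ a left and a right $B$-module. The comodule algebra $A$ is * *left faithfully flat over $B$* if every pair of composable maps $N_1\to N_2\to N_3$ of right $B$-modules is exact at $N_2$ if and only if $N_1\otimes_BA\to N_2\otimes_BA\to N_3\otimes_BA$ is exact at $N_2\otimes_B A$; * *Galois over $B$* if the map $A\otimes_BA\to A\otimes H$, $a\otimes_B b\mapsto a_0b_0\otimes\omega^{-1}(a_1,b_1\beta(b_2),S(b_3))\,b_4$ is bijective. Let $A\otimes A$ carry the coaction $a\otimes b\mapsto a_0\otimes b_0\otimes a_1b_1$, and let $L=(A\otimes A^{op})^{\mathrm{co}H}$ be the subspace of its coinvariants. This is an associative algebra with unit $1\otimes1$ and product $$(a\otimes b)(c\otimes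 d)=a_0c_0\otimes d_0b_0\;\omega^{-1}(a_1,c_1,d_1b_1)\,\omega(c_2,d_2,b_2)$$ (extended linearly to sums of such tensors). Let ${}_L\mathcal M$ be the category of left $L$-modules. Let ${}_A\mathcal M_A^H$ be the category of two-sided $(H,A)$-Hopf modules, that is, of $A$-bimodules in the monoidal category of right $H$-comodules. An object is a right $H$-comodule $M$ with bilinear actions of $A$ from the left and from the right such that $1m=m=m1$, $\rho(am)=a_0m_0\otimes a_1m_1$, $\rho(ma)=m_0a_0\otimes m_1a_1$ and $$(ab)m=a_0(b_0m_0)\,\omega(a_1,b_1,m_1),\quad (ma)b=m_0(a_0b_0)\,\omega(m_1,a_1,b_1),\quad (am)b=a_0(m_0b_0)\,\omega(a_1,m_1,b_1);$$ a morphism is an $H$-colinear map which is left and right $A$-linear. **Proposition.** Let $H$ be a coquasi-Hopf algebra over $k$ with bijective antipode and let $A$ be a right $H$-comodule algebra which is left faithfully flat and Galois over $B=A^{\mathrm{co}H}$. Then the category ${}_L\mathcal M$ of left modules over $L=(A\otimes A^{op})^{\mathrm{co}H}$ is equivalent to the category ${}_A\mathcal M_A^H$. -/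

import Mathlib

open scoped TensorProduct
open CategoryTheory

set_option linter.unusedSimpArgs false
set_option linter.unusedSectionVars false

universe u₁ u₂ v w

namespace Coquasi

noncomputable section

/-! ## The convolution algebra of a coalgebra and right comodules -/

section Comodules

variable (k : Type*) [Field k]

/-- The linear dual `C^*` of a coalgebra, with the convolution product
`(φ * ψ)(c) = φ(c₁) ψ(c₂)` and unit `ε`. -/
abbrev CDual (C : Type*) [AddCommGroup C] [Module k C] : Type _ := WithConv (C →ₗ[k] k)

/-- A right comodule over the `k`-coalgebra `C`, with coaction `v ↦ v₀ ⊗ v₁`. -/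
class RightComodule (C : Type*) (V : Type*) [AddCommGroup C] [Module k C] [Coalgebra k C]
    [AddCommGroup V] [Module k V] where
  coaction : V →ₗ[k] V ⊗[k] C
  coaction_coassoc : (TensorProduct.assoc k V C C).toLinearMap ∘ₗ coaction.rTensor C ∘ₗ coaction =
    (Coalgebra.comul (R := k) (A := C)).lTensor V ∘ₗ coaction
  coaction_counit : (TensorProduct.rid k V).toLinearMap ∘ₗ
    (Coalgebra.counit (R := k) (A := C)).lTensor V ∘ₗ coaction = LinearMap.id

variable {k}
variable {C D E F : Type*} [AddCommGroup C] [Module k C] [Coalgebra k C]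
  [AddCommGroup D] [Module k D] [Coalgebra k D] [AddCommGroup E] [Module k E] [Coalgebra k E]
  [AddCommGroup F] [Module k F] [Coalgebra k F]
variable {V W X Y : Type*} [AddCommGroup V] [Module k V] [AddCommGroup W] [Module k W]
  [AddCommGroup X] [Module k X] [AddCommGroup Y] [Module k Y]

/-- The pull-back `φ ∘ j` of a functional along a linear map of coalgebras. -/
def pull (j : C →ₗ[k] D) (φ : CDual k D) : CDual k C := WithConv.toConv (φ.ofConv ∘ₗ j)

/-- `φ ⇀ c = c₁ φ(c₂)`. -/
def hitL (φ : CDual k C) : C →ₗ[k] C :=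
  (TensorProduct.rid k C).toLinearMap ∘ₗ φ.ofConv.lTensor C ∘ₗ Coalgebra.comul

/-- `c ↼ φ = φ(c₁) c₂`. -/
def hitR (φ : CDual k C) : C →ₗ[k] C :=
  (TensorProduct.lid k C).toLinearMap ∘ₗ φ.ofConv.rTensor C ∘ₗ Coalgebra.comul

variable (k C) in
/-- The coaction as a linear map `V → V ⊗ C`. -/
def coact (V : Type*) [AddCommGroup V] [Module k V] [RightComodule k C V] :
    V →ₗ[k] V ⊗[k] C := RightComodule.coaction

variable (k C) in
theorem coact_coassoc [RightComodule k C V] (v : V) :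
    TensorProduct.assoc k V C C ((coact k C V).rTensor C (coact k C V v)) =
      (Coalgebra.comul (R := k) (A := C)).lTensor V (coact k C V v) :=
  LinearMap.congr_fun RightComodule.coaction_coassoc v

variable (k C) in
theorem coact_counit [RightComodule k C V] (v : V) :
    TensorProduct.rid k V ((Coalgebra.counit (R := k) (A := C)).lTensor V (coact k C V v)) = v :=
  LinearMap.congr_fun RightComodule.coaction_counit v

/-- The action of `φ ∈ C^*` on a right `C`-comodule: `v ↦ v₀ φ(v₁)`. -/
def act (V : Type*) [AddCommGroup V] [Module k V] [RightComodule k C V] (φ : CDual k C) :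
    V →ₗ[k] V :=
  (TensorProduct.rid k V).toLinearMap ∘ₗ φ.ofConv.lTensor V ∘ₗ coact k C V

/-- The external tensor product of a right `C`-comodule and a right `D`-comodule is a right
`C ⊗ D`-comodule by `v ⊗ w ↦ (v₀ ⊗ w₀) ⊗ (v₁ ⊗ w₁)`. -/
instance tensorComodule [RightComodule k C V] [RightComodule k D W] :
    RightComodule k (C ⊗[k] D) (V ⊗[k] W) where
  coaction := (TensorProduct.tensorTensorTensorComm k V C W D).toLinearMap ∘ₗ
    TensorProduct.map (coact k C V) (coact k D W)
  coaction_coassoc := by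
    refine TensorProduct.ext' fun v w => ?_
    have h := congrArg ((TensorProduct.map LinearMap.id
      (TensorProduct.tensorTensorTensorComm k C C D D).toLinearMap) ∘ₗ
      (TensorProduct.tensorTensorTensorComm k V (C ⊗[k] C) W (D ⊗[k] D)).toLinearMap)
      (congrArg₂ (fun a b => a ⊗ₜ[k] b) (coact_coassoc k C v) (coact_coassoc k D w))
    refine Eq.trans ?_ (h.trans ?_)
    · simp only [LinearMap.comp_apply, LinearEquiv.coe_coe, TensorProduct.map_tmul,
      LinearMap.rTensor_tmul, LinearMap.lTensor_tmul, TensorProduct.assoc_tmul,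
      TensorProduct.tensorTensorTensorComm_tmul, LinearMap.id_apply, TensorProduct.rid_tmul,
      TensorProduct.lid_tmul]
      induction coact k C V v with
      | zero => simp only [map_zero, TensorProduct.zero_tmul, TensorProduct.tmul_zero, smul_zero]
      | add _ _ h₁ h₂ => simp only [map_add, TensorProduct.add_tmul, TensorProduct.tmul_add,
        smul_add, h₁, h₂]
      | tmul v c =>
      induction coact k D W w with
      | zero => simp only [map_zero, TensorProduct.zero_tmul, TensorProduct.tmul_zero, smul_zero]
      | add _ _ h₁ h₂ => simp only [map_add, TensorProduct.add_tmul, TensorProduct.tmul_add,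
        smul_add, h₁, h₂]
      | tmul w d =>
      simp only [LinearMap.comp_apply, LinearEquiv.coe_coe, TensorProduct.map_tmul,
        LinearMap.rTensor_tmul, LinearMap.lTensor_tmul, TensorProduct.assoc_tmul,
        TensorProduct.tensorTensorTensorComm_tmul, LinearMap.id_apply, TensorProduct.rid_tmul,
        TensorProduct.lid_tmul]
      induction coact k C V v with
      | zero => simp only [map_zero, TensorProduct.zero_tmul, TensorProduct.tmul_zero, smul_zero]
      | add _ _ h₁ h₂ => simp only [map_add, TensorProduct.add_tmul, TensorProduct.tmul_add,
        smul_add, h₁, h₂]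
      | tmul v c' =>
      induction coact k D W w with
      | zero => simp only [map_zero, TensorProduct.zero_tmul, TensorProduct.tmul_zero, smul_zero]
      | add _ _ h₁ h₂ => simp only [map_add, TensorProduct.add_tmul, TensorProduct.tmul_add,
        smul_add, h₁, h₂]
      | tmul w d' =>
      rfl
    · simp only [LinearMap.comp_apply, LinearEquiv.coe_coe, TensorProduct.map_tmul,
      LinearMap.rTensor_tmul, LinearMap.lTensor_tmul, TensorProduct.assoc_tmul,
      TensorProduct.tensorTensorTensorComm_tmul, LinearMap.id_apply, TensorProduct.rid_tmul,
      TensorProduct.lid_tmul]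
      induction coact k C V v with
      | zero => simp only [map_zero, TensorProduct.zero_tmul, TensorProduct.tmul_zero, smul_zero]
      | add _ _ h₁ h₂ => simp only [map_add, TensorProduct.add_tmul, TensorProduct.tmul_add,
        smul_add, h₁, h₂]
      | tmul v c =>
      induction coact k D W w with
      | zero => simp only [map_zero, TensorProduct.zero_tmul, TensorProduct.tmul_zero, smul_zero]
      | add _ _ h₁ h₂ => simp only [map_add, TensorProduct.add_tmul, TensorProduct.tmul_add,
        smul_add, h₁, h₂]
      | tmul w d =>
      rfl
  coaction_counit := by
    refine TensorProduct.ext' fun v w => ?_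
    refine Eq.trans ?_ (congrArg₂ (fun a b => a ⊗ₜ[k] b) (coact_counit k C v) (coact_counit k D w))
    simp only [LinearMap.comp_apply, LinearEquiv.coe_coe, TensorProduct.map_tmul,
      LinearMap.rTensor_tmul, LinearMap.lTensor_tmul, TensorProduct.assoc_tmul,
      TensorProduct.tensorTensorTensorComm_tmul, LinearMap.id_apply, TensorProduct.rid_tmul,
      TensorProduct.lid_tmul]
    induction coact k C V v with
    | zero => simp only [map_zero, TensorProduct.zero_tmul, TensorProduct.tmul_zero, smul_zero]
    | add _ _ h₁ h₂ => simp only [map_add, TensorProduct.add_tmul, TensorProduct.tmul_add,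
      smul_add, h₁, h₂]
    | tmul v c =>
    induction coact k D W w with
    | zero => simp only [map_zero, TensorProduct.zero_tmul, TensorProduct.tmul_zero, smul_zero]
    | add _ _ h₁ h₂ => simp only [map_add, TensorProduct.add_tmul, TensorProduct.tmul_add,
      smul_add, h₁, h₂]
    | tmul w d =>
    simp [TensorProduct.tmul_smul, TensorProduct.smul_tmul', smul_smul]

theorem coact_tmul [RightComodule k C V] [RightComodule k D W] (v : V) (w : W) :
    coact k (C ⊗[k] D) (V ⊗[k] W) (v ⊗ₜ w) =
      TensorProduct.tensorTensorTensorComm k V C W D (coact k C V v ⊗ₜ coact k D W w) := rfl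

/-- `g : V → W` is colinear along `j : C → D`. -/
def IsColin (j : C →ₗ[k] D) [RightComodule k C V] [RightComodule k D W] (g : V →ₗ[k] W) : Prop :=
  coact k D W ∘ₗ g = TensorProduct.map g j ∘ₗ coact k C V

theorem act_one [RightComodule k C V] : act V (1 : CDual k C) = LinearMap.id := by
  ext v
  exact coact_counit k C v

theorem act_mul [RightComodule k C V] (φ ψ : CDual k C) :
    act V (φ * ψ) = act V φ ∘ₗ act V ψ := by
  ext v
  have h := congrArg ((TensorProduct.rid k V).toLinearMap ∘ₗ
    (LinearMap.mul' k k ∘ₗ TensorProduct.map φ.ofConv ψ.ofConv).lTensor V) (coact_coassoc k C v)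
  refine Eq.trans ?_ (h.symm.trans ?_)
  · simp only [act, LinearMap.comp_apply, LinearEquiv.coe_coe, TensorProduct.map_tmul,
    LinearMap.rTensor_tmul, LinearMap.lTensor_tmul, TensorProduct.assoc_tmul,
    TensorProduct.tensorTensorTensorComm_tmul, LinearMap.id_apply, TensorProduct.rid_tmul,
    TensorProduct.lid_tmul]
    induction coact k C V v with
    | zero => simp only [map_zero, TensorProduct.zero_tmul, TensorProduct.tmul_zero, smul_zero]
    | add _ _ h₁ h₂ => simp only [map_add, TensorProduct.add_tmul, TensorProduct.tmul_add,
      smul_add, h₁, h₂]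
    | tmul v c =>
    rfl
  · simp only [act, LinearMap.comp_apply, LinearEquiv.coe_coe, TensorProduct.map_tmul,
    LinearMap.rTensor_tmul, LinearMap.lTensor_tmul, TensorProduct.assoc_tmul,
    TensorProduct.tensorTensorTensorComm_tmul, LinearMap.id_apply, TensorProduct.rid_tmul,
    TensorProduct.lid_tmul]
    induction coact k C V v with
    | zero => simp only [map_zero, TensorProduct.zero_tmul, TensorProduct.tmul_zero, smul_zero]
    | add _ _ h₁ h₂ => simp only [map_add, TensorProduct.add_tmul, TensorProduct.tmul_add,
      smul_add, h₁, h₂]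
    | tmul v c =>
    simp only [LinearMap.comp_apply, LinearEquiv.coe_coe, TensorProduct.map_tmul,
      LinearMap.rTensor_tmul, LinearMap.lTensor_tmul, TensorProduct.assoc_tmul,
      TensorProduct.tensorTensorTensorComm_tmul, LinearMap.id_apply, TensorProduct.rid_tmul,
      TensorProduct.lid_tmul, map_smul]
    induction coact k C V v with
    | zero => simp only [map_zero, TensorProduct.zero_tmul, TensorProduct.tmul_zero, smul_zero]
    | add _ _ h₁ h₂ => simp only [map_add, TensorProduct.add_tmul, TensorProduct.tmul_add,
      smul_add, h₁, h₂]
    | tmul v d =>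
    simp [smul_smul, mul_comm]

theorem IsColin.act_comp {j : C →ₗ[k] D} [RightComodule k C V] [RightComodule k D W]
    {g : V →ₗ[k] W} (h : IsColin j g) (φ : CDual k D) :
    act W φ ∘ₗ g = g ∘ₗ act V (pull j φ) := by
  ext v
  have hv := LinearMap.congr_fun h v
  simp only [LinearMap.comp_apply] at hv
  simp only [act, LinearMap.comp_apply, hv]
  induction coact k C V v with
  | zero => simp only [map_zero, TensorProduct.zero_tmul, TensorProduct.tmul_zero, smul_zero]
  | add _ _ h₁ h₂ => simp only [map_add, TensorProduct.add_tmul, TensorProduct.tmul_add, smul_add,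
    h₁, h₂]
  | tmul v c =>
  simp [pull]

theorem IsColin.id [RightComodule k C V] :
    IsColin (LinearMap.id : C →ₗ[k] C) (LinearMap.id : V →ₗ[k] V) := by
  simp [IsColin]

theorem IsColin.comp {j : C →ₗ[k] D} {j' : D →ₗ[k] E} [RightComodule k C V] [RightComodule k D W]
    [RightComodule k E X] {g : V →ₗ[k] W} {g' : W →ₗ[k] X} (h' : IsColin j' g')
    (h : IsColin j g) : IsColin (j' ∘ₗ j) (g' ∘ₗ g) := by
  unfold IsColin at *
  rw [← LinearMap.comp_assoc, h', LinearMap.comp_assoc, h, TensorProduct.map_comp,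
    LinearMap.comp_assoc]

theorem IsColin.map {j : C →ₗ[k] D} {j' : E →ₗ[k] F} [RightComodule k C V] [RightComodule k D W]
    [RightComodule k E X] [RightComodule k F Y] {g : V →ₗ[k] W} {g' : X →ₗ[k] Y}
    (h : IsColin j g) (h' : IsColin j' g') :
    IsColin (TensorProduct.map j j') (TensorProduct.map g g') := by
  refine TensorProduct.ext' fun v x => ?_
  have hv := LinearMap.congr_fun h v
  have hx := LinearMap.congr_fun h' x
  simp only [LinearMap.comp_apply] at hv hx
  simp only [LinearMap.comp_apply, LinearEquiv.coe_coe, TensorProduct.map_tmul,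
    LinearMap.rTensor_tmul, LinearMap.lTensor_tmul, TensorProduct.assoc_tmul,
    TensorProduct.tensorTensorTensorComm_tmul, LinearMap.id_apply, TensorProduct.rid_tmul,
    TensorProduct.lid_tmul, coact_tmul, hv, hx]
  induction coact k C V v with
  | zero => simp only [map_zero, TensorProduct.zero_tmul, TensorProduct.tmul_zero, smul_zero]
  | add _ _ h₁ h₂ => simp only [map_add, TensorProduct.add_tmul, TensorProduct.tmul_add, smul_add,
    h₁, h₂]
  | tmul v c =>
  induction coact k E X x with
  | zero => simp only [map_zero, TensorProduct.zero_tmul, TensorProduct.tmul_zero, smul_zero]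
  | add _ _ h₁ h₂ => simp only [map_add, TensorProduct.add_tmul, TensorProduct.tmul_add, smul_add,
    h₁, h₂]
  | tmul w d =>
  rfl

theorem IsColin.assoc [RightComodule k C V] [RightComodule k D W] [RightComodule k E X] :
    IsColin (TensorProduct.assoc k C D E).toLinearMap (TensorProduct.assoc k V W X).toLinearMap := by
  refine TensorProduct.ext_threefold fun v w x => ?_
  simp only [LinearMap.comp_apply, LinearEquiv.coe_coe, TensorProduct.map_tmul,
    LinearMap.rTensor_tmul, LinearMap.lTensor_tmul, TensorProduct.assoc_tmul,
    TensorProduct.tensorTensorTensorComm_tmul, LinearMap.id_apply, TensorProduct.rid_tmul,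
    TensorProduct.lid_tmul, coact_tmul]
  induction coact k C V v with
  | zero => simp only [map_zero, TensorProduct.zero_tmul, TensorProduct.tmul_zero, smul_zero]
  | add _ _ h₁ h₂ => simp only [map_add, TensorProduct.add_tmul, TensorProduct.tmul_add, smul_add,
    h₁, h₂]
  | tmul v c =>
  induction coact k D W w with
  | zero => simp only [map_zero, TensorProduct.zero_tmul, TensorProduct.tmul_zero, smul_zero]
  | add _ _ h₁ h₂ => simp only [map_add, TensorProduct.add_tmul, TensorProduct.tmul_add, smul_add,
    h₁, h₂]
  | tmul w d =>
  induction coact k E X x with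
  | zero => simp only [map_zero, TensorProduct.zero_tmul, TensorProduct.tmul_zero, smul_zero]
  | add _ _ h₁ h₂ => simp only [map_add, TensorProduct.add_tmul, TensorProduct.tmul_add, smul_add,
    h₁, h₂]
  | tmul x e =>
  rfl

theorem IsColin.assoc_symm [RightComodule k C V] [RightComodule k D W] [RightComodule k E X] :
    IsColin (TensorProduct.assoc k C D E).symm.toLinearMap
      (TensorProduct.assoc k V W X).symm.toLinearMap := by
  refine LinearMap.ext fun t => ?_
  obtain ⟨t, rfl⟩ := (TensorProduct.assoc k V W X).surjective t
  have h := congrArg (TensorProduct.map (TensorProduct.assoc k V W X).symm.toLinearMap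
    (TensorProduct.assoc k C D E).symm.toLinearMap)
    (LinearMap.congr_fun (IsColin.assoc (k := k) (C := C) (D := D) (E := E)
      (V := V) (W := W) (X := X)) t)
  simp only [LinearMap.comp_apply, LinearEquiv.coe_coe, ← TensorProduct.map_comp] at h ⊢
  rw [h, ← LinearMap.comp_apply, ← TensorProduct.map_comp]
  simp

theorem lTensor_act [RightComodule k C V] [RightComodule k D W] (φ : CDual k D) :
    (act W φ).lTensor V = act (V ⊗[k] W) (pull ((TensorProduct.lid k D).toLinearMap ∘ₗ
      (Coalgebra.counit (R := k) (A := C)).rTensor D) φ) := by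
  refine TensorProduct.ext' fun v w => ?_
  simp only [act, LinearMap.comp_apply, LinearEquiv.coe_coe, TensorProduct.map_tmul,
    LinearMap.rTensor_tmul, LinearMap.lTensor_tmul, TensorProduct.assoc_tmul,
    TensorProduct.tensorTensorTensorComm_tmul, LinearMap.id_apply, TensorProduct.rid_tmul,
    TensorProduct.lid_tmul, coact_tmul]
  conv_lhs => rw [← coact_counit k C v]
  induction coact k C V v with
  | zero => simp only [map_zero, TensorProduct.zero_tmul, TensorProduct.tmul_zero, smul_zero]
  | add _ _ h₁ h₂ => simp only [map_add, TensorProduct.add_tmul, TensorProduct.tmul_add, smul_add,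
    h₁, h₂]
  | tmul v c =>
  induction coact k D W w with
  | zero => simp only [map_zero, TensorProduct.zero_tmul, TensorProduct.tmul_zero, smul_zero]
  | add _ _ h₁ h₂ => simp only [map_add, TensorProduct.add_tmul, TensorProduct.tmul_add, smul_add,
    h₁, h₂]
  | tmul w d =>
  simp [pull, TensorProduct.smul_tmul', TensorProduct.tmul_smul, smul_smul, mul_comm]

theorem rTensor_act [RightComodule k C V] [RightComodule k D W] (φ : CDual k C) :
    (act V φ).rTensor W = act (V ⊗[k] W) (pull ((TensorProduct.rid k C).toLinearMap ∘ₗ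
      (Coalgebra.counit (R := k) (A := D)).lTensor C) φ) := by
  refine TensorProduct.ext' fun v w => ?_
  simp only [act, LinearMap.comp_apply, LinearEquiv.coe_coe, TensorProduct.map_tmul,
    LinearMap.rTensor_tmul, LinearMap.lTensor_tmul, TensorProduct.assoc_tmul,
    TensorProduct.tensorTensorTensorComm_tmul, LinearMap.id_apply, TensorProduct.rid_tmul,
    TensorProduct.lid_tmul, coact_tmul]
  conv_lhs => rw [← coact_counit k D w]
  induction coact k C V v with
  | zero => simp only [map_zero, TensorProduct.zero_tmul, TensorProduct.tmul_zero, smul_zero]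
  | add _ _ h₁ h₂ => simp only [map_add, TensorProduct.add_tmul, TensorProduct.tmul_add, smul_add,
    h₁, h₂]
  | tmul v c =>
  induction coact k D W w with
  | zero => simp only [map_zero, TensorProduct.zero_tmul, TensorProduct.tmul_zero, smul_zero]
  | add _ _ h₁ h₂ => simp only [map_add, TensorProduct.add_tmul, TensorProduct.tmul_add, smul_add,
    h₁, h₂]
  | tmul w d =>
  simp [pull, TensorProduct.smul_tmul', TensorProduct.tmul_smul, smul_smul, mul_comm]

/-- `ρ(act φ v) = v₀ ⊗ v₁ φ(v₂)`. -/
theorem coact_act [RightComodule k C V] (φ : CDual k C) :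
    coact k C V ∘ₗ act V φ = (hitL φ).lTensor V ∘ₗ coact k C V := by
  ext v
  have h := congrArg (((TensorProduct.rid k C).toLinearMap ∘ₗ φ.ofConv.lTensor C).lTensor V)
    (coact_coassoc k C v)
  refine Eq.trans ?_ (h.trans ?_)
  · simp only [act, LinearMap.comp_apply, LinearEquiv.coe_coe, TensorProduct.map_tmul,
    LinearMap.rTensor_tmul, LinearMap.lTensor_tmul, TensorProduct.assoc_tmul,
    TensorProduct.tensorTensorTensorComm_tmul, LinearMap.id_apply, TensorProduct.rid_tmul,
    TensorProduct.lid_tmul]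
    induction coact k C V v with
    | zero => simp only [map_zero, TensorProduct.zero_tmul, TensorProduct.tmul_zero, smul_zero]
    | add _ _ h₁ h₂ => simp only [map_add, TensorProduct.add_tmul, TensorProduct.tmul_add,
      smul_add, h₁, h₂]
    | tmul v c =>
    simp only [LinearMap.comp_apply, LinearEquiv.coe_coe, TensorProduct.map_tmul,
      LinearMap.rTensor_tmul, LinearMap.lTensor_tmul, TensorProduct.assoc_tmul,
      TensorProduct.tensorTensorTensorComm_tmul, LinearMap.id_apply, TensorProduct.rid_tmul,
      TensorProduct.lid_tmul, map_smul]
    induction coact k C V v with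
    | zero => simp only [map_zero, TensorProduct.zero_tmul, TensorProduct.tmul_zero, smul_zero]
    | add _ _ h₁ h₂ => simp only [map_add, TensorProduct.add_tmul, TensorProduct.tmul_add,
      smul_add, h₁, h₂]
    | tmul v d =>
    simp
  · simp only [hitL, LinearMap.comp_apply, LinearEquiv.coe_coe, TensorProduct.map_tmul,
    LinearMap.rTensor_tmul, LinearMap.lTensor_tmul, TensorProduct.assoc_tmul,
    TensorProduct.tensorTensorTensorComm_tmul, LinearMap.id_apply, TensorProduct.rid_tmul,
    TensorProduct.lid_tmul]
    induction coact k C V v with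
    | zero => simp only [map_zero, TensorProduct.zero_tmul, TensorProduct.tmul_zero, smul_zero]
    | add _ _ h₁ h₂ => simp only [map_add, TensorProduct.add_tmul, TensorProduct.tmul_add,
      smul_add, h₁, h₂]
    | tmul v c =>
    rfl

/-- `v₀ φ(v₁) ⊗ v₂`. -/
theorem act_coact [RightComodule k C V] (φ : CDual k C) :
    (act V φ).rTensor C ∘ₗ coact k C V = (hitR φ).lTensor V ∘ₗ coact k C V := by
  ext v
  have h := congrArg (((TensorProduct.lid k C).toLinearMap ∘ₗ φ.ofConv.rTensor C).lTensor V)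
    (coact_coassoc k C v)
  refine Eq.trans ?_ (h.trans ?_)
  · simp only [act, LinearMap.comp_apply, LinearEquiv.coe_coe, TensorProduct.map_tmul,
    LinearMap.rTensor_tmul, LinearMap.lTensor_tmul, TensorProduct.assoc_tmul,
    TensorProduct.tensorTensorTensorComm_tmul, LinearMap.id_apply, TensorProduct.rid_tmul,
    TensorProduct.lid_tmul]
    induction coact k C V v with
    | zero => simp only [map_zero, TensorProduct.zero_tmul, TensorProduct.tmul_zero, smul_zero]
    | add _ _ h₁ h₂ => simp only [map_add, TensorProduct.add_tmul, TensorProduct.tmul_add,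
      smul_add, h₁, h₂]
    | tmul v c =>
    simp only [LinearMap.comp_apply, LinearEquiv.coe_coe, TensorProduct.map_tmul,
      LinearMap.rTensor_tmul, LinearMap.lTensor_tmul, TensorProduct.assoc_tmul,
      TensorProduct.tensorTensorTensorComm_tmul, LinearMap.id_apply, TensorProduct.rid_tmul,
      TensorProduct.lid_tmul, map_smul]
    induction coact k C V v with
    | zero => simp only [map_zero, TensorProduct.zero_tmul, TensorProduct.tmul_zero, smul_zero]
    | add _ _ h₁ h₂ => simp only [map_add, TensorProduct.add_tmul, TensorProduct.tmul_add,
      smul_add, h₁, h₂]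
    | tmul v d =>
    simp [TensorProduct.smul_tmul]
  · simp only [hitR, LinearMap.comp_apply, LinearEquiv.coe_coe, TensorProduct.map_tmul,
    LinearMap.rTensor_tmul, LinearMap.lTensor_tmul, TensorProduct.assoc_tmul,
    TensorProduct.tensorTensorTensorComm_tmul, LinearMap.id_apply, TensorProduct.rid_tmul,
    TensorProduct.lid_tmul]
    induction coact k C V v with
    | zero => simp only [map_zero, TensorProduct.zero_tmul, TensorProduct.tmul_zero, smul_zero]
    | add _ _ h₁ h₂ => simp only [map_add, TensorProduct.add_tmul, TensorProduct.tmul_add,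
      smul_add, h₁, h₂]
    | tmul v c =>
    rfl

/-- A linear map of coalgebras which respects `Δ` and `ε`. -/
def IsCoalgMap (j : C →ₗ[k] D) : Prop :=
  Coalgebra.comul ∘ₗ j = TensorProduct.map j j ∘ₗ Coalgebra.comul ∧
    Coalgebra.counit (R := k) ∘ₗ j = Coalgebra.counit

theorem IsCoalgMap.pull_mul {j : C →ₗ[k] D} (h : IsCoalgMap j) (φ ψ : CDual k D) :
    pull j (φ * ψ) = pull j φ * pull j ψ := by
  apply WithConv.ofConv_injective
  ext c
  have hc := LinearMap.congr_fun h.1 c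
  simp only [LinearMap.comp_apply] at hc
  simp only [pull, LinearMap.convMul_def, LinearMap.comp_apply, hc]
  induction Coalgebra.comul (R := k) c with
  | zero => simp only [map_zero, TensorProduct.zero_tmul, TensorProduct.tmul_zero, smul_zero]
  | add _ _ h₁ h₂ => simp only [map_add, TensorProduct.add_tmul, TensorProduct.tmul_add, smul_add,
    h₁, h₂]
  | tmul v c =>
  rfl

theorem IsCoalgMap.pull_one {j : C →ₗ[k] D} (h : IsCoalgMap j) :
    pull j (1 : CDual k D) = 1 := by
  apply WithConv.ofConv_injective
  ext c
  exact LinearMap.congr_fun h.2 c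

/-- Push-forward of a right `C`-comodule structure along a coalgebra map `C → D`. -/
@[reducible] def pushComodule (j : C →ₗ[k] D) (h : IsCoalgMap j) [RightComodule k C V] :
    RightComodule k D V where
  coaction := j.lTensor V ∘ₗ coact k C V
  coaction_coassoc := by
    ext v
    have hp := congrArg ((TensorProduct.map j j).lTensor V) (coact_coassoc k C v)
    refine Eq.trans ?_ (hp.trans ?_)
    · simp only [LinearMap.comp_apply, LinearEquiv.coe_coe, TensorProduct.map_tmul,
      LinearMap.rTensor_tmul, LinearMap.lTensor_tmul, TensorProduct.assoc_tmul,
      TensorProduct.tensorTensorTensorComm_tmul, LinearMap.id_apply, TensorProduct.rid_tmul,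
      TensorProduct.lid_tmul]
      induction coact k C V v with
      | zero => simp only [map_zero, TensorProduct.zero_tmul, TensorProduct.tmul_zero, smul_zero]
      | add _ _ h₁ h₂ => simp only [map_add, TensorProduct.add_tmul, TensorProduct.tmul_add,
        smul_add, h₁, h₂]
      | tmul v c =>
      simp only [LinearMap.comp_apply, LinearEquiv.coe_coe, TensorProduct.map_tmul,
        LinearMap.rTensor_tmul, LinearMap.lTensor_tmul, TensorProduct.assoc_tmul,
        TensorProduct.tensorTensorTensorComm_tmul, LinearMap.id_apply, TensorProduct.rid_tmul,
        TensorProduct.lid_tmul]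
      induction coact k C V v with
      | zero => simp only [map_zero, TensorProduct.zero_tmul, TensorProduct.tmul_zero, smul_zero]
      | add _ _ h₁ h₂ => simp only [map_add, TensorProduct.add_tmul, TensorProduct.tmul_add,
        smul_add, h₁, h₂]
      | tmul v d =>
      rfl
    · simp only [LinearMap.comp_apply, LinearEquiv.coe_coe, TensorProduct.map_tmul,
      LinearMap.rTensor_tmul, LinearMap.lTensor_tmul, TensorProduct.assoc_tmul,
      TensorProduct.tensorTensorTensorComm_tmul, LinearMap.id_apply, TensorProduct.rid_tmul,
      TensorProduct.lid_tmul]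
      induction coact k C V v with
      | zero => simp only [map_zero, TensorProduct.zero_tmul, TensorProduct.tmul_zero, smul_zero]
      | add _ _ h₁ h₂ => simp only [map_add, TensorProduct.add_tmul, TensorProduct.tmul_add,
        smul_add, h₁, h₂]
      | tmul v c =>
      exact congrArg (TensorProduct.mk k V (D ⊗[k] D) v) (LinearMap.congr_fun h.1 c).symm
  coaction_counit := by
    ext v
    refine Eq.trans ?_ (coact_counit k C v)
    simp only [LinearMap.comp_apply, LinearEquiv.coe_coe, TensorProduct.map_tmul,
      LinearMap.rTensor_tmul, LinearMap.lTensor_tmul, TensorProduct.assoc_tmul,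
      TensorProduct.tensorTensorTensorComm_tmul, LinearMap.id_apply, TensorProduct.rid_tmul,
      TensorProduct.lid_tmul]
    rw [← h.2, LinearMap.lTensor_comp]
    rfl

end Comodules

/-! ## Coquasi-bialgebras, coquasi-Hopf algebras, comodule algebras -/

section Definitions

variable (k : Type*) [Field k]

/-- `a ⊗ (b ⊗ c) ↦ (ab)c`. -/
def mulL (A : Type*) [NonAssocRing A] [Module k A] [SMulCommClass k A A] [IsScalarTower k A A] :
    A ⊗[k] (A ⊗[k] A) →ₗ[k] A :=
  LinearMap.mul' k A ∘ₗ (LinearMap.mul' k A).rTensor A ∘ₗ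
    (TensorProduct.assoc k A A A).symm.toLinearMap

/-- `a ⊗ (b ⊗ c) ↦ a(bc)`. -/
def mulR (A : Type*) [NonAssocRing A] [Module k A] [SMulCommClass k A A] [IsScalarTower k A A] :
    A ⊗[k] (A ⊗[k] A) →ₗ[k] A :=
  LinearMap.mul' k A ∘ₗ (LinearMap.mul' k A).lTensor A

/-- `a ⊗ (b ⊗ t) ↦ ab ⊗ t`. -/
def mulFst (A : Type*) [NonAssocRing A] [Module k A] [SMulCommClass k A A] [IsScalarTower k A A]
    (V : Type*) [AddCommGroup V] [Module k V] : A ⊗[k] (A ⊗[k] V) →ₗ[k] A ⊗[k] V :=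
  (LinearMap.mul' k A).rTensor V ∘ₗ (TensorProduct.assoc k A A V).symm.toLinearMap

variable (H : Type*) [NonAssocRing H] [Module k H] [SMulCommClass k H H] [IsScalarTower k H H]
  [Coalgebra k H]

/-- `h ⊗ (g ⊗ (p ⊗ l)) ↦ ε(h) g ⊗ (p ⊗ l)`. -/
def face0 : H ⊗[k] (H ⊗[k] (H ⊗[k] H)) →ₗ[k] H ⊗[k] (H ⊗[k] H) :=
  (TensorProduct.lid k (H ⊗[k] (H ⊗[k] H))).toLinearMap ∘ₗ
    (Coalgebra.counit (R := k) (A := H)).rTensor (H ⊗[k] (H ⊗[k] H))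

/-- `h ⊗ (g ⊗ (p ⊗ l)) ↦ hg ⊗ (p ⊗ l)`. -/
def face1 : H ⊗[k] (H ⊗[k] (H ⊗[k] H)) →ₗ[k] H ⊗[k] (H ⊗[k] H) := mulFst k H (H ⊗[k] H)

/-- `h ⊗ (g ⊗ (p ⊗ l)) ↦ h ⊗ (gp ⊗ l)`. -/
def face2 : H ⊗[k] (H ⊗[k] (H ⊗[k] H)) →ₗ[k] H ⊗[k] (H ⊗[k] H) := (mulFst k H H).lTensor H

/-- `h ⊗ (g ⊗ (p ⊗ l)) ↦ h ⊗ (g ⊗ pl)`. -/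
def face3 : H ⊗[k] (H ⊗[k] (H ⊗[k] H)) →ₗ[k] H ⊗[k] (H ⊗[k] H) :=
  ((LinearMap.mul' k H).lTensor H).lTensor H

/-- `h ⊗ (g ⊗ (p ⊗ l)) ↦ h ⊗ (g ⊗ p ε(l))`. -/
def face4 : H ⊗[k] (H ⊗[k] (H ⊗[k] H)) →ₗ[k] H ⊗[k] (H ⊗[k] H) :=
  (((TensorProduct.rid k H).toLinearMap ∘ₗ
    (Coalgebra.counit (R := k) (A := H)).lTensor H).lTensor H).lTensor H

/-- A coquasi-bialgebra: a coalgebra `H` with coalgebra morphisms `m : H ⊗ H → H` (not assumed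
associative) and `u : k → H`, and a convolution invertible reassociator `ω ∈ (H ⊗ H ⊗ H)^*`. -/
class CoquasiBialgebra where
  /-- `m` is a coalgebra morphism. -/
  comul_mul : Coalgebra.comul ∘ₗ LinearMap.mul' k H =
    TensorProduct.map (LinearMap.mul' k H) (LinearMap.mul' k H) ∘ₗ Coalgebra.comul
  counit_mul : Coalgebra.counit (R := k) ∘ₗ LinearMap.mul' k H = Coalgebra.counit
  /-- `u` is a coalgebra morphism. -/
  comul_one : Coalgebra.comul (R := k) (1 : H) = 1 ⊗ₜ 1
  counit_one : Coalgebra.counit (R := k) (1 : H) = 1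
  /-- The reassociator. -/
  reassociator : (CDual k (H ⊗[k] (H ⊗[k] H)))ˣ
  /-- `h₁(g₁p₁) ω(h₂,g₂,p₂) = ω(h₁,g₁,p₁) (h₂g₂)p₂`. -/
  quasi_assoc : mulR k H ∘ₗ hitL (reassociator : CDual k (H ⊗[k] (H ⊗[k] H))) =
    mulL k H ∘ₗ hitR (reassociator : CDual k (H ⊗[k] (H ⊗[k] H)))
  /-- `ω(h₁,g₁,p₁l₁) ω(h₂g₂,p₂,l₂) = ω(g₁,p₁,l₁) ω(h₁,g₂p₂,l₂) ω(h₂,g₃,p₃)`. -/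
  cocycle : pull (face3 k H) reassociator * pull (face1 k H) reassociator =
    pull (face0 k H) reassociator * pull (face2 k H) reassociator * pull (face4 k H) reassociator
  /-- `ω(h,1,g) = ε(h) ε(g)`. -/
  reassociator_one : ∀ h g : H,
    (reassociator : CDual k (H ⊗[k] (H ⊗[k] H))).ofConv (h ⊗ₜ (1 ⊗ₜ g)) =
      Coalgebra.counit (R := k) h * Coalgebra.counit (R := k) g

/-- The reassociator `ω`, as an invertible element of the convolution algebra `(H ⊗ H ⊗ H)^*`. -/
def omega [CoquasiBialgebra k H] : (CDual k (H ⊗[k] (H ⊗[k] H)))ˣ := CoquasiBialgebra.reassociator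

/-- `ω` as a functional. -/
def om [CoquasiBialgebra k H] : CDual k (H ⊗[k] (H ⊗[k] H)) := (omega k H).val

/-- The convolution inverse `ω⁻¹` as a functional. -/
def omInv [CoquasiBialgebra k H] : CDual k (H ⊗[k] (H ⊗[k] H)) := (omega k H)⁻¹.val

/-- A coquasi-Hopf algebra: a coquasi-bialgebra with a coalgebra antihomomorphism `S` (the
antipode) and functionals `α`, `β`. -/
class CoquasiHopfAlgebra extends CoquasiBialgebra k H where
  S : H →ₗ[k] H
  alpha : CDual k H
  beta : CDual k H
  comul_S : Coalgebra.comul ∘ₗ S = TensorProduct.map S S ∘ₗ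
    (TensorProduct.comm k H H).toLinearMap ∘ₗ Coalgebra.comul
  counit_S : Coalgebra.counit (R := k) ∘ₗ S = Coalgebra.counit
  /-- `S(h₁) α(h₂) h₃ = α(h) 1`. -/
  S_alpha : LinearMap.mul' k H ∘ₗ TensorProduct.map S (hitR alpha) ∘ₗ Coalgebra.comul =
    alpha.ofConv.smulRight 1
  /-- `h₁ β(h₂) S(h₃) = β(h) 1`. -/
  beta_S : LinearMap.mul' k H ∘ₗ TensorProduct.map (hitL beta) S ∘ₗ Coalgebra.comul =
    beta.ofConv.smulRight 1
  /-- `ω(h₁β(h₂), S(h₃), α(h₄)h₅) = ε(h)`. -/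
  om_S : (om k H).ofConv ∘ₗ TensorProduct.map (hitL beta)
      (TensorProduct.map S (hitR alpha) ∘ₗ Coalgebra.comul) ∘ₗ Coalgebra.comul =
    Coalgebra.counit
  /-- `ω⁻¹(S(h₁), α(h₂)h₃β(h₄), S(h₅)) = ε(h)`. -/
  omInv_S : (omInv k H).ofConv ∘ₗ TensorProduct.map S
      (TensorProduct.map (hitL beta ∘ₗ hitR alpha) S ∘ₗ Coalgebra.comul) ∘ₗ Coalgebra.comul =
    Coalgebra.counit

/-- The antipode. -/
def antipode [CoquasiHopfAlgebra k H] : H →ₗ[k] H := CoquasiHopfAlgebra.S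

variable [CoquasiBialgebra k H]

/-- A right `H`-comodule algebra: an algebra in the monoidal category of right `H`-comodules. -/
class ComoduleAlgebra (A : Type*) [NonAssocRing A] [Module k A] [SMulCommClass k A A]
    [IsScalarTower k A A] [RightComodule k H A] : Prop where
  /-- `ρ(ab) = a₀b₀ ⊗ a₁b₁`. -/
  coact_mul : coact k H A ∘ₗ LinearMap.mul' k A =
    TensorProduct.map (LinearMap.mul' k A) (LinearMap.mul' k H) ∘ₗ coact k (H ⊗[k] H) (A ⊗[k] A)
  coact_one : coact k H A 1 = 1 ⊗ₜ 1
  /-- `(ab)c = a₀(b₀c₀) ω(a₁,b₁,c₁)`. -/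
  quasi_assoc : mulL k A = mulR k A ∘ₗ act (A ⊗[k] (A ⊗[k] A)) (om k H)

variable (A : Type*) [NonAssocRing A] [Module k A] [SMulCommClass k A A]
  [IsScalarTower k A A] [RightComodule k H A] [ComoduleAlgebra k H A]

/-- The structure of an `A`-bimodule in the monoidal category of right `H`-comodules on a right
`H`-comodule `M` (a two-sided `(H, A)`-Hopf module). -/
class HopfBimodule (M : Type*) [AddCommGroup M] [Module k M] [RightComodule k H M] where
  lact : A ⊗[k] M →ₗ[k] M
  ract : M ⊗[k] A →ₗ[k] M
  /-- `ρ(am) = a₀m₀ ⊗ a₁m₁`. -/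
  coact_lact : coact k H M ∘ₗ lact =
    TensorProduct.map lact (LinearMap.mul' k H) ∘ₗ coact k (H ⊗[k] H) (A ⊗[k] M)
  /-- `ρ(ma) = m₀a₀ ⊗ m₁a₁`. -/
  coact_ract : coact k H M ∘ₗ ract =
    TensorProduct.map ract (LinearMap.mul' k H) ∘ₗ coact k (H ⊗[k] H) (M ⊗[k] A)
  one_lact : ∀ m : M, lact (1 ⊗ₜ m) = m
  ract_one : ∀ m : M, ract (m ⊗ₜ 1) = m
  /-- `(ab)m = a₀(b₀m₀) ω(a₁,b₁,m₁)`. -/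
  lact_assoc : lact ∘ₗ mulFst k A M = lact ∘ₗ lact.lTensor A ∘ₗ
    act (A ⊗[k] (A ⊗[k] M)) (om k H)
  /-- `(ma)b = m₀(a₀b₀) ω(m₁,a₁,b₁)`. -/
  ract_assoc : ract ∘ₗ ract.rTensor A ∘ₗ (TensorProduct.assoc k M A A).symm.toLinearMap =
    ract ∘ₗ (LinearMap.mul' k A).lTensor M ∘ₗ act (M ⊗[k] (A ⊗[k] A)) (om k H)
  /-- `(am)b = a₀(m₀b₀) ω(a₁,m₁,b₁)`. -/
  middle_assoc : ract ∘ₗ lact.rTensor A ∘ₗ (TensorProduct.assoc k A M A).symm.toLinearMap =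
    lact ∘ₗ ract.lTensor A ∘ₗ act (A ⊗[k] (M ⊗[k] A)) (om k H)

/-- The coinvariants `V^{co H} = {v | ρ(v) = v ⊗ 1}` of a right `H`-comodule. -/
def coinvariants (V : Type*) [AddCommGroup V] [Module k V] [RightComodule k H V] :
    Submodule k V :=
  LinearMap.ker (coact k H V - (TensorProduct.mk k V H).flip 1)

theorem mem_coinvariants {V : Type*} [AddCommGroup V] [Module k V] [RightComodule k H V] {v : V} :
    v ∈ coinvariants k H V ↔ coact k H V v = v ⊗ₜ 1 := by
  simp [coinvariants, sub_eq_zero]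

end Definitions

/-! ## Auxiliary facts -/

section CoalgMaps

variable {k : Type*} [Field k]
variable {C D E F : Type*} [AddCommGroup C] [Module k C] [Coalgebra k C]
  [AddCommGroup D] [Module k D] [Coalgebra k D] [AddCommGroup E] [Module k E] [Coalgebra k E]
  [AddCommGroup F] [Module k F] [Coalgebra k F]

theorem isCoalgMap_coe (f : C →ₗc[k] D) : IsCoalgMap (f : C →ₗ[k] D) :=
  ⟨f.map_comp_comul.symm, f.counit_comp⟩

theorem IsCoalgMap.id : IsCoalgMap (LinearMap.id : C →ₗ[k] C) :=
  isCoalgMap_coe (CoalgHom.id k C)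

theorem IsCoalgMap.comp {j : C →ₗ[k] D} {i : D →ₗ[k] E} (hi : IsCoalgMap i) (hj : IsCoalgMap j) :
    IsCoalgMap (i ∘ₗ j) := by
  refine ⟨?_, ?_⟩
  · rw [← LinearMap.comp_assoc, hi.1, LinearMap.comp_assoc, hj.1, TensorProduct.map_comp,
      LinearMap.comp_assoc]
  · rw [← LinearMap.comp_assoc, hi.2, hj.2]

theorem IsCoalgMap.map {j : C →ₗ[k] D} {i : E →ₗ[k] F} (hj : IsCoalgMap j) (hi : IsCoalgMap i) :
    IsCoalgMap (TensorProduct.map j i) :=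
  isCoalgMap_coe (Coalgebra.TensorProduct.map
    (⟨j, hj.2, hj.1.symm⟩ : C →ₗc[k] D) (⟨i, hi.2, hi.1.symm⟩ : E →ₗc[k] F))

theorem IsCoalgMap.lTensor (M : Type*) [AddCommGroup M] [Module k M] [Coalgebra k M]
    {i : E →ₗ[k] F} (hi : IsCoalgMap i) : IsCoalgMap (i.lTensor M) := IsCoalgMap.id.map hi

theorem IsCoalgMap.rTensor (M : Type*) [AddCommGroup M] [Module k M] [Coalgebra k M]
    {i : E →ₗ[k] F} (hi : IsCoalgMap i) : IsCoalgMap (i.rTensor M) := hi.map IsCoalgMap.id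

theorem IsCoalgMap.assoc_symm :
    IsCoalgMap (TensorProduct.assoc k C D E).symm.toLinearMap :=
  isCoalgMap_coe (Coalgebra.TensorProduct.assoc k k C D E).symm.toCoalgHom

theorem IsCoalgMap.lid : IsCoalgMap (TensorProduct.lid k C).toLinearMap :=
  isCoalgMap_coe (Coalgebra.TensorProduct.lid k C).toCoalgHom

theorem IsCoalgMap.rid : IsCoalgMap (TensorProduct.rid k C).toLinearMap :=
  isCoalgMap_coe (Coalgebra.TensorProduct.rid k k C).toCoalgHom

theorem IsCoalgMap.counit : IsCoalgMap (Coalgebra.counit (R := k) (A := C)) :=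
  isCoalgMap_coe (Coalgebra.counitCoalgHom k C)

theorem IsCoalgMap.mk_left {e : C} (h : Coalgebra.comul (R := k) e = e ⊗ₜ e)
    (h' : Coalgebra.counit (R := k) e = 1) : IsCoalgMap (TensorProduct.mk k C D e) := by
  refine ⟨?_, ?_⟩
  · ext d
    simp only [LinearMap.comp_apply, TensorProduct.mk_apply, TensorProduct.comul_tmul, h]
    induction Coalgebra.comul (R := k) d with
    | zero => simp
    | add _ _ h₁ h₂ => simp only [map_add, TensorProduct.tmul_add, h₁, h₂]
    | tmul x y => rfl
  · ext d
    simp [h']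

theorem IsCoalgMap.mk_right {e : C} (h : Coalgebra.comul (R := k) e = e ⊗ₜ e)
    (h' : Coalgebra.counit (R := k) e = 1) : IsCoalgMap ((TensorProduct.mk k D C).flip e) := by
  refine ⟨?_, ?_⟩
  · ext d
    simp only [LinearMap.comp_apply, LinearMap.flip_apply, TensorProduct.mk_apply,
      TensorProduct.comul_tmul, h]
    induction Coalgebra.comul (R := k) d with
    | zero => simp
    | add _ _ h₁ h₂ => simp only [map_add, TensorProduct.add_tmul, h₁, h₂]
    | tmul x y => rfl
  · ext d
    simp [h']

/-- Pull-back along a coalgebra map as a homomorphism of convolution algebras. -/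
def IsCoalgMap.pullHom {j : C →ₗ[k] D} (h : IsCoalgMap j) : CDual k D →* CDual k C where
  toFun := pull j
  map_one' := h.pull_one
  map_mul' := h.pull_mul

theorem hitL_mul (φ ψ : CDual k C) : hitL (φ * ψ) = hitL φ ∘ₗ hitL ψ := by
  let _ : RightComodule k C C :=
    ⟨Coalgebra.comul, Coalgebra.coassoc, by ext c; simp⟩
  exact act_mul (V := C) φ ψ

theorem hitL_one : hitL (1 : CDual k C) = LinearMap.id := by
  let _ : RightComodule k C C :=
    ⟨Coalgebra.comul, Coalgebra.coassoc, by ext c; simp⟩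
  exact act_one (V := C)

theorem hitR_one : hitR (1 : CDual k C) = LinearMap.id := by
  ext c
  change TensorProduct.lid k C (Coalgebra.counit.rTensor C (Coalgebra.comul c)) = c
  simp

theorem hitR_hitL (φ ψ : CDual k C) : hitR ψ ∘ₗ hitL φ = hitL φ ∘ₗ hitR ψ := by
  let _ : RightComodule k C C :=
    ⟨Coalgebra.comul, Coalgebra.coassoc, by ext c; simp⟩
  ext c
  have h : Coalgebra.comul (hitL φ c) = (hitL φ).lTensor C (Coalgebra.comul (R := k) c) :=
    LinearMap.congr_fun (coact_act (V := C) φ) c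
  conv_lhs => rw [hitR, LinearMap.comp_apply, LinearMap.comp_apply, LinearMap.comp_apply, h]
  conv_rhs => rw [LinearMap.comp_apply, hitR]
  simp only [LinearMap.comp_apply, LinearEquiv.coe_coe]
  induction Coalgebra.comul (R := k) c with
  | zero => simp
  | add _ _ h₁ h₂ => simp only [map_add, h₁, h₂]
  | tmul x y => simp

theorem hitR_mul (φ ψ : CDual k C) : hitR (φ * ψ) = hitR ψ ∘ₗ hitR φ := by
  ext c
  have h := congrArg ((TensorProduct.lid k C).toLinearMap ∘ₗ
    (TensorProduct.lid k C).toLinearMap.lTensor k ∘ₗ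
    TensorProduct.map φ.ofConv (ψ.ofConv.rTensor C)) (Coalgebra.coassoc_apply (R := k) c)
  refine Eq.trans ?_ (h.trans ?_)
  · simp only [hitR, LinearMap.comp_apply, LinearEquiv.coe_coe]
    induction Coalgebra.comul (R := k) c with
    | zero => simp
    | add _ _ h₁ h₂ => simp only [map_add, h₁, h₂]
    | tmul x y =>
    simp only [LinearMap.rTensor_tmul, LinearMap.convMul_def, LinearMap.comp_apply]
    induction Coalgebra.comul (R := k) x with
    | zero => simp
    | add _ _ h₁ h₂ => simp only [map_add, TensorProduct.add_tmul, h₁, h₂]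
    | tmul x z => simp [smul_smul, mul_comm]
  · simp only [hitR, LinearMap.comp_apply, LinearEquiv.coe_coe]
    induction Coalgebra.comul (R := k) c with
    | zero => simp
    | add _ _ h₁ h₂ => simp only [map_add, h₁, h₂]
    | tmul x y => simp

variable {V W : Type*} [AddCommGroup V] [Module k V] [AddCommGroup W] [Module k W]
  [RightComodule k C V] [RightComodule k D W]

theorem IsColin.lTensor {X : Type*} [AddCommGroup X] [Module k X] [RightComodule k E X]
    {j : C →ₗ[k] D} {g : V →ₗ[k] W} (h : IsColin j g) :
    IsColin (j.lTensor E) (g.lTensor X) := IsColin.id.map h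

theorem IsColin.rTensor {X : Type*} [AddCommGroup X] [Module k X] [RightComodule k E X]
    {j : C →ₗ[k] D} {g : V →ₗ[k] W} (h : IsColin j g) :
    IsColin (j.rTensor E) (g.rTensor X) := h.map IsColin.id

theorem IsColin.act_apply {j : C →ₗ[k] D} {g : V →ₗ[k] W} (h : IsColin j g) (φ : CDual k D)
    (v : V) : act W φ (g v) = g (act V (pull j φ) v) :=
  LinearMap.congr_fun (h.act_comp φ) v

theorem IsColin.mk_left {e : C} {v : V} (h : coact k C V v = v ⊗ₜ e) :
    IsColin (TensorProduct.mk k C D e) (TensorProduct.mk k V W v) := by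
  unfold IsColin
  ext w
  simp only [LinearMap.comp_apply, TensorProduct.mk_apply, coact_tmul, h]
  induction coact k D W w with
  | zero => simp
  | add _ _ h₁ h₂ => simp only [map_add, TensorProduct.tmul_add, h₁, h₂]
  | tmul x y => rfl

theorem IsColin.mk_right {e : C} {v : V} (h : coact k C V v = v ⊗ₜ e) :
    IsColin ((TensorProduct.mk k D C).flip e) ((TensorProduct.mk k W V).flip v) := by
  unfold IsColin
  ext w
  simp only [LinearMap.comp_apply, LinearMap.flip_apply, TensorProduct.mk_apply, coact_tmul, h]
  induction coact k D W w with
  | zero => simp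
  | add _ _ h₁ h₂ => simp only [map_add, TensorProduct.add_tmul, h₁, h₂]
  | tmul x y => rfl

end CoalgMaps

section Reassociator

variable (k : Type*) [Field k]
variable (H : Type*) [NonAssocRing H] [Module k H] [SMulCommClass k H H] [IsScalarTower k H H]
  [Coalgebra k H] [CoquasiBialgebra k H]

theorem isCoalgMap_mul : IsCoalgMap (LinearMap.mul' k H) :=
  ⟨CoquasiBialgebra.comul_mul, CoquasiBialgebra.counit_mul⟩

theorem isCoalgMap_mulFst (C : Type*) [AddCommGroup C] [Module k C] [Coalgebra k C] :
    IsCoalgMap (mulFst k H C) :=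
  ((isCoalgMap_mul k H).rTensor C).comp IsCoalgMap.assoc_symm

theorem isCoalgMap_one_left (C : Type*) [AddCommGroup C] [Module k C] [Coalgebra k C] :
    IsCoalgMap (TensorProduct.mk k H C 1) :=
  IsCoalgMap.mk_left CoquasiBialgebra.comul_one CoquasiBialgebra.counit_one

theorem isCoalgMap_one_right (C : Type*) [AddCommGroup C] [Module k C] [Coalgebra k C] :
    IsCoalgMap ((TensorProduct.mk k C H).flip 1) :=
  IsCoalgMap.mk_right CoquasiBialgebra.comul_one CoquasiBialgebra.counit_one

theorem isCoalgMap_face0 : IsCoalgMap (face0 k H) :=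
  IsCoalgMap.lid.comp (IsCoalgMap.counit.rTensor _)

theorem isCoalgMap_face1 : IsCoalgMap (face1 k H) := isCoalgMap_mulFst k H _

theorem isCoalgMap_face2 : IsCoalgMap (face2 k H) := (isCoalgMap_mulFst k H H).lTensor H

theorem isCoalgMap_face3 : IsCoalgMap (face3 k H) := ((isCoalgMap_mul k H).lTensor H).lTensor H

theorem isCoalgMap_face4 : IsCoalgMap (face4 k H) :=
  ((IsCoalgMap.rid.comp (IsCoalgMap.counit.lTensor H)).lTensor H).lTensor H

/-- The pull-back of `ω` along `face0`. -/
def w0 : (CDual k (H ⊗[k] (H ⊗[k] (H ⊗[k] H))))ˣ :=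
  Units.map (isCoalgMap_face0 k H).pullHom (omega k H)

/-- The pull-back of `ω` along `face1`. -/
def w1 : (CDual k (H ⊗[k] (H ⊗[k] (H ⊗[k] H))))ˣ :=
  Units.map (isCoalgMap_face1 k H).pullHom (omega k H)

/-- The pull-back of `ω` along `face2`. -/
def w2 : (CDual k (H ⊗[k] (H ⊗[k] (H ⊗[k] H))))ˣ :=
  Units.map (isCoalgMap_face2 k H).pullHom (omega k H)

/-- The pull-back of `ω` along `face3`. -/
def w3 : (CDual k (H ⊗[k] (H ⊗[k] (H ⊗[k] H))))ˣ :=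
  Units.map (isCoalgMap_face3 k H).pullHom (omega k H)

/-- The pull-back of `ω` along `face4`. -/
def w4 : (CDual k (H ⊗[k] (H ⊗[k] (H ⊗[k] H))))ˣ :=
  Units.map (isCoalgMap_face4 k H).pullHom (omega k H)

theorem w_cocycle : w3 k H * w1 k H = w0 k H * w2 k H * w4 k H :=
  Units.ext CoquasiBialgebra.cocycle

theorem om_mul_omInv : om k H * omInv k H = 1 := (omega k H).mul_inv

theorem omInv_mul_om : omInv k H * om k H = 1 := (omega k H).inv_mul

theorem om_one_mid (h g : H) : (om k H).ofConv (h ⊗ₜ (1 ⊗ₜ g)) =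
    Coalgebra.counit (R := k) h * Coalgebra.counit (R := k) g :=
  CoquasiBialgebra.reassociator_one h g

/-- Inverse of a pull-back which is trivial. -/
theorem pull_omInv_eq_one {C : Type*} [AddCommGroup C] [Module k C] [Coalgebra k C]
    {j : C →ₗ[k] H ⊗[k] (H ⊗[k] H)} (hj : IsCoalgMap j) (h : pull j (om k H) = 1) :
    pull j (omInv k H) = 1 := by
  have h' := congrArg (pull j) (om_mul_omInv k H)
  rwa [hj.pull_mul, h, one_mul, hj.pull_one] at h'

theorem pull_mid : pull ((TensorProduct.mk k H H 1).lTensor H) (om k H) = 1 := by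
  apply WithConv.ofConv_injective
  refine TensorProduct.ext' fun h g => ?_
  refine (om_one_mid k H h g).trans ?_
  simp [LinearMap.convOne_def, mul_comm]

theorem pull_comp {C D E : Type*} [AddCommGroup C] [Module k C] [AddCommGroup D] [Module k D]
    [AddCommGroup E] [Module k E] (i : D →ₗ[k] E) (j : C →ₗ[k] D) (φ : CDual k E) :
    pull j (pull i φ) = pull (i ∘ₗ j) φ := rfl

theorem pull_left : pull (TensorProduct.mk k H (H ⊗[k] H) 1) (om k H) = 1 := by
  have hι := (isCoalgMap_one_left k H (H ⊗[k] H)).lTensor H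
  have h := congrArg (pull ((TensorProduct.mk k H (H ⊗[k] H) 1).lTensor H))
    (CoquasiBialgebra.cocycle (k := k) (H := H))
  change pull _ (pull _ (om k H) * pull _ (om k H)) =
    pull _ (pull _ (om k H) * pull _ (om k H) * pull _ (om k H)) at h
  simp only [hι.pull_mul, pull_comp] at h
  have e3 : pull (face3 k H ∘ₗ (TensorProduct.mk k H (H ⊗[k] H) 1).lTensor H) (om k H) = 1 := by
    have : face3 k H ∘ₗ (TensorProduct.mk k H (H ⊗[k] H) 1).lTensor H =
        (TensorProduct.mk k H H 1).lTensor H ∘ₗ (LinearMap.mul' k H).lTensor H := by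
      ext; simp [face3]
    rw [this, ← pull_comp, pull_mid]
    exact ((isCoalgMap_mul k H).lTensor H).pull_one
  have e1 : face1 k H ∘ₗ (TensorProduct.mk k H (H ⊗[k] H) 1).lTensor H = LinearMap.id := by
    ext; simp [face1, mulFst]
  have e2 : face2 k H ∘ₗ (TensorProduct.mk k H (H ⊗[k] H) 1).lTensor H = LinearMap.id := by
    ext; simp [face2, mulFst]
  have e4 : pull (face4 k H ∘ₗ (TensorProduct.mk k H (H ⊗[k] H) 1).lTensor H) (om k H) = 1 := by
    have : face4 k H ∘ₗ (TensorProduct.mk k H (H ⊗[k] H) 1).lTensor H =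
        (TensorProduct.mk k H H 1).lTensor H ∘ₗ (((TensorProduct.rid k H).toLinearMap ∘ₗ
    (Coalgebra.counit (R := k) (A := H)).lTensor H).lTensor H) := by
      ext; simp [face4]
    rw [this, ← pull_comp, pull_mid]
    exact ((IsCoalgMap.rid.comp (IsCoalgMap.counit.lTensor H)).lTensor H).pull_one
  have hid : pull LinearMap.id (om k H) = om k H := rfl
  rw [e3, e1, e2, e4, hid, one_mul, mul_one] at h
  have h2 := congrArg (· * omInv k H) h
  simp only [mul_assoc, om_mul_omInv, mul_one] at h2
  have h3 := congrArg (pull (TensorProduct.mk k H (H ⊗[k] H) 1)) h2.symm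
  rw [(isCoalgMap_one_left k H (H ⊗[k] H)).pull_one, pull_comp] at h3
  have e0 : (face0 k H ∘ₗ (TensorProduct.mk k H (H ⊗[k] H) 1).lTensor H) ∘ₗ
      TensorProduct.mk k H (H ⊗[k] H) 1 = TensorProduct.mk k H (H ⊗[k] H) 1 := by
    ext; simp [face0, CoquasiBialgebra.counit_one]
  rwa [e0] at h3

theorem pull_right : pull (((TensorProduct.mk k H H).flip 1).lTensor H) (om k H) = 1 := by
  have hι := ((isCoalgMap_one_left k H H).lTensor H).lTensor H
  have h := congrArg (pull (((TensorProduct.mk k H H 1).lTensor H).lTensor H))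
    (CoquasiBialgebra.cocycle (k := k) (H := H))
  change pull _ (pull _ (om k H) * pull _ (om k H)) =
    pull _ (pull _ (om k H) * pull _ (om k H) * pull _ (om k H)) at h
  simp only [hι.pull_mul, pull_comp] at h
  have e3 : face3 k H ∘ₗ ((TensorProduct.mk k H H 1).lTensor H).lTensor H = LinearMap.id := by
    ext; simp [face3]
  have e2 : face2 k H ∘ₗ ((TensorProduct.mk k H H 1).lTensor H).lTensor H = LinearMap.id := by
    ext; simp [face2, mulFst]
  have e1 : pull (face1 k H ∘ₗ ((TensorProduct.mk k H H 1).lTensor H).lTensor H) (om k H) = 1 := by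
    have : face1 k H ∘ₗ ((TensorProduct.mk k H H 1).lTensor H).lTensor H =
        (TensorProduct.mk k H H 1).lTensor H ∘ₗ mulFst k H H := by
      ext; simp [face1, mulFst]
    rw [this, ← pull_comp, pull_mid]
    exact (isCoalgMap_mulFst k H H).pull_one
  have e0 : pull (face0 k H ∘ₗ ((TensorProduct.mk k H H 1).lTensor H).lTensor H) (om k H) = 1 := by
    have : face0 k H ∘ₗ ((TensorProduct.mk k H H 1).lTensor H).lTensor H =
        (TensorProduct.mk k H H 1).lTensor H ∘ₗ ((TensorProduct.lid k (H ⊗[k] H)).toLinearMap ∘ₗ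
          (Coalgebra.counit (R := k) (A := H)).rTensor (H ⊗[k] H)) := by
      ext; simp [face0]
    rw [this, ← pull_comp, pull_mid]
    exact (IsCoalgMap.lid.comp (IsCoalgMap.counit.rTensor _)).pull_one
  have hid : pull LinearMap.id (om k H) = om k H := rfl
  rw [e3, e1, e2, e0, hid, one_mul, mul_one] at h
  have h2 := congrArg (omInv k H * ·) h
  simp only [← mul_assoc, omInv_mul_om, one_mul] at h2
  have h3 := congrArg (pull (((TensorProduct.mk k H H).flip 1).lTensor H)) h2.symm
  rw [((isCoalgMap_one_right k H H).lTensor H).pull_one, pull_comp] at h3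
  have e4 : (face4 k H ∘ₗ ((TensorProduct.mk k H H 1).lTensor H).lTensor H) ∘ₗ
      ((TensorProduct.mk k H H).flip 1).lTensor H = ((TensorProduct.mk k H H).flip 1).lTensor H := by
    ext; simp [face4, CoquasiBialgebra.counit_one]
  rwa [e4] at h3

/-- `(hg)k` and `h(gk)` are intertwined by `ω⁻¹` as well. -/
theorem quasi_assoc_inv : mulL k H ∘ₗ hitL (omInv k H) = mulR k H ∘ₗ hitR (omInv k H) := by
  have h : mulR k H ∘ₗ hitL (om k H) = mulL k H ∘ₗ hitR (om k H) := CoquasiBialgebra.quasi_assoc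
  calc mulL k H ∘ₗ hitL (omInv k H)
      = mulL k H ∘ₗ hitR (omInv k H * om k H) ∘ₗ hitL (omInv k H) := by
        rw [omInv_mul_om, hitR_one, LinearMap.id_comp]
    _ = (mulL k H ∘ₗ hitR (om k H)) ∘ₗ hitL (omInv k H) ∘ₗ hitR (omInv k H) := by
        rw [hitR_mul, ← hitR_hitL]; rfl
    _ = mulR k H ∘ₗ hitL (om k H * omInv k H) ∘ₗ hitR (omInv k H) := by
        rw [← h, hitL_mul]; rfl
    _ = mulR k H ∘ₗ hitR (omInv k H) := by
        rw [om_mul_omInv, hitL_one, LinearMap.id_comp]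

end Reassociator

section FreeBimodule

variable (k : Type*) [Field k]
variable (H : Type*) [NonAssocRing H] [Module k H] [SMulCommClass k H H] [IsScalarTower k H H]
  [Coalgebra k H] [CoquasiBialgebra k H]

/-- The codiagonal coaction `v ⊗ w ↦ v₀ ⊗ w₀ ⊗ v₁w₁` of `H` on the tensor product of two right
`H`-comodules. -/
@[reducible] def codiagonal (V W : Type*) [AddCommGroup V] [Module k V] [AddCommGroup W]
    [Module k W] [RightComodule k H V] [RightComodule k H W] : RightComodule k H (V ⊗[k] W) :=
  pushComodule (C := H ⊗[k] H) (LinearMap.mul' k H) (isCoalgMap_mul k H)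

variable (A : Type*) [NonAssocRing A] [Module k A] [SMulCommClass k A A]
  [IsScalarTower k A A] [RightComodule k H A] [ComoduleAlgebra k H A]

attribute [local instance] codiagonal

theorem isColin_codiagonal (V W : Type*) [AddCommGroup V] [Module k V] [AddCommGroup W]
    [Module k W] [RightComodule k H V] [RightComodule k H W] :
    IsColin (C := H ⊗[k] H) (D := H) (LinearMap.mul' k H)
      (LinearMap.id : V ⊗[k] W →ₗ[k] V ⊗[k] W) := rfl

theorem isColin_mul : IsColin (LinearMap.mul' k H) (LinearMap.mul' k A) :=
  ComoduleAlgebra.coact_mul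

theorem isColin_mulFst (C V : Type*) [AddCommGroup C] [Module k C] [Coalgebra k C]
    [AddCommGroup V] [Module k V] [RightComodule k C V] :
    IsColin (mulFst k H C) (mulFst k A V) :=
  (isColin_mul k H A).rTensor.comp IsColin.assoc_symm

theorem mulL_eq (t : A ⊗[k] (A ⊗[k] A)) :
    mulL k A t = mulR k A (act (A ⊗[k] (A ⊗[k] A)) (om k H) t) :=
  LinearMap.congr_fun (ComoduleAlgebra.quasi_assoc (k := k) (H := H)) t

/-- The left action `a(c ⊗ d) = a₀c₀ ⊗ d₀ ω⁻¹(a₁,c₁,d₁)` on `A ⊗ A`. -/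
def freeL : A ⊗[k] (A ⊗[k] A) →ₗ[k] A ⊗[k] A :=
  mulFst k A A ∘ₗ act (A ⊗[k] (A ⊗[k] A)) (omInv k H)

/-- The right action `(c ⊗ d)b = c₀ ⊗ d₀b₀ ω(c₁,d₁,b₁)` on `A ⊗ A`. -/
def freeR : (A ⊗[k] A) ⊗[k] A →ₗ[k] A ⊗[k] A :=
  (LinearMap.mul' k A).lTensor A ∘ₗ act (A ⊗[k] (A ⊗[k] A)) (om k H) ∘ₗ
    (TensorProduct.assoc k A A A).toLinearMap

variable {k H A}

theorem act_w_inv {V : Type*} [AddCommGroup V] [Module k V] {C : Type*} [AddCommGroup C]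
    [Module k C] [Coalgebra k C] [RightComodule k C V] (φ ψ : CDual k C) (v : V) :
    act V φ (act V ψ v) = act V (φ * ψ) v := by
  rw [act_mul]; rfl

variable (k H A)

/-- `ρ` of `ω · t`, multiplied out. -/
theorem coact_act_om (t : A ⊗[k] (A ⊗[k] A)) :
    (mulR k H).lTensor _ (coact k (H ⊗[k] (H ⊗[k] H)) (A ⊗[k] (A ⊗[k] A))
      (act (A ⊗[k] (A ⊗[k] A)) (om k H) t)) =
    TensorProduct.map (act (A ⊗[k] (A ⊗[k] A)) (om k H)) (mulL k H)
      (coact k (H ⊗[k] (H ⊗[k] H)) (A ⊗[k] (A ⊗[k] A)) t) := by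
  have h1 := LinearMap.congr_fun (coact_act (V := A ⊗[k] (A ⊗[k] A)) (om k H)) t
  have h2 := LinearMap.congr_fun (act_coact (V := A ⊗[k] (A ⊗[k] A)) (om k H)) t
  simp only [LinearMap.comp_apply] at h1 h2
  rw [h1, ← LinearMap.comp_apply, ← LinearMap.lTensor_comp]
  have h3 : mulR k H ∘ₗ hitL (om k H) = mulL k H ∘ₗ hitR (om k H) := CoquasiBialgebra.quasi_assoc
  rw [h3, LinearMap.lTensor_comp, LinearMap.comp_apply, ← h2, ← LinearMap.comp_apply,
    LinearMap.lTensor_comp_rTensor]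

theorem coact_act_omInv (t : A ⊗[k] (A ⊗[k] A)) :
    (mulL k H).lTensor _ (coact k (H ⊗[k] (H ⊗[k] H)) (A ⊗[k] (A ⊗[k] A))
      (act (A ⊗[k] (A ⊗[k] A)) (omInv k H) t)) =
    TensorProduct.map (act (A ⊗[k] (A ⊗[k] A)) (omInv k H)) (mulR k H)
      (coact k (H ⊗[k] (H ⊗[k] H)) (A ⊗[k] (A ⊗[k] A)) t) := by
  have h1 := LinearMap.congr_fun (coact_act (V := A ⊗[k] (A ⊗[k] A)) (omInv k H)) t
  have h2 := LinearMap.congr_fun (act_coact (V := A ⊗[k] (A ⊗[k] A)) (omInv k H)) t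
  simp only [LinearMap.comp_apply] at h1 h2
  rw [h1, ← LinearMap.comp_apply, ← LinearMap.lTensor_comp, quasi_assoc_inv,
    LinearMap.lTensor_comp, LinearMap.comp_apply, ← h2, ← LinearMap.comp_apply,
    LinearMap.lTensor_comp_rTensor]

theorem free_coact_lact : coact k H (A ⊗[k] A) ∘ₗ freeL k H A =
    TensorProduct.map (freeL k H A) (LinearMap.mul' k H) ∘ₗ
      coact k (H ⊗[k] H) (A ⊗[k] (A ⊗[k] A)) := by
  refine LinearMap.ext fun t => ?_
  have h1 := LinearMap.congr_fun (((isColin_codiagonal k H A A).lTensor (E := H) (X := A)))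
    t
  have h2 := LinearMap.congr_fun (isColin_mulFst k H A H A)
    (act (A ⊗[k] (A ⊗[k] A)) (omInv k H) t)
  have h3 := congrArg ((mulFst k A A).rTensor H) (coact_act_omInv k H A t)
  simp only [LinearMap.comp_apply, LinearMap.lTensor_id, LinearMap.id_apply] at h1 h2
  rw [LinearMap.comp_apply, LinearMap.comp_apply, h1]
  change (LinearMap.mul' k H).lTensor _ (coact k (H ⊗[k] H) (A ⊗[k] A)
    (mulFst k A A (act (A ⊗[k] (A ⊗[k] A)) (omInv k H) t))) = _
  rw [h2]
  refine Eq.trans ?_ (h3.trans ?_)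
  · generalize coact k (H ⊗[k] (H ⊗[k] H)) (A ⊗[k] (A ⊗[k] A)) _ = p
    induction p with
    | zero => simp only [map_zero]
    | add _ _ h₁ h₂ => simp only [map_add, h₁, h₂]
    | tmul x y => rfl
  · generalize coact k (H ⊗[k] (H ⊗[k] H)) (A ⊗[k] (A ⊗[k] A)) _ = p
    induction p with
    | zero => simp only [map_zero]
    | add _ _ h₁ h₂ => simp only [map_add, h₁, h₂]
    | tmul x y => rfl

theorem free_coact_ract : coact k H (A ⊗[k] A) ∘ₗ freeR k H A =
    TensorProduct.map (freeR k H A) (LinearMap.mul' k H) ∘ₗ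
      coact k (H ⊗[k] H) ((A ⊗[k] A) ⊗[k] A) := by
  refine LinearMap.ext fun t => ?_
  have h1 := LinearMap.congr_fun (((isColin_codiagonal k H A A).rTensor (E := H) (X := A)))
    t
  have h0 := LinearMap.congr_fun (IsColin.assoc (k := k) (C := H) (D := H) (E := H)
    (V := A) (W := A) (X := A)) t
  have h2 := LinearMap.congr_fun ((isColin_mul k H A).lTensor (E := H) (X := A))
    (act (A ⊗[k] (A ⊗[k] A)) (om k H) (TensorProduct.assoc k A A A t))
  have h3 := congrArg (((LinearMap.mul' k A).lTensor A).rTensor H)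
    (coact_act_om k H A (TensorProduct.assoc k A A A t))
  simp only [LinearMap.comp_apply, LinearMap.rTensor_id, LinearMap.id_apply,
    LinearEquiv.coe_coe] at h0 h1 h2
  rw [LinearMap.comp_apply, LinearMap.comp_apply, h1]
  change (LinearMap.mul' k H).lTensor _ (coact k (H ⊗[k] H) (A ⊗[k] A)
    ((LinearMap.mul' k A).lTensor A (act (A ⊗[k] (A ⊗[k] A)) (om k H)
      (TensorProduct.assoc k A A A t)))) = _
  rw [h2]
  refine Eq.trans ?_ (h3.trans ?_)
  · generalize coact k (H ⊗[k] (H ⊗[k] H)) (A ⊗[k] (A ⊗[k] A)) _ = p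
    induction p with
    | zero => simp only [map_zero]
    | add _ _ h₁ h₂ => simp only [map_add, h₁, h₂]
    | tmul x y => rfl
  · rw [h0]
    generalize coact k ((H ⊗[k] H) ⊗[k] H) ((A ⊗[k] A) ⊗[k] A) _ = p
    induction p with
    | zero => simp only [map_zero]
    | add _ _ h₁ h₂ => simp only [map_add, h₁, h₂]
    | tmul x y =>
    simp [freeR, mulL, TensorProduct.map_tmul]

theorem free_one_lact (x : A ⊗[k] A) : freeL k H A (1 ⊗ₜ x) = x := by
  have h := (IsColin.mk_left (k := k) (D := H ⊗[k] H) (W := A ⊗[k] A)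
    (ComoduleAlgebra.coact_one (k := k) (H := H) (A := A))).act_apply (omInv k H) x
  rw [pull_omInv_eq_one k H (isCoalgMap_one_left k H _) (pull_left k H), act_one] at h
  simp only [TensorProduct.mk_apply, LinearMap.id_apply] at h
  rw [freeL, LinearMap.comp_apply, h]
  have e : mulFst k A A ∘ₗ TensorProduct.mk k A (A ⊗[k] A) 1 = LinearMap.id := by
    ext; simp [mulFst]
  exact LinearMap.congr_fun e x

theorem free_ract_one (x : A ⊗[k] A) : freeR k H A (x ⊗ₜ 1) = x := by
  have h := ((IsColin.mk_right (k := k) (D := H) (W := A)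
    (ComoduleAlgebra.coact_one (k := k) (H := H) (A := A))).lTensor (E := H) (X := A)).act_apply
      (om k H) x
  rw [pull_right, act_one] at h
  have e : (TensorProduct.assoc k A A A).toLinearMap ∘ₗ (TensorProduct.mk k (A ⊗[k] A) A).flip 1 =
      ((TensorProduct.mk k A A).flip 1).lTensor A := by
    ext; simp
  have e' : (LinearMap.mul' k A).lTensor A ∘ₗ ((TensorProduct.mk k A A).flip 1).lTensor A =
      LinearMap.id := by
    ext; simp
  have hx := LinearMap.congr_fun e x
  have hx' := LinearMap.congr_fun e' x
  simp only [LinearMap.id_apply, LinearMap.comp_apply, LinearEquiv.coe_coe, LinearMap.flip_apply,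
    TensorProduct.mk_apply] at h hx hx'
  simp only [freeR, LinearMap.comp_apply, LinearEquiv.coe_coe, hx, h, hx']

/-- `a ⊗ (b ⊗ (c ⊗ d)) ↦ (a ⊗ (b ⊗ c)) ⊗ d`. -/
def regroup (X : Type*) [AddCommGroup X] [Module k X] :
    X ⊗[k] (X ⊗[k] (X ⊗[k] X)) →ₗ[k] (X ⊗[k] (X ⊗[k] X)) ⊗[k] X :=
  (TensorProduct.assoc k X (X ⊗[k] X) X).symm.toLinearMap ∘ₗ
    (TensorProduct.assoc k X X X).symm.toLinearMap.lTensor X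

theorem rTensor_act_regroup (φ : CDual k (H ⊗[k] (H ⊗[k] H)))
    (s : A ⊗[k] (A ⊗[k] (A ⊗[k] A))) :
    (act (A ⊗[k] (A ⊗[k] A)) φ).rTensor A (regroup k A s) =
      regroup k A (act (C := H ⊗[k] (H ⊗[k] (H ⊗[k] H))) (A ⊗[k] (A ⊗[k] (A ⊗[k] A)))
        (pull (face4 k H) φ) s) := by
  have h : IsColin (regroup k H) (regroup k A) :=
    (IsColin.assoc_symm (k := k) (C := H) (D := H ⊗[k] H) (E := H)
      (V := A) (W := A ⊗[k] A) (X := A)).comp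
      ((IsColin.assoc_symm (k := k) (C := H) (D := H) (E := H)
        (V := A) (W := A) (X := A)).lTensor (E := H) (X := A))
  rw [rTensor_act (C := H ⊗[k] (H ⊗[k] H)) (D := H), h.act_apply, pull_comp]
  congr 4
  ext
  simp [regroup, face4, TensorProduct.tmul_smul]

theorem lTensor_act_face0 (φ : CDual k (H ⊗[k] (H ⊗[k] H)))
    (s : A ⊗[k] (A ⊗[k] (A ⊗[k] A))) :
    (act (A ⊗[k] (A ⊗[k] A)) φ).lTensor A s =
      act (C := H ⊗[k] (H ⊗[k] (H ⊗[k] H))) (A ⊗[k] (A ⊗[k] (A ⊗[k] A)))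
        (pull (face0 k H) φ) s := by
  rw [lTensor_act (C := H) (D := H ⊗[k] (H ⊗[k] H))]; rfl

theorem free_lact_assoc : freeL k H A ∘ₗ mulFst k A (A ⊗[k] A) =
    freeL k H A ∘ₗ (freeL k H A).lTensor A ∘ₗ
      act (A ⊗[k] (A ⊗[k] (A ⊗[k] A))) (om k H) := by
  refine LinearMap.ext fun t => ?_
  have hL : freeL k H A (mulFst k A (A ⊗[k] A) t) =
      (mulR k A).rTensor A (regroup k A (act (A ⊗[k] (A ⊗[k] (A ⊗[k] A)))
        ((w4 k H) * (w1 k H)⁻¹).val t)) := by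
    have e : mulFst k A A ∘ₗ mulFst k A (A ⊗[k] A) = (mulL k A).rTensor A ∘ₗ regroup k A := by
      ext; simp [mulFst, mulL, regroup]
    have e' : mulL k A = mulR k A ∘ₗ act (A ⊗[k] (A ⊗[k] A)) (om k H) :=
      ComoduleAlgebra.quasi_assoc
    rw [freeL, LinearMap.comp_apply, (isColin_mulFst k H A (H ⊗[k] H) (A ⊗[k] A)).act_apply,
      ← LinearMap.comp_apply, e, e', LinearMap.rTensor_comp, LinearMap.comp_apply,
      LinearMap.comp_apply, rTensor_act_regroup, act_w_inv]
    rfl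
  have hR : freeL k H A ((freeL k H A).lTensor A
      (act (A ⊗[k] (A ⊗[k] (A ⊗[k] A))) (om k H) t)) =
      (mulR k A).rTensor A (regroup k A (act (A ⊗[k] (A ⊗[k] (A ⊗[k] A)))
        ((w2 k H)⁻¹ * (w0 k H)⁻¹ * w3 k H).val t)) := by
    have h1 := (((isColin_codiagonal k H A A).lTensor (E := H) (X := A)).lTensor
      (E := H) (X := A)).act_apply (om k H) t
    simp only [LinearMap.lTensor_id, LinearMap.id_apply] at h1
    have e : mulFst k A A ∘ₗ (mulFst k A A).lTensor A = (mulR k A).rTensor A ∘ₗ regroup k A := by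
      ext; simp [mulFst, mulR, regroup]
    rw [h1, freeL, LinearMap.lTensor_comp, LinearMap.comp_apply, LinearMap.comp_apply,
      lTensor_act_face0, ((isColin_mulFst k H A H A).lTensor (E := H) (X := A)).act_apply,
      ← LinearMap.comp_apply (mulFst k A A), e, act_w_inv, act_w_inv]
    simp only [Units.val_mul, mul_assoc]
    rfl
  have hw : w4 k H * (w1 k H)⁻¹ = (w2 k H)⁻¹ * (w0 k H)⁻¹ * w3 k H := by
    have := w_cocycle k H
    rw [mul_inv_eq_iff_eq_mul, mul_assoc, this]
    group
  simp only [LinearMap.comp_apply]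
  rw [hL, hR, hw]

theorem free_ract_assoc : freeR k H A ∘ₗ (freeR k H A).rTensor A ∘ₗ
      (TensorProduct.assoc k (A ⊗[k] A) A A).symm.toLinearMap =
    freeR k H A ∘ₗ (LinearMap.mul' k A).lTensor (A ⊗[k] A) ∘ₗ
      act ((A ⊗[k] A) ⊗[k] (A ⊗[k] A)) (om k H) := by
  refine LinearMap.ext fun t => ?_
  obtain ⟨s, rfl⟩ := (TensorProduct.assoc k A A (A ⊗[k] A)).symm.surjective t
  have hL : freeR k H A ((freeR k H A).rTensor A ((TensorProduct.assoc k (A ⊗[k] A) A A).symm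
      ((TensorProduct.assoc k A A (A ⊗[k] A)).symm s))) =
      (mulR k A).lTensor A (act (A ⊗[k] (A ⊗[k] (A ⊗[k] A)))
        (w0 k H * w2 k H * w4 k H).val s) := by
    have e1 : (TensorProduct.assoc k A A A).toLinearMap.rTensor A ∘ₗ
        (TensorProduct.assoc k (A ⊗[k] A) A A).symm.toLinearMap ∘ₗ
        (TensorProduct.assoc k A A (A ⊗[k] A)).symm.toLinearMap = regroup k A := by
      ext; simp [regroup]
    have e2 : (TensorProduct.assoc k A A A).toLinearMap ∘ₗ
        ((LinearMap.mul' k A).lTensor A).rTensor A ∘ₗ regroup k A =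
        (mulFst k A A).lTensor A := by
      ext; simp [regroup, mulFst]
    have e3 : (LinearMap.mul' k A).lTensor A ∘ₗ (mulFst k A A).lTensor A =
        (mulR k A).lTensor A ∘ₗ (act (A ⊗[k] (A ⊗[k] A)) (om k H)).lTensor A := by
      have e' : mulL k A = mulR k A ∘ₗ act (A ⊗[k] (A ⊗[k] A)) (om k H) :=
        ComoduleAlgebra.quasi_assoc
      rw [← LinearMap.lTensor_comp, ← LinearMap.lTensor_comp, ← e']
      rfl
    have e1s := LinearMap.congr_fun e1 s
    have e2s := fun s => LinearMap.congr_fun e2 s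
    have e3s := fun s => LinearMap.congr_fun e3 s
    simp only [LinearMap.comp_apply, LinearEquiv.coe_coe] at e1s e2s e3s
    simp only [freeR, LinearMap.rTensor_comp, LinearMap.comp_apply, LinearEquiv.coe_coe]
    rw [e1s, rTensor_act_regroup, e2s,
      ((isColin_mulFst k H A H A).lTensor (E := H) (X := A)).act_apply, e3s,
      lTensor_act_face0, act_w_inv, act_w_inv]
    rfl
  have hR : freeR k H A ((LinearMap.mul' k A).lTensor (A ⊗[k] A)
      (act ((A ⊗[k] A) ⊗[k] (A ⊗[k] A)) (om k H)
        ((TensorProduct.assoc k A A (A ⊗[k] A)).symm s))) =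
      (mulR k A).lTensor A (act (A ⊗[k] (A ⊗[k] (A ⊗[k] A)))
        (w3 k H * w1 k H).val s) := by
    have h1 := ((isColin_codiagonal k H A A).rTensor (E := H ⊗[k] H) (X := A ⊗[k] A)).act_apply
      (om k H) ((TensorProduct.assoc k A A (A ⊗[k] A)).symm s)
    simp only [LinearMap.rTensor_id, LinearMap.id_apply] at h1
    have h2 := (IsColin.assoc_symm (k := k) (C := H) (D := H) (E := H ⊗[k] H)
      (V := A) (W := A) (X := A ⊗[k] A)).act_apply
        (pull ((LinearMap.mul' k H).rTensor (H ⊗[k] H)) (om k H)) s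
    simp only [LinearEquiv.coe_coe] at h2
    have e1 : (TensorProduct.assoc k A A A).toLinearMap ∘ₗ
        (LinearMap.mul' k A).lTensor (A ⊗[k] A) ∘ₗ
        (TensorProduct.assoc k A A (A ⊗[k] A)).symm.toLinearMap =
        ((LinearMap.mul' k A).lTensor A).lTensor A := by
      ext; simp
    have e1s := fun s => LinearMap.congr_fun e1 s
    simp only [LinearMap.comp_apply, LinearEquiv.coe_coe] at e1s
    rw [h1, h2]
    simp only [freeR, LinearMap.comp_apply, LinearEquiv.coe_coe]
    rw [e1s, (((isColin_mul k H A).lTensor (E := H) (X := A)).lTensor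
      (E := H) (X := A)).act_apply, act_w_inv, ← LinearMap.comp_apply, ← LinearMap.lTensor_comp]
    rfl
  simp only [LinearMap.comp_apply, LinearEquiv.coe_coe]
  rw [hL, hR, w_cocycle]

/-- `a ⊗ (c ⊗ (d ⊗ b)) ↦ ac ⊗ db`. -/
def outer : A ⊗[k] (A ⊗[k] (A ⊗[k] A)) →ₗ[k] A ⊗[k] A :=
  TensorProduct.map (LinearMap.mul' k A) (LinearMap.mul' k A) ∘ₗ
    (TensorProduct.assoc k A A (A ⊗[k] A)).symm.toLinearMap

theorem freeL_freeR (s : A ⊗[k] (A ⊗[k] (A ⊗[k] A))) :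
    freeL k H A ((freeR k H A).lTensor A
      ((TensorProduct.assoc k A A A).symm.toLinearMap.lTensor A s)) =
    outer k A (act (A ⊗[k] (A ⊗[k] (A ⊗[k] A)))
      ((w3 k H)⁻¹ * w0 k H).val s) := by
  have e0 : (TensorProduct.assoc k A A A).toLinearMap.lTensor A ∘ₗ
      (TensorProduct.assoc k A A A).symm.toLinearMap.lTensor A = LinearMap.id := by
    rw [← LinearMap.lTensor_comp]; simp
  have e1 : mulFst k A A ∘ₗ ((LinearMap.mul' k A).lTensor A).lTensor A = outer k A := by
    ext; simp [mulFst, outer]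
  have e0s := fun s => LinearMap.congr_fun e0 s
  have e1s := fun s => LinearMap.congr_fun e1 s
  simp only [LinearMap.comp_apply, LinearMap.id_apply] at e0s e1s
  simp only [freeR, freeL, LinearMap.lTensor_comp, LinearMap.comp_apply]
  rw [e0s, lTensor_act_face0, (((isColin_mul k H A).lTensor (E := H) (X := A)).lTensor
      (E := H) (X := A)).act_apply, act_w_inv, e1s]
  rfl

theorem free_middle_assoc : freeR k H A ∘ₗ (freeL k H A).rTensor A ∘ₗ
      (TensorProduct.assoc k A (A ⊗[k] A) A).symm.toLinearMap =
    freeL k H A ∘ₗ (freeR k H A).lTensor A ∘ₗ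
      act (A ⊗[k] ((A ⊗[k] A) ⊗[k] A)) (om k H) := by
  refine LinearMap.ext fun t => ?_
  obtain ⟨s, rfl⟩ : ∃ s, (TensorProduct.assoc k A A A).symm.toLinearMap.lTensor A s = t :=
    ⟨(TensorProduct.assoc k A A A).toLinearMap.lTensor A t, by
      rw [← LinearMap.comp_apply, ← LinearMap.lTensor_comp]; simp⟩
  have hR : freeL k H A ((freeR k H A).lTensor A
      (act (A ⊗[k] ((A ⊗[k] A) ⊗[k] A)) (om k H)
        ((TensorProduct.assoc k A A A).symm.toLinearMap.lTensor A s))) =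
      outer k A (act (A ⊗[k] (A ⊗[k] (A ⊗[k] A)))
        ((w3 k H)⁻¹ * w0 k H * w2 k H).val s) := by
    have h1 := (((isColin_codiagonal k H A A).rTensor (E := H) (X := A)).lTensor
      (E := H) (X := A)).act_apply
      (om k H) ((TensorProduct.assoc k A A A).symm.toLinearMap.lTensor A s)
    simp only [LinearMap.rTensor_id, LinearMap.lTensor_id, LinearMap.id_apply] at h1
    rw [h1, ((IsColin.assoc_symm (k := k) (C := H) (D := H) (E := H)
      (V := A) (W := A) (X := A)).lTensor (E := H) (X := A)).act_apply, freeL_freeR, act_w_inv,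
      pull_comp, ← LinearMap.lTensor_comp]
    rfl
  have hL : freeR k H A ((freeL k H A).rTensor A ((TensorProduct.assoc k A (A ⊗[k] A) A).symm
      ((TensorProduct.assoc k A A A).symm.toLinearMap.lTensor A s))) =
      outer k A (act (A ⊗[k] (A ⊗[k] (A ⊗[k] A)))
        (w1 k H * (w4 k H)⁻¹).val s) := by
    have e1 : (TensorProduct.assoc k A A A).toLinearMap ∘ₗ (mulFst k A A).rTensor A ∘ₗ
        regroup k A = mulFst k A (A ⊗[k] A) := by
      ext; simp [mulFst, regroup]
    have e2 : (LinearMap.mul' k A).lTensor A ∘ₗ mulFst k A (A ⊗[k] A) = outer k A := by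
      ext; simp [mulFst, outer]
    have e1s := fun s => LinearMap.congr_fun e1 s
    have e2s := fun s => LinearMap.congr_fun e2 s
    simp only [LinearMap.comp_apply, LinearEquiv.coe_coe] at e1s e2s
    have hreg : (TensorProduct.assoc k A (A ⊗[k] A) A).symm
      ((TensorProduct.assoc k A A A).symm.toLinearMap.lTensor A s) = regroup k A s := rfl
    rw [hreg]
    simp only [freeR, freeL, LinearMap.rTensor_comp, LinearMap.comp_apply, LinearEquiv.coe_coe]
    rw [rTensor_act_regroup, e1s, (isColin_mulFst k H A (H ⊗[k] H) (A ⊗[k] A)).act_apply,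
      act_w_inv, e2s]
    rfl
  have hw : w1 k H * (w4 k H)⁻¹ = (w3 k H)⁻¹ * w0 k H * w2 k H := by
    have := w_cocycle k H
    rw [mul_inv_eq_iff_eq_mul, mul_assoc, mul_assoc, ← mul_assoc (w0 k H), ← this]
    group
  simp only [LinearMap.comp_apply, LinearEquiv.coe_coe]
  rw [hL, hR, hw]

/-- `A ⊗ A` with the codiagonal coaction is an `A`-bimodule in the category of right
`H`-comodules. -/
@[reducible] def freeBimodule : HopfBimodule k H A (A ⊗[k] A) where
  lact := freeL k H A
  ract := freeR k H A
  coact_lact := free_coact_lact k H A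
  coact_ract := free_coact_ract k H A
  one_lact := free_one_lact k H A
  ract_one := free_ract_one k H A
  lact_assoc := free_lact_assoc k H A
  ract_assoc := free_ract_assoc k H A
  middle_assoc := free_middle_assoc k H A

end FreeBimodule

section CoinvariantAction

variable (k : Type*) [Field k]
variable (H : Type*) [NonAssocRing H] [Module k H] [SMulCommClass k H H] [IsScalarTower k H H]
  [Coalgebra k H] [CoquasiBialgebra k H]
variable (A : Type*) [NonAssocRing A] [Module k A] [SMulCommClass k A A]
  [IsScalarTower k A A] [RightComodule k H A] [ComoduleAlgebra k H A]

section General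

variable {M : Type*} [AddCommGroup M] [Module k M] [RightComodule k H M] [HopfBimodule k H A M]

/-- `a ↦ ma`. -/
def rightBy (m : M) : A →ₗ[k] M := HopfBimodule.ract (k := k) (H := H) ∘ₗ TensorProduct.mk k M A m

/-- `a ⊗ b ↦ a(mb)`. -/
def sandwich (m : M) : A ⊗[k] A →ₗ[k] M :=
  HopfBimodule.lact (k := k) (H := H) ∘ₗ (rightBy k H A m).lTensor A

theorem isColin_rightBy {m : M} (hm : m ∈ coinvariants k H M) : IsColin (LinearMap.id :
    H →ₗ[k] H) (rightBy k H A m) := by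
  have h1 := (mem_coinvariants k H).1 hm
  have h2 : IsColin (LinearMap.mul' k H) (HopfBimodule.ract (k := k) (H := H) (A := A) (M := M)) :=
    HopfBimodule.coact_ract
  have h3 := h2.comp (IsColin.mk_left (k := k) (D := H) (W := A) h1)
  have e : LinearMap.mul' k H ∘ₗ TensorProduct.mk k H H 1 = LinearMap.id := by ext; simp
  rwa [e] at h3

theorem rightBy_mul {m : M} (hm : m ∈ coinvariants k H M) : rightBy k H A m ∘ₗ LinearMap.mul' k A =
    HopfBimodule.ract (k := k) (H := H) ∘ₗ (rightBy k H A m).rTensor A := by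
  refine LinearMap.ext fun t => ?_
  have h1 := (mem_coinvariants k H).1 hm
  have h2 := (IsColin.mk_left (k := k) (D := H ⊗[k] H) (W := A ⊗[k] A) h1).act_apply (om k H) t
  rw [pull_left, act_one] at h2
  have h3 := LinearMap.congr_fun (HopfBimodule.ract_assoc (k := k) (H := H) (A := A) (M := M))
    (m ⊗ₜ t)
  simp only [LinearMap.comp_apply, TensorProduct.mk_apply, LinearMap.id_apply,
    LinearEquiv.coe_coe] at h2 h3
  rw [h2] at h3
  have e : (HopfBimodule.ract (k := k) (H := H) (A := A) (M := M)).rTensor A ∘ₗ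
      (TensorProduct.assoc k M A A).symm.toLinearMap ∘ₗ TensorProduct.mk k M (A ⊗[k] A) m =
      (rightBy k H A m).rTensor A := by
    ext; simp [rightBy]
  have et := LinearMap.congr_fun e t
  simp only [LinearMap.comp_apply, TensorProduct.mk_apply, LinearEquiv.coe_coe] at et
  rw [et] at h3
  exact h3.symm

theorem sandwich_freeL {m : M} (hm : m ∈ coinvariants k H M) (t : A ⊗[k] (A ⊗[k] A)) :
    sandwich k H A m (freeL k H A t) =
    HopfBimodule.lact (k := k) (H := H) ((sandwich k H A m).lTensor A t) := by
  have hf := isColin_rightBy k H A hm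
  have e1 : sandwich k H A m ∘ₗ mulFst k A A =
      (HopfBimodule.lact (k := k) (H := H) ∘ₗ mulFst k A M) ∘ₗ
        ((rightBy k H A m).lTensor A).lTensor A := by
    ext; simp [sandwich, mulFst]
  rw [HopfBimodule.lact_assoc] at e1
  have e1t := LinearMap.congr_fun e1 (act (A ⊗[k] (A ⊗[k] A)) (omInv k H) t)
  have h2 := ((hf.lTensor (E := H) (X := A)).lTensor (E := H) (X := A)).act_apply (om k H)
    (act (A ⊗[k] (A ⊗[k] A)) (omInv k H) t)
  simp only [LinearMap.comp_apply] at e1t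
  rw [h2, act_w_inv] at e1t
  simp only [LinearMap.lTensor_id] at e1t
  have h3 : pull LinearMap.id (om k H) * omInv k H = 1 := om_mul_omInv k H
  rw [h3, act_one] at e1t
  refine e1t.trans ?_
  rw [LinearMap.id_apply, ← LinearMap.comp_apply (LinearMap.lTensor A _),
    ← LinearMap.lTensor_comp]
  rfl

theorem sandwich_freeR {m : M} (hm : m ∈ coinvariants k H M) (t : (A ⊗[k] A) ⊗[k] A) :
    sandwich k H A m (freeR k H A t) =
    HopfBimodule.ract (k := k) (H := H) ((sandwich k H A m).rTensor A t) := by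
  have hf := isColin_rightBy k H A hm
  obtain ⟨s, rfl⟩ := (TensorProduct.assoc k A A A).symm.surjective t
  have e1 : sandwich k H A m ∘ₗ (LinearMap.mul' k A).lTensor A =
      HopfBimodule.lact (k := k) (H := H) ∘ₗ
        (HopfBimodule.ract (k := k) (H := H)).lTensor A ∘ₗ
        ((rightBy k H A m).rTensor A).lTensor A := by
    rw [sandwich, LinearMap.comp_assoc, ← LinearMap.lTensor_comp, rightBy_mul k H A hm,
      LinearMap.lTensor_comp]
  have h2 := ((hf.rTensor (E := H) (X := A)).lTensor (E := H) (X := A)).act_apply (om k H) s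
  have h3 := LinearMap.congr_fun (HopfBimodule.middle_assoc (k := k) (H := H) (A := A) (M := M))
    (((rightBy k H A m).rTensor A).lTensor A s)
  have e1s := LinearMap.congr_fun e1 (act (A ⊗[k] (A ⊗[k] A)) (om k H) s)
  have e2 : (HopfBimodule.lact (k := k) (H := H) (A := A) (M := M)).rTensor A ∘ₗ
      (TensorProduct.assoc k A M A).symm.toLinearMap ∘ₗ
      ((rightBy k H A m).rTensor A).lTensor A =
      (sandwich k H A m).rTensor A ∘ₗ (TensorProduct.assoc k A A A).symm.toLinearMap := by
    ext; simp [sandwich]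
  have e2s := LinearMap.congr_fun e2 s
  simp only [LinearMap.comp_apply, LinearEquiv.coe_coe, LinearMap.lTensor_id,
    LinearMap.rTensor_id] at h2 h3 e1s e2s
  rw [h2, e2s] at h3
  simp only [freeR, LinearMap.comp_apply, LinearEquiv.coe_coe, LinearEquiv.apply_symm_apply]
  rw [e1s]
  exact h3.symm

theorem sandwich_one (m : M) : sandwich k H A m (1 ⊗ₜ 1) = m := by
  simp [sandwich, rightBy, HopfBimodule.ract_one, HopfBimodule.one_lact]

/-- `sandwich` by a coinvariant element is colinear for the codiagonal coaction. -/
theorem sandwich_mem {m : M} (hm : m ∈ coinvariants k H M) (x : A ⊗[k] A)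
    (hx : x ∈ @coinvariants k _ H _ _ _ (A ⊗[k] A) _ _ (codiagonal k H A A)) :
    sandwich k H A m x ∈ coinvariants k H M := by
  have hf := (isColin_rightBy k H A hm).lTensor (E := H) (X := A)
  have hl : IsColin (LinearMap.mul' k H) (HopfBimodule.lact (k := k) (H := H) (A := A) (M := M)) :=
    HopfBimodule.coact_lact
  have h1 := LinearMap.congr_fun (hl.comp hf) x
  have h2 : (LinearMap.mul' k H).lTensor _ (coact k (H ⊗[k] H) (A ⊗[k] A) x) = x ⊗ₜ 1 := by
    let _ := codiagonal k H A A
    exact (mem_coinvariants k H (V := A ⊗[k] A)).1 hx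
  rw [mem_coinvariants]
  refine h1.trans ?_
  have h3 := congrArg ((sandwich k H A m).rTensor H) h2
  rw [LinearMap.lTensor_id, LinearMap.comp_id, LinearMap.comp_apply]
  refine Eq.trans ?_ h3
  rw [← LinearMap.comp_apply (LinearMap.rTensor H _), LinearMap.rTensor_comp_lTensor]
  rfl

end General

attribute [local instance] codiagonal freeBimodule

/-- `L = (A ⊗ A^op)^{co H}`, the coinvariants of `A ⊗ A` for the codiagonal coaction
`ρ(a ⊗ b) = a₀ ⊗ b₀ ⊗ a₁b₁`. -/
def envCoinvariants : Submodule k (A ⊗[k] A) := coinvariants k H (A ⊗[k] A)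

/-- `(a ⊗ b) ⊗ (c ⊗ d) ↦ a ⊗ (c ⊗ (d ⊗ b))`. -/
def nest : (A ⊗[k] A) ⊗[k] (A ⊗[k] A) →ₗ[k] A ⊗[k] (A ⊗[k] (A ⊗[k] A)) :=
  (TensorProduct.assoc k A A A).toLinearMap.lTensor A ∘ₗ
    (TensorProduct.comm k A (A ⊗[k] A)).toLinearMap.lTensor A ∘ₗ
    (TensorProduct.assoc k A A (A ⊗[k] A)).toLinearMap

/-- The product
`(a ⊗ b)(c ⊗ d) = a₀c₀ ⊗ d₀b₀ ω⁻¹(a₁, c₁, d₁b₁) ω(c₂, d₂, b₂)`. -/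
def envMul : A ⊗[k] A →ₗ[k] A ⊗[k] A →ₗ[k] A ⊗[k] A :=
  TensorProduct.curry (outer k A ∘ₗ
    act (A ⊗[k] (A ⊗[k] (A ⊗[k] A))) (pull (face3 k H) (omInv k H) * pull (face0 k H) (om k H)) ∘ₗ
    nest k A)

theorem envMul_eq (x y : A ⊗[k] A) : envMul k H A x y = sandwich k H A y x := by
  have e : ∀ a b : A, (TensorProduct.assoc k A A A).symm.toLinearMap.lTensor A
      (nest k A ((a ⊗ₜ b) ⊗ₜ y)) = a ⊗ₜ (y ⊗ₜ b) := by
    intro a b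
    simp [nest]
  have h : (envMul k H A).flip y = sandwich k H A y := by
    refine TensorProduct.ext' fun a b => ?_
    have h1 := freeL_freeR k H A (nest k A ((a ⊗ₜ b) ⊗ₜ y))
    rw [e] at h1
    exact h1.symm
  exact LinearMap.congr_fun h x

theorem envMul_mem {x y : A ⊗[k] A} (hx : x ∈ envCoinvariants k H A)
    (hy : y ∈ envCoinvariants k H A) : envMul k H A x y ∈ envCoinvariants k H A := by
  rw [envMul_eq]
  exact sandwich_mem k H A hy x hx

theorem sandwich_sandwich {M : Type*} [AddCommGroup M] [Module k M] [RightComodule k H M]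
    [HopfBimodule k H A M] {m : M} (hm : m ∈ coinvariants k H M) (x y : A ⊗[k] A) :
    sandwich k H A m (sandwich k H A y x) = sandwich k H A (sandwich k H A m y) x := by
  have h : sandwich k H A m ∘ₗ sandwich k H A y = sandwich k H A (sandwich k H A m y) := by
    refine TensorProduct.ext' fun a b => ?_
    refine (sandwich_freeL k H A hm (a ⊗ₜ freeR k H A (y ⊗ₜ b))).trans ?_
    rw [LinearMap.lTensor_tmul, sandwich_freeR k H A hm]
    rfl
  exact LinearMap.congr_fun h x

theorem one_mem_env : (1 : A) ⊗ₜ[k] (1 : A) ∈ envCoinvariants k H A := by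
  refine (mem_coinvariants k H).2 ?_
  change (LinearMap.mul' k H).lTensor _ (coact k (H ⊗[k] H) (A ⊗[k] A) (1 ⊗ₜ 1)) = _
  rw [coact_tmul, ComoduleAlgebra.coact_one]
  simp

theorem envMul_one (x : A ⊗[k] A) : envMul k H A x (1 ⊗ₜ 1) = x := by
  have e1 : nest k A ∘ₗ (TensorProduct.mk k (A ⊗[k] A) (A ⊗[k] A)).flip (1 ⊗ₜ 1) =
      (TensorProduct.mk k A (A ⊗[k] A) 1 ∘ₗ TensorProduct.mk k A A 1).lTensor A := by
    ext; simp [nest]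
  have e1x := LinearMap.congr_fun e1 x
  simp only [LinearMap.comp_apply, LinearMap.flip_apply, TensorProduct.mk_apply] at e1x
  have h1 := ComoduleAlgebra.coact_one (k := k) (H := H) (A := A)
  have hc := (((IsColin.mk_left (k := k) (D := H ⊗[k] H) (W := A ⊗[k] A) h1).comp
    (IsColin.mk_left (k := k) (D := H) (W := A) h1)).lTensor (E := H) (X := A))
  have hj := (((isCoalgMap_one_left k H (H ⊗[k] H)).comp
    (isCoalgMap_one_left k H H)).lTensor H)
  have hp3 : face3 k H ∘ₗ (TensorProduct.mk k H (H ⊗[k] H) 1 ∘ₗ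
      TensorProduct.mk k H H 1).lTensor H = (TensorProduct.mk k H H 1).lTensor H := by
    ext; simp [face3]
  have hp0 : face0 k H ∘ₗ (TensorProduct.mk k H (H ⊗[k] H) 1 ∘ₗ
      TensorProduct.mk k H H 1).lTensor H = (TensorProduct.mk k H (H ⊗[k] H) 1) ∘ₗ
      (TensorProduct.mk k H H 1) ∘ₗ (TensorProduct.lid k H).toLinearMap ∘ₗ
        (Coalgebra.counit (R := k) (A := H)).rTensor H := by
    ext; simp [face0]
  have h2 : outer k A ∘ₗ (TensorProduct.mk k A (A ⊗[k] A) 1 ∘ₗ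
      TensorProduct.mk k A A 1).lTensor A = LinearMap.id := by
    ext; simp [outer]
  change outer k A (act _ _ (nest k A (x ⊗ₜ (1 ⊗ₜ 1)))) = x
  rw [e1x, hc.act_apply, hj.pull_mul, pull_comp, pull_comp, hp3, hp0,
    pull_omInv_eq_one k H ((isCoalgMap_one_left k H H).lTensor H) (pull_mid k H), ← pull_comp,
    pull_left, one_mul, ((isCoalgMap_one_left k H H).comp
      (IsCoalgMap.lid.comp (IsCoalgMap.counit.rTensor H))).pull_one, act_one]
  exact LinearMap.congr_fun h2 x

/-- `L` is an associative ring with unit `1 ⊗ 1`. -/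
instance envRing : Ring (envCoinvariants k H A) :=
  { (inferInstance : AddCommGroup (envCoinvariants k H A)) with
    mul := fun x y => ⟨envMul k H A x y, envMul_mem k H A x.2 y.2⟩
    one := ⟨1 ⊗ₜ 1, one_mem_env k H A⟩
    left_distrib := fun x y z => Subtype.ext (map_add (envMul k H A (x : A ⊗[k] A)) _ _)
    right_distrib := fun x y z => Subtype.ext (LinearMap.map_add₂ (envMul k H A) _ _ _)
    zero_mul := fun x => Subtype.ext (LinearMap.map_zero₂ (envMul k H A) _)
    mul_zero := fun x => Subtype.ext (map_zero (envMul k H A (x : A ⊗[k] A)))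
    mul_assoc := fun x y z => Subtype.ext <| by
      change envMul k H A (envMul k H A x y) z = envMul k H A x (envMul k H A y z)
      simp only [envMul_eq]
      exact sandwich_sandwich k H A z.2 _ _
    one_mul := fun x => Subtype.ext <| by
      change envMul k H A (1 ⊗ₜ 1) x = x
      rw [envMul_eq]
      exact sandwich_one k H A _
    mul_one := fun x => Subtype.ext (envMul_one k H A x)
    zsmul := fun n x => n • x
    nsmul := fun n x => n • x }

/-! ## The subalgebra of coinvariants -/

theorem mul_assoc_mid (a b c : A) (hb : b ∈ coinvariants k H A) : a * b * c = a * (b * c) := by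
  have h1 := ((IsColin.mk_left (k := k) (D := H) (W := A)
    ((mem_coinvariants k H).1 hb)).lTensor (E := H) (X := A)).act_apply (om k H) (a ⊗ₜ c)
  rw [pull_mid, act_one] at h1
  have h2 := mulL_eq k H A (a ⊗ₜ (b ⊗ₜ c))
  simp only [LinearMap.lTensor_tmul, TensorProduct.mk_apply, LinearMap.id_apply] at h1
  rw [h1] at h2
  simpa [mulL, mulR] using h2

theorem coact_mul_tmul (a b : A) : coact k H A (a * b) =
    TensorProduct.map (LinearMap.mul' k A) (LinearMap.mul' k H)
      (TensorProduct.tensorTensorTensorComm k A H A H (coact k H A a ⊗ₜ coact k H A b)) :=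
  LinearMap.congr_fun (ComoduleAlgebra.coact_mul (k := k) (H := H) (A := A)) (a ⊗ₜ b)

theorem mul_mem_coinvariants {a b : A} (ha : a ∈ coinvariants k H A)
    (hb : b ∈ coinvariants k H A) : a * b ∈ coinvariants k H A := by
  rw [mem_coinvariants] at *
  rw [coact_mul_tmul, ha, hb]
  simp

/-- `B = A^{co H}` is an associative ring. -/
instance coinvRing : Ring (coinvariants k H A) :=
  { (inferInstance : AddCommGroup (coinvariants k H A)) with
    mul := fun x y => ⟨(x : A) * y, mul_mem_coinvariants k H A x.2 y.2⟩
    one := ⟨1, (mem_coinvariants k H).2 ComoduleAlgebra.coact_one⟩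
    left_distrib := fun x y z => Subtype.ext (mul_add (x : A) y z)
    right_distrib := fun x y z => Subtype.ext (add_mul (x : A) y z)
    zero_mul := fun x => Subtype.ext (zero_mul (x : A))
    mul_zero := fun x => Subtype.ext (mul_zero (x : A))
    mul_assoc := fun x y z => Subtype.ext (mul_assoc_mid k H A x y z y.2)
    one_mul := fun x => Subtype.ext (one_mul (x : A))
    mul_one := fun x => Subtype.ext (mul_one (x : A))
    zsmul := fun n x => n • x
    nsmul := fun n x => n • x }

/-- `A` is a left `B`-module by multiplication. -/
instance coinvLeftModule : Module (coinvariants k H A) A where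
  smul b a := (b : A) * a
  one_smul a := one_mul a
  mul_smul b c a := mul_assoc_mid k H A b c a c.2
  smul_zero b := mul_zero (b : A)
  smul_add b := mul_add (b : A)
  add_smul b c a := add_mul (b : A) c a
  zero_smul a := zero_mul a

/-- `A` is a right `B`-module by multiplication. -/
instance coinvRightModule : Module (coinvariants k H A)ᵐᵒᵖ A where
  smul b a := a * (b.unop : A)
  one_smul a := mul_one a
  mul_smul b c a := (mul_assoc_mid k H A a c.unop b.unop c.unop.2).symm
  smul_zero b := zero_mul (b.unop : A)
  smul_add b x y := add_mul x y (b.unop : A)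
  add_smul b c a := mul_add a (b.unop : A) c.unop
  zero_smul a := mul_zero a

end CoinvariantAction

/-! ## Tensor products over a noncommutative ring and faithful flatness -/

section Balanced

variable (B : Type*) [Ring B]

/-- The relations `nb ⊗ x - n ⊗ bx`. -/
def balancedRel (N X : Type*) [AddCommGroup N] [Module Bᵐᵒᵖ N] [AddCommGroup X] [Module B X] :
    AddSubgroup (N ⊗[ℤ] X) :=
  AddSubgroup.closure {t | ∃ (n : N) (b : B) (x : X),
    t = (MulOpposite.op b • n) ⊗ₜ[ℤ] x - n ⊗ₜ[ℤ] (b • x)}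

/-- The tensor product `N ⊗_B X` of a right `B`-module and a left `B`-module. -/
abbrev BalTensor (N X : Type*) [AddCommGroup N] [Module Bᵐᵒᵖ N] [AddCommGroup X] [Module B X] :
    Type _ :=
  (N ⊗[ℤ] X) ⧸ balancedRel B N X

variable {B} in
/-- `f ⊗_B X : N ⊗_B X → N' ⊗_B X`. -/
def balMap {N N' : Type*} [AddCommGroup N] [Module Bᵐᵒᵖ N] [AddCommGroup N'] [Module Bᵐᵒᵖ N']
    (X : Type*) [AddCommGroup X] [Module B X] (f : N →ₗ[Bᵐᵒᵖ] N') :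
    BalTensor B N X →+ BalTensor B N' X :=
  QuotientAddGroup.map _ _ (f.toAddMonoidHom.toIntLinearMap.rTensor X).toAddMonoidHom <| by
    rw [balancedRel, AddSubgroup.closure_le]
    rintro _ ⟨n, b, x, rfl⟩
    refine AddSubgroup.subset_closure ⟨f n, b, x, ?_⟩
    simp

/-- A left `B`-module `X` is faithfully flat if a sequence `N₁ → N₂ → N₃` of right `B`-modules is
exact if and only if `N₁ ⊗_B X → N₂ ⊗_B X → N₃ ⊗_B X` is exact. -/
def LeftFaithfullyFlat (B X : Type v) [Ring B] [AddCommGroup X] [Module B X] : Prop :=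
  ∀ (N₁ N₂ N₃ : Type v) [AddCommGroup N₁] [AddCommGroup N₂] [AddCommGroup N₃]
    [Module Bᵐᵒᵖ N₁] [Module Bᵐᵒᵖ N₂] [Module Bᵐᵒᵖ N₃]
    (f : N₁ →ₗ[Bᵐᵒᵖ] N₂) (g : N₂ →ₗ[Bᵐᵒᵖ] N₃),
    Function.Exact f g ↔ Function.Exact (balMap X f) (balMap X g)

end Balanced

/-! ## Galois extensions -/

section Galois

variable (k : Type*) [Field k]
variable (H : Type*) [NonAssocRing H] [Module k H] [SMulCommClass k H H] [IsScalarTower k H H]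
  [Coalgebra k H] [CoquasiHopfAlgebra k H]
variable (A : Type*) [NonAssocRing A] [Module k A] [SMulCommClass k A A]
  [IsScalarTower k A A] [RightComodule k H A] [ComoduleAlgebra k H A]

/-- `h ⊗ g ↦ ω⁻¹(h, g₁β(g₂), S(g₃)) g₄`. -/
def canTwist : H ⊗[k] H →ₗ[k] H :=
  (TensorProduct.lid k H).toLinearMap ∘ₗ (omInv k H).ofConv.rTensor H ∘ₗ
    (TensorProduct.assoc k H (H ⊗[k] H) H).symm.toLinearMap ∘ₗ
    ((TensorProduct.assoc k H H H).symm.toLinearMap ∘ₗ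
      TensorProduct.map (hitL CoquasiHopfAlgebra.beta)
        ((antipode k H).rTensor H ∘ₗ Coalgebra.comul) ∘ₗ Coalgebra.comul).lTensor H

/-- `A ⊗ A → A ⊗ H`, `a ⊗ b ↦ a₀b₀ ⊗ ω⁻¹(a₁, b₁β(b₂), S(b₃)) b₄`. -/
def canLin : A ⊗[k] A →ₗ[k] A ⊗[k] H :=
  TensorProduct.map (LinearMap.mul' k A) (canTwist k H) ∘ₗ coact k (H ⊗[k] H) (A ⊗[k] A)

theorem canLin_balanced (a b x : A) (hx : x ∈ coinvariants k H A) :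
    canLin k H A ((a * x) ⊗ₜ b) = canLin k H A (a ⊗ₜ (x * b)) := by
  have hx' := (mem_coinvariants k H).1 hx
  simp only [canLin, LinearMap.comp_apply, coact_tmul, coact_mul_tmul, hx']
  induction coact k H A a with
  | zero => simp only [map_zero, TensorProduct.zero_tmul, TensorProduct.tmul_zero]
  | add _ _ h₁ h₂ =>
    simp only [map_add, TensorProduct.add_tmul, TensorProduct.tmul_add, h₁, h₂]
  | tmul a h =>
  induction coact k H A b with
  | zero => simp only [map_zero, TensorProduct.zero_tmul, TensorProduct.tmul_zero]
  | add _ _ h₁ h₂ =>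
    simp only [map_add, TensorProduct.add_tmul, TensorProduct.tmul_add, h₁, h₂]
  | tmul b g =>
  simp [mul_assoc_mid k H A a x b hx]

/-- The Galois map `can : A ⊗_B A → A ⊗ H`,
`a ⊗_B b ↦ a₀b₀ ⊗ ω⁻¹(a₁, b₁β(b₂), S(b₃)) b₄`. -/
def can : BalTensor (coinvariants k H A) A A →+ A ⊗[k] H :=
  QuotientAddGroup.lift _ ((canLin k H A).toAddMonoidHom.comp
    (TensorProduct.mapOfCompatibleSMul k ℤ ℤ A A).toAddMonoidHom) <| by
    rw [balancedRel, AddSubgroup.closure_le]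
    rintro _ ⟨a, x, b, rfl⟩
    have h := canLin_balanced k H A a b x x.2
    rw [SetLike.mem_coe, AddMonoidHom.mem_ker, map_sub, sub_eq_zero]
    exact h

/-- The extension `B = A^{co H} ⊆ A` is `H`-Galois if `can` is bijective. -/
def IsGaloisExtension : Prop := Function.Bijective (can k H A)

end Galois

/-! ## The category of two-sided Hopf modules -/

section Category

variable (k : Type*) [Field k]
variable (H : Type*) [NonAssocRing H] [Module k H] [SMulCommClass k H H] [IsScalarTower k H H]
  [Coalgebra k H] [CoquasiBialgebra k H]
variable (A : Type*) [NonAssocRing A] [Module k A] [SMulCommClass k A A]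
  [IsScalarTower k A A] [RightComodule k H A] [ComoduleAlgebra k H A]

/-- The objects of the category of `A`-bimodules in the monoidal category of right
`H`-comodules. -/
structure HopfBimod where
  carrier : Type w
  [addCommGroup : AddCommGroup carrier]
  [module : Module k carrier]
  [comodule : RightComodule k H carrier]
  [bimodule : HopfBimodule k H A carrier]

attribute [instance] HopfBimod.addCommGroup HopfBimod.module HopfBimod.comodule
  HopfBimod.bimodule

variable {k H A}

/-- Morphisms: right `H`-colinear maps which respect both `A`-actions. -/
@[ext]
structure HopfBimod.Hom (M N : HopfBimod.{w} k H A) where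
  toLin : M.carrier →ₗ[k] N.carrier
  colinear : coact k H N.carrier ∘ₗ toLin = toLin.rTensor H ∘ₗ coact k H M.carrier
  map_lact : toLin ∘ₗ HopfBimodule.lact (k := k) (H := H) (A := A) =
    HopfBimodule.lact (k := k) (H := H) (A := A) ∘ₗ toLin.lTensor A
  map_ract : toLin ∘ₗ HopfBimodule.ract (k := k) (H := H) (A := A) =
    HopfBimodule.ract (k := k) (H := H) (A := A) ∘ₗ toLin.rTensor A

instance : Category (HopfBimod.{w} k H A) where
  Hom := HopfBimod.Hom
  id M := ⟨LinearMap.id, by simp, by simp, by simp⟩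
  comp {M N P} f g := ⟨g.toLin ∘ₗ f.toLin,
    by rw [← LinearMap.comp_assoc, g.colinear, LinearMap.comp_assoc, f.colinear,
      LinearMap.rTensor_comp, LinearMap.comp_assoc],
    by rw [LinearMap.comp_assoc, f.map_lact, ← LinearMap.comp_assoc, g.map_lact,
      LinearMap.comp_assoc, LinearMap.lTensor_comp],
    by rw [LinearMap.comp_assoc, f.map_ract, ← LinearMap.comp_assoc, g.map_ract,
      LinearMap.comp_assoc, LinearMap.rTensor_comp]⟩

end Category

end

end Coquasi

/-! The equivalence is `M ↦ M^{co H}`, with `L` acting by `(a ⊗ b) · m = a(mb)`. For a coinvariant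
`m` the map `sandwich m : a ⊗ b ↦ a(mb)` is a morphism of two-sided Hopf modules `A ⊗ A → M` sending
`1 ⊗ 1` to `m`. Thus `A ⊗ A` represents the coinvariants, `L` is the opposite of its endomorphism
ring, and the candidate inverse functor is `V ↦ (A ⊗ A) ⊗_L V`.

The core is the structure theorem `mulBal_bijective`: `M^{co H} ⊗_B A → M`, `m ⊗ a ↦ ma`, is
bijective. It is proved by descent along the Galois map. Let `H` carry the coaction `h ↦ h₂ ⊗ S(h₁)`
and `M ⊗ H` the codiagonal one. The map `betaCoact : v ↦ v₀ ⊗ β(v₁)v₂` takes values in coinvariants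
(axiom on `β`), and it has a linear left inverse (axiom linking `ω`, `α`, `β`, `S`). The Galois map
of `A` is `a ⊗ b ↦ a · betaCoact b`, rebracketed by `ω⁻¹`. The same formula makes sense for every
Hopf module `M`, and the pentagon identity shows that `M ⊗_B A → M ⊗ H` is again bijective, with
inverse `m ⊗ h ↦ m · can⁻¹(1 ⊗ h)` (`canBal_bijective`). It carries the coaction of `M` alone to the
codiagonal coaction (`act_canBy`), and restricted to `M^{co H} ⊗_B A` it is `betaCoact` after
multiplication (`canBal_incl`).

Injectivity of `mulBal` then follows because flatness keeps `M^{co H} → M` injective after `⊗_B A`.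
For surjectivity, `betaCoact x` is a coinvariant, so its preimage in `M ⊗_B A` is killed by all the
maps `φ(m₁)m₀ - φ(1)m` tensored with `A`. The common kernel of these maps is `M^{co H}`, so by
flatness the preimage comes from some `t` in `M^{co H} ⊗_B A`. Now `x` and the image of `t` have the
same `betaCoact`, hence are equal.

Consequently every `M` is spanned by elements `a(mb)` with `m` coinvariant, so the functor is
faithful, and an `L`-linear map `h` of coinvariants extends by `a(mb) ↦ a(h(m)b)`, so it is full.
For essential surjectivity the unit `V → ((A ⊗ A) ⊗_L V)^{co H}` is tested after `⊗_B A`. There it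
becomes `V ⊗_B A → (A ⊗ A) ⊗_L V`, `v ⊗ a ↦ (1 ⊗ a) ⊗ v`, which is bijective because the structure
theorem for `A ⊗ A` itself identifies `A ⊗ A` with `L ⊗_B A`. Faithful flatness brings the
conclusion back to `V`. -/

namespace Coquasi

noncomputable section

/-! ### The antipode coaction on `H` and the coinvariants `v₀ ⊗ β(v₁)v₂` of `V ⊗ H` -/

section AntipodeComodule

variable (k : Type*) [Field k]

/-- A vector space as a comodule over the coalgebra `k`. -/
@[reducible] def trivialComodule (V : Type*) [AddCommGroup V] [Module k V] :
    RightComodule k k V where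
  coaction := (TensorProduct.mk k V k).flip 1
  coaction_coassoc := by ext v; simp
  coaction_counit := by ext v; simp

attribute [local instance] trivialComodule

theorem coact_trivial {V : Type*} [AddCommGroup V] [Module k V] (v : V) :
    coact k k V v = v ⊗ₜ 1 := rfl

variable (H : Type*) [NonAssocRing H] [Module k H] [SMulCommClass k H H] [IsScalarTower k H H]
  [Coalgebra k H] [CoquasiHopfAlgebra k H]

/-- `H` as a right `H`-comodule by `h ↦ h₂ ⊗ S(h₁)`. -/
@[reducible] def antipodeComodule : RightComodule k H H where
  coaction := (antipode k H).lTensor H ∘ₗ (TensorProduct.comm k H H).toLinearMap ∘ₗ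
    Coalgebra.comul
  coaction_coassoc := by
    ext h
    have hc := congrArg ((TensorProduct.map (antipode k H) (antipode k H)).lTensor H ∘ₗ
      (TensorProduct.comm k H H).toLinearMap.lTensor H ∘ₗ
      (TensorProduct.comm k (H ⊗[k] H) H).toLinearMap ∘ₗ
      (TensorProduct.assoc k H H H).symm.toLinearMap) (Coalgebra.coassoc_apply (R := k) h)
    refine Eq.trans ?_ (hc.symm.trans ?_)
    · simp only [LinearMap.comp_apply, LinearEquiv.coe_coe]
      induction Coalgebra.comul (R := k) h with
      | zero => simp
      | add _ _ h₁ h₂ => simp only [map_add, h₁, h₂]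
      | tmul x y =>
      simp only [LinearMap.lTensor_tmul, TensorProduct.comm_tmul, LinearMap.rTensor_tmul,
        LinearMap.comp_apply, LinearEquiv.coe_coe]
      induction Coalgebra.comul (R := k) y with
      | zero => simp
      | add _ _ h₁ h₂ => simp only [map_add, TensorProduct.tmul_add, TensorProduct.add_tmul, h₁, h₂]
      | tmul y z => simp
    · simp only [LinearMap.comp_apply, LinearEquiv.coe_coe, LinearEquiv.symm_apply_apply]
      induction Coalgebra.comul (R := k) h with
      | zero => simp
      | add _ _ h₁ h₂ => simp only [map_add, h₁, h₂]
      | tmul x y =>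
      simp only [LinearMap.lTensor_tmul, TensorProduct.comm_tmul, LinearMap.rTensor_tmul]
      -- The flip in the coaction and the antimultiplicativity of `S` for `Δ` cancel, which is what
      -- makes this a right coaction.
      exact congrArg (TensorProduct.mk k H (H ⊗[k] H) y)
        (LinearMap.congr_fun CoquasiHopfAlgebra.comul_S x).symm
  coaction_counit := by
    ext h
    refine Eq.trans ?_ (congrArg (TensorProduct.lid k H) (Coalgebra.rTensor_counit_comul h)) |>.trans
      (by simp)
    simp only [LinearMap.comp_apply, LinearEquiv.coe_coe]
    induction Coalgebra.comul (R := k) h with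
    | zero => simp
    | add _ _ h₁ h₂ => simp only [map_add, h₁, h₂]
    | tmul x y =>
    have := LinearMap.congr_fun (CoquasiHopfAlgebra.counit_S (k := k) (H := H)) x
    simp only [LinearMap.comp_apply] at this
    simp [antipode, this]

attribute [local instance] antipodeComodule

theorem coact_antipodeComodule (h : H) : coact k H H h =
    (antipode k H).lTensor H (TensorProduct.comm k H H (Coalgebra.comul (R := k) h)) := rfl

/-- `h ↦ (h₁β(h₂) ⊗ S(h₃)) ⊗ h₄`. -/
def betaSplit : H →ₗ[k] (H ⊗[k] H) ⊗[k] H :=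
  (TensorProduct.assoc k H H H).symm.toLinearMap ∘ₗ
    TensorProduct.map (hitL CoquasiHopfAlgebra.beta)
      ((antipode k H).rTensor H ∘ₗ Coalgebra.comul) ∘ₗ Coalgebra.comul

/-- Coassociativity. In this bracketing the first two factors form the block `h₁β(h₂) ⊗ S(h₃)`, to
which the axiom on `β` applies. -/
theorem betaSplit_eq : betaSplit k H = (TensorProduct.map (hitL CoquasiHopfAlgebra.beta)
    (antipode k H) ∘ₗ Coalgebra.comul).rTensor H ∘ₗ Coalgebra.comul := by
  ext h
  have hc := congrArg ((TensorProduct.assoc k H H H).symm.toLinearMap ∘ₗ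
    TensorProduct.map (hitL CoquasiHopfAlgebra.beta) ((antipode k H).rTensor H))
    (Coalgebra.coassoc_apply (R := k) h)
  refine Eq.trans ?_ (hc.symm.trans ?_)
  · simp only [betaSplit, LinearMap.comp_apply, LinearEquiv.coe_coe]
    induction Coalgebra.comul (R := k) h with
    | zero => simp
    | add _ _ h₁ h₂ => simp only [map_add, h₁, h₂]
    | tmul x y => simp
  · simp only [LinearMap.comp_apply, LinearEquiv.coe_coe]
    induction Coalgebra.comul (R := k) h with
    | zero => simp
    | add _ _ h₁ h₂ => simp only [map_add, h₁, h₂]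
    | tmul x y =>
    simp only [LinearMap.rTensor_tmul, LinearMap.comp_apply]
    induction Coalgebra.comul (R := k) x with
    | zero => simp
    | add _ _ h₁ h₂ => simp only [map_add, TensorProduct.add_tmul, h₁, h₂]
    | tmul x z => simp

variable (V : Type*) [AddCommGroup V] [Module k V] [RightComodule k H V]

/-- `v ↦ v₀ ⊗ β(v₁) v₂`. -/
def betaCoact : V →ₗ[k] V ⊗[k] H := (hitR CoquasiHopfAlgebra.beta).lTensor V ∘ₗ coact k H V

/-- `v ⊗ ((x ⊗ y) ⊗ z) ↦ (v ⊗ z) ⊗ (x ⊗ y)`. -/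
def moveLast (X Y Z : Type*) [AddCommGroup X] [Module k X] [AddCommGroup Y] [Module k Y]
    [AddCommGroup Z] [Module k Z] : V ⊗[k] ((X ⊗[k] Y) ⊗[k] Z) →ₗ[k] (V ⊗[k] Z) ⊗[k] (X ⊗[k] Y) :=
  (TensorProduct.assoc k V Z (X ⊗[k] Y)).symm.toLinearMap ∘ₗ
    (TensorProduct.comm k (X ⊗[k] Y) Z).toLinearMap.lTensor V

/-- Both sides are `c₁ ⊗ φ(c₂) c₃`. -/
theorem lTensor_hitR_comul {C : Type*} [AddCommGroup C] [Module k C] [Coalgebra k C]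
    (φ : CDual k C) : (hitR φ).lTensor C ∘ₗ Coalgebra.comul =
      (hitL φ).rTensor C ∘ₗ (Coalgebra.comul (R := k)) := by
  let _ : RightComodule k C C :=
    ⟨Coalgebra.comul, Coalgebra.coassoc, by ext c; simp⟩
  exact (act_coact (V := C) φ).symm

/-- Both sides are `(v₀ ⊗ v₄) ⊗ (v₁β(v₂) ⊗ S(v₃))`. The two degrees are left unmultiplied: their
product gives coinvariance of `betaCoact`, while their separate values are needed for its left
inverse and for the formula of the Galois map. -/
theorem coact_betaCoact (v : V) : coact k (H ⊗[k] H) (V ⊗[k] H) (betaCoact k H V v) =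
    moveLast k V H H H ((betaSplit k H).lTensor V (coact k H V v)) := by
  have hc := congrArg (TensorProduct.assoc k V H H).symm (coact_coassoc k H v)
  rw [LinearEquiv.symm_apply_apply] at hc
  have e : ∀ t : V ⊗[k] H, coact k (H ⊗[k] H) (V ⊗[k] H)
      ((hitR CoquasiHopfAlgebra.beta).lTensor V t) =
      TensorProduct.tensorTensorTensorComm k V H H H
        ((coact k H H ∘ₗ hitR CoquasiHopfAlgebra.beta).lTensor _ ((coact k H V).rTensor H t)) := by
    intro t
    induction t with
    | zero => simp
    | add _ _ h₁ h₂ => simp only [map_add, h₁, h₂]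
    | tmul v c => simp [coact_tmul]
  rw [betaCoact, LinearMap.comp_apply, e, hc]
  induction coact k H V v with
  | zero => simp
  | add _ _ h₁ h₂ => simp only [map_add, h₁, h₂]
  | tmul v c =>
  have h := LinearMap.congr_fun (lTensor_hitR_comul k (C := H) CoquasiHopfAlgebra.beta) c
  have e2 : betaSplit k H c = (TensorProduct.assoc k H H H).symm
      (((antipode k H).rTensor H ∘ₗ Coalgebra.comul ∘ₗ
        hitR (CoquasiHopfAlgebra.beta (k := k) (H := H))).lTensor H
        (Coalgebra.comul (R := k) c)) := by
    rw [← LinearMap.comp_assoc, LinearMap.lTensor_comp, LinearMap.comp_apply]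
    simp only [LinearMap.comp_apply] at h
    rw [h, ← LinearMap.comp_apply (LinearMap.lTensor _ _), LinearMap.lTensor_comp_rTensor]
    rfl
  simp only [LinearMap.lTensor_tmul, e2]
  induction Coalgebra.comul (R := k) c with
  | zero => simp
  | add _ _ h₁ h₂ => simp only [map_add, TensorProduct.tmul_add, h₁, h₂]
  | tmul x y =>
  simp only [LinearMap.lTensor_tmul, TensorProduct.assoc_symm_tmul, LinearMap.comp_apply,
    coact_antipodeComodule]
  induction Coalgebra.comul (R := k) (hitR (CoquasiHopfAlgebra.beta (k := k) (H := H)) y) with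
  | zero => simp
  | add _ _ h₁ h₂ => simp only [map_add, TensorProduct.tmul_add, h₁, h₂]
  | tmul y z => simp [moveLast]

/-- `v₀ ⊗ β(v₁) v₂` is a coinvariant element of `V ⊗ H` for the codiagonal coaction. -/
theorem mul_coact_betaCoact (v : V) : (LinearMap.mul' k H).lTensor _
    (coact k (H ⊗[k] H) (V ⊗[k] H) (betaCoact k H V v)) = betaCoact k H V v ⊗ₜ 1 := by
  have e : ∀ (v : V) (z : (H ⊗[k] H)) (y : H), (LinearMap.mul' k H).lTensor _
      (moveLast k V H H H (v ⊗ₜ (z ⊗ₜ y))) = (v ⊗ₜ y) ⊗ₜ (LinearMap.mul' k H z) := by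
    intro v z y
    simp [moveLast]
  rw [coact_betaCoact, betaCoact, LinearMap.comp_apply]
  induction coact k H V v with
  | zero => simp
  | add _ _ h₁ h₂ => simp only [map_add, TensorProduct.add_tmul, h₁, h₂]
  | tmul v c =>
  simp only [LinearMap.lTensor_tmul, betaSplit_eq, hitR, LinearMap.comp_apply,
    LinearEquiv.coe_coe]
  induction Coalgebra.comul (R := k) c with
  | zero => simp
  | add _ _ h₁ h₂ => simp only [map_add, TensorProduct.tmul_add, TensorProduct.add_tmul, h₁, h₂]
  | tmul x y =>
  -- The product of the two degrees is `v₁β(v₂)S(v₃) = β(v₁)1`.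
  have h := LinearMap.congr_fun (CoquasiHopfAlgebra.beta_S (k := k) (H := H)) x
  simp only [LinearMap.comp_apply, LinearMap.smulRight_apply] at h
  rw [LinearMap.rTensor_tmul, e, LinearMap.comp_apply, antipode, h]
  simp [TensorProduct.tmul_smul, TensorProduct.smul_tmul']

attribute [local instance] codiagonal

/-- Coinvariance restated as colinearity from `V` with the trivial coaction. In this form it can be
tensored with other comodules and used to pull functionals back. -/
theorem isColin_betaCoact : IsColin (LinearMap.toSpanSingleton k H 1) (betaCoact k H V) := by
  ext v
  simp only [LinearMap.comp_apply, coact_trivial, TensorProduct.map_tmul,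
    LinearMap.toSpanSingleton_apply, one_smul]
  exact mul_coact_betaCoact k H V v

/-- `v ⊗ h ↦ v₀ ω(v₁, S(h₁), α(h₂) h₃)`. -/
def alphaContract : V ⊗[k] H →ₗ[k] V :=
  (TensorProduct.rid k V).toLinearMap ∘ₗ
    ((om k H).ofConv ∘ₗ ((hitR CoquasiHopfAlgebra.alpha).lTensor H).lTensor H).lTensor V ∘ₗ
    (TensorProduct.assoc k H H H).toLinearMap.lTensor V ∘ₗ
    (TensorProduct.comm k H (H ⊗[k] H)).toLinearMap.lTensor V ∘ₗ
    (TensorProduct.assoc k V H (H ⊗[k] H)).toLinearMap ∘ₗ coact k (H ⊗[k] H) (V ⊗[k] H)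

/-- The coefficient that arises is `ω(v₁β(v₂), S(v₃), α(v₄)v₅) = ε(v₁)`. The consequence used later
is that `betaCoact` is injective. -/
theorem alphaContract_betaCoact (v : V) : alphaContract k H V (betaCoact k H V v) = v := by
  simp only [alphaContract, LinearMap.comp_apply, LinearEquiv.coe_coe, coact_betaCoact]
  conv_rhs => rw [← coact_counit k H v, ← CoquasiHopfAlgebra.om_S (k := k) (H := H)]
  induction coact k H V v with
  | zero => simp
  | add _ _ h₁ h₂ => simp only [map_add, h₁, h₂]
  | tmul v c =>
  simp only [LinearMap.lTensor_tmul, betaSplit, LinearMap.comp_apply, LinearEquiv.coe_coe]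
  induction Coalgebra.comul (R := k) c with
  | zero => simp
  | add _ _ h₁ h₂ => simp only [map_add, TensorProduct.tmul_add, h₁, h₂]
  | tmul x y =>
  simp only [TensorProduct.map_tmul, LinearMap.comp_apply]
  induction Coalgebra.comul (R := k) y with
  | zero => simp
  | add _ _ h₁ h₂ => simp only [map_add, TensorProduct.tmul_add, h₁, h₂]
  | tmul y z => simp [moveLast, antipode]

end AntipodeComodule

/-! ### The Galois map attached to a right action of `A` -/

section GaloisMap

variable (k : Type*) [Field k]
variable (H : Type*) [NonAssocRing H] [Module k H] [SMulCommClass k H H] [IsScalarTower k H H]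
  [Coalgebra k H] [CoquasiHopfAlgebra k H]
variable {A : Type*} [NonAssocRing A] [Module k A] [SMulCommClass k A A]
  [IsScalarTower k A A] [RightComodule k H A] [ComoduleAlgebra k H A]
variable {M : Type*} [AddCommGroup M] [Module k M] [RightComodule k H M]
variable {N : Type*} [AddCommGroup N] [Module k N] [RightComodule k H N]

attribute [local instance] trivialComodule antipodeComodule codiagonal

/-- `m ⊗ (a ⊗ h) ↦ m₀a₀ ⊗ ω⁻¹(m₁, a₁, S(h₁)) h₂`. -/
def actAssocInv (r : M ⊗[k] A →ₗ[k] M) : M ⊗[k] (A ⊗[k] H) →ₗ[k] M ⊗[k] H :=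
  r.rTensor H ∘ₗ (TensorProduct.assoc k M A H).symm.toLinearMap ∘ₗ
    act (M ⊗[k] (A ⊗[k] H)) (omInv k H)

/-- The Galois map `m ⊗ a ↦ m₀a₀ ⊗ ω⁻¹(m₁, a₁β(a₂), S(a₃)) a₄` for a right action `r` of `A`. -/
def canBy (r : M ⊗[k] A →ₗ[k] M) : M ⊗[k] A →ₗ[k] M ⊗[k] H :=
  actAssocInv k H r ∘ₗ (betaCoact k H A).lTensor M

/-- The Galois map factors as `betaCoact` on the second tensorand followed by rebracketing `a(b ⊗
h)` into `ab ⊗ h` through `ω⁻¹`. This factorisation separates the role of `β` and `S` from that of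
`ω`. -/
theorem canBy_mul : canBy k H (LinearMap.mul' k A) = canLin k H A := by
  refine TensorProduct.ext' fun a b => ?_
  simp only [canBy, actAssocInv, canLin, act, LinearMap.comp_apply, LinearMap.lTensor_tmul,
    coact_tmul, coact_betaCoact]
  induction coact k H A a with
  | zero => simp
  | add _ _ h₁ h₂ => simp only [map_add, TensorProduct.add_tmul, h₁, h₂]
  | tmul a h =>
  induction coact k H A b with
  | zero => simp
  | add _ _ h₁ h₂ => simp only [map_add, TensorProduct.tmul_add, h₁, h₂]
  | tmul b g =>
  have e : canTwist k H (h ⊗ₜ g) = TensorProduct.lid k H ((omInv k H).ofConv.rTensor H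
      ((TensorProduct.assoc k H (H ⊗[k] H) H).symm (h ⊗ₜ betaSplit k H g))) := rfl
  rw [TensorProduct.tensorTensorTensorComm_tmul, TensorProduct.map_tmul, e,
    LinearMap.lTensor_tmul]
  induction betaSplit k H g with
  | zero => simp
  | add _ _ h₁ h₂ => simp only [map_add, TensorProduct.tmul_add, h₁, h₂]
  | tmul x z => simp [moveLast, TensorProduct.smul_tmul', TensorProduct.tmul_smul, smul_mul_assoc]

/-- The map `betaCoact` uses nothing but the coaction. -/
theorem betaCoact_natural {f : M →ₗ[k] N} (hf : IsColin (LinearMap.id : H →ₗ[k] H) f) :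
    betaCoact k H N ∘ₗ f = f.rTensor H ∘ₗ betaCoact k H M := by
  unfold IsColin at hf
  rw [betaCoact, betaCoact, LinearMap.comp_assoc, hf, ← LinearMap.comp_assoc,
    ← LinearMap.comp_assoc, LinearMap.lTensor_comp_map, LinearMap.rTensor_comp_lTensor,
    LinearMap.comp_id]

/-- A coinvariant has degree `1` and `ω⁻¹(1, -, -)` is trivial, so no rebracketing factor appears;
moreover `a ↦ ma` is then colinear and commutes with `betaCoact`. -/
theorem canBy_coinvariant {r : M ⊗[k] A →ₗ[k] M} (hr : IsColin (LinearMap.mul' k H) r)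
    {m : M} (hm : coact k H M m = m ⊗ₜ 1) (a : A) :
    canBy k H r (m ⊗ₜ a) = betaCoact k H M (r (m ⊗ₜ a)) := by
  have h1 := (IsColin.mk_left (k := k) (D := H ⊗[k] H) (W := A ⊗[k] H) hm).act_apply
    (omInv k H) (betaCoact k H A a)
  rw [pull_omInv_eq_one k H (isCoalgMap_one_left k H _) (pull_left k H), act_one] at h1
  simp only [TensorProduct.mk_apply, LinearMap.id_apply] at h1
  have h3 := hr.comp (IsColin.mk_left (k := k) (D := H) (W := A) hm)
  have e : LinearMap.mul' k H ∘ₗ TensorProduct.mk k H H 1 = LinearMap.id := by ext; simp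
  rw [e] at h3
  have h4 := LinearMap.congr_fun (betaCoact_natural k H h3) a
  simp only [LinearMap.comp_apply, TensorProduct.mk_apply] at h4
  have e2 : r.rTensor H ∘ₗ (TensorProduct.assoc k M A H).symm.toLinearMap ∘ₗ
      TensorProduct.mk k M (A ⊗[k] H) m = (r ∘ₗ TensorProduct.mk k M A m).rTensor H := by
    ext; simp
  rw [h4, ← e2, canBy, actAssocInv]
  simp only [LinearMap.comp_apply, LinearMap.lTensor_tmul, h1, TensorProduct.mk_apply]

/-- The quasi-associativity of `H` in dual form: `ω⁻¹` intertwines the functionals `φ((hg)p)` and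
`φ(h(gp))` in the convolution algebra. -/
theorem pull_mulL_mul_omInv (φ : CDual k H) :
    pull (mulL k H) φ * omInv k H = omInv k H * pull (mulR k H) φ := by
  have e1 : ∀ {C : Type _} [AddCommGroup C] [Module k C] [Coalgebra k C] (j : C →ₗ[k] H)
      (ψ : CDual k C), (pull j φ * ψ).ofConv = φ.ofConv ∘ₗ j ∘ₗ hitL ψ := by
    intro C _ _ _ j ψ
    ext c
    simp only [pull, LinearMap.convMul_def, LinearMap.comp_apply, hitL]
    induction Coalgebra.comul (R := k) c with
    | zero => simp
    | add _ _ h₁ h₂ => simp only [map_add, h₁, h₂]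
    | tmul x y => simp [mul_comm]
  have e2 : ∀ {C : Type _} [AddCommGroup C] [Module k C] [Coalgebra k C] (j : C →ₗ[k] H)
      (ψ : CDual k C), (ψ * pull j φ).ofConv = φ.ofConv ∘ₗ j ∘ₗ hitR ψ := by
    intro C _ _ _ j ψ
    ext c
    simp only [pull, LinearMap.convMul_def, LinearMap.comp_apply, hitR]
    induction Coalgebra.comul (R := k) c with
    | zero => simp
    | add _ _ h₁ h₂ => simp only [map_add, h₁, h₂]
    | tmul x y => simp
  apply WithConv.ofConv_injective
  rw [e1, e2, quasi_assoc_inv]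

/-- `m ⊗ a ↦ φ(m₁) m₀ ⊗ a`. -/
theorem act_unit_right {X : Type*} [AddCommGroup X] [Module k X] (φ : CDual k H) :
    act (M ⊗[k] X) (pull (TensorProduct.rid k H).toLinearMap φ) = (act M φ).rTensor X := by
  rw [rTensor_act (C := H) (D := k)]
  congr 2
  ext
  simp

/-- Colinearity of the Galois map, tested on functionals: the source carries the coaction of `M`
alone, the target the codiagonal one. The factor `A` contributes no degree because `betaCoact` lands
in coinvariants, and the rebracketing by `ω⁻¹` is colinear by quasi-associativity of `H`. -/
theorem act_canBy {r : M ⊗[k] A →ₗ[k] M} (hr : IsColin (LinearMap.mul' k H) r)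
    (φ : CDual k H) :
    act (C := H ⊗[k] H) (M ⊗[k] H) (pull (LinearMap.mul' k H) φ) ∘ₗ canBy k H r =
      canBy k H r ∘ₗ (act M φ).rTensor A := by
  refine LinearMap.ext fun t => ?_
  have hL := (hr.rTensor (E := H) (X := H)).comp
    (IsColin.assoc_symm (k := k) (C := H) (D := H) (E := H) (V := M) (W := A) (X := H))
  have h1 := hL.act_apply (pull (LinearMap.mul' k H) φ)
    (act (M ⊗[k] (A ⊗[k] H)) (omInv k H) ((betaCoact k H A).lTensor M t))
  have h2 := ((isColin_codiagonal k H A H).lTensor (E := H) (X := M)).act_apply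
    (pull (LinearMap.mul' k H) φ) ((betaCoact k H A).lTensor M t)
  have h3 := ((isColin_betaCoact k H A).lTensor (E := H) (X := M)).act_apply
    (pull (LinearMap.mul' k H) φ) t
  -- The degree contributed by `betaCoact` is `1`, so multiplying by it leaves only the degree from
  -- `M`.
  have e : LinearMap.mul' k H ∘ₗ (LinearMap.toSpanSingleton k H 1).lTensor H =
      (TensorProduct.rid k H).toLinearMap := by
    ext; simp
  rw [pull_comp, e, act_unit_right] at h3
  simp only [LinearMap.lTensor_id, LinearMap.id_apply] at h2
  rw [pull_comp, act_w_inv] at h1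
  have e2 : pull (LinearMap.mul' k H ∘ₗ (LinearMap.mul' k H).rTensor H ∘ₗ
      (TensorProduct.assoc k H H H).symm.toLinearMap) φ * omInv k H =
      omInv k H * pull (mulR k H) φ := pull_mulL_mul_omInv k H φ
  rw [e2, ← act_w_inv] at h1
  have h4 : act (M ⊗[k] (A ⊗[k] H)) (pull (mulR k H) φ) ((betaCoact k H A).lTensor M t) =
    (betaCoact k H A).lTensor M ((act M φ).rTensor A t) := h2.symm.trans h3
  rw [h4] at h1
  exact h1

/-- `a ⊗ (b ⊗ (c ⊗ d)) ↦ (a ⊗ (b ⊗ c)) ⊗ d`. -/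
def regroupFour (X Y Z W : Type*) [AddCommGroup X] [Module k X] [AddCommGroup Y] [Module k Y]
    [AddCommGroup Z] [Module k Z] [AddCommGroup W] [Module k W] :
    X ⊗[k] (Y ⊗[k] (Z ⊗[k] W)) →ₗ[k] (X ⊗[k] (Y ⊗[k] Z)) ⊗[k] W :=
  (TensorProduct.assoc k X (Y ⊗[k] Z) W).symm.toLinearMap ∘ₗ
    (TensorProduct.assoc k Y Z W).symm.toLinearMap.lTensor X

theorem rTensor_act_regroupFour (φ : CDual k (H ⊗[k] (H ⊗[k] H)))
    (s : M ⊗[k] (A ⊗[k] (A ⊗[k] H))) :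
    (act (M ⊗[k] (A ⊗[k] A)) φ).rTensor H (regroupFour k M A A H s) =
      regroupFour k M A A H (act (C := H ⊗[k] (H ⊗[k] (H ⊗[k] H))) (M ⊗[k] (A ⊗[k] (A ⊗[k] H)))
        (pull (face4 k H) φ) s) := by
  have h : IsColin (regroupFour k H H H H) (regroupFour k M A A H) :=
    (IsColin.assoc_symm (k := k) (C := H) (D := H ⊗[k] H) (E := H)
      (V := M) (W := A ⊗[k] A) (X := H)).comp
      ((IsColin.assoc_symm (k := k) (C := H) (D := H) (E := H)
        (V := A) (W := A) (X := H)).lTensor (E := H) (X := M))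
  rw [rTensor_act (C := H ⊗[k] (H ⊗[k] H)) (D := H), h.act_apply, pull_comp]
  congr 4
  ext
  simp [regroupFour, face4, TensorProduct.tmul_smul]

/-- The factor `w3` is `ω` evaluated at the product of the last two degrees. On the image of
`betaCoact` this product is `1`, and `ω(-, -, 1)` is trivial. -/
theorem act_w3_betaCoact (t : M ⊗[k] (A ⊗[k] A)) :
    act (C := H ⊗[k] (H ⊗[k] (H ⊗[k] H))) (M ⊗[k] (A ⊗[k] (A ⊗[k] H))) (w3 k H).val
      (((betaCoact k H A).lTensor A).lTensor M t) = ((betaCoact k H A).lTensor A).lTensor M t := by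
  have h1 := (((isColin_codiagonal k H A H).lTensor (E := H) (X := A)).lTensor (E := H)
    (X := M)).act_apply (om k H) (((betaCoact k H A).lTensor A).lTensor M t)
  have h2 := (((isColin_betaCoact k H A).lTensor (E := H) (X := A)).lTensor (E := H)
    (X := M)).act_apply (om k H) t
  simp only [LinearMap.lTensor_id, LinearMap.id_apply] at h1
  have e : ((LinearMap.toSpanSingleton k H 1).lTensor H).lTensor H =
      (((TensorProduct.mk k H H).flip 1).lTensor H) ∘ₗ
        (TensorProduct.rid k H).toLinearMap.lTensor H := by
    ext; simp
  rw [e, ← pull_comp, pull_right, (IsCoalgMap.rid.lTensor H).pull_one, act_one] at h2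
  exact h1.symm.trans h2

/-- The Galois map is left `A`-linear: `can(ma ⊗ b) = m₀(a₀ · can(a ⊗ b)₀) ω⁻¹`. -/
theorem canBy_act {r : M ⊗[k] A →ₗ[k] M} (hr : IsColin (LinearMap.mul' k H) r)
    (hassoc : r ∘ₗ r.rTensor A ∘ₗ (TensorProduct.assoc k M A A).symm.toLinearMap =
      r ∘ₗ (LinearMap.mul' k A).lTensor M ∘ₗ act (M ⊗[k] (A ⊗[k] A)) (om k H))
    (t : M ⊗[k] (A ⊗[k] A)) :
    canBy k H r (r.rTensor A ((TensorProduct.assoc k M A A).symm t)) =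
      actAssocInv k H r ((canBy k H (LinearMap.mul' k A)).lTensor M t) := by
  set s := ((betaCoact k H A).lTensor A).lTensor M t with hs
  -- The pentagon identity, solved so that the two ways of rebracketing stand on opposite sides;
  -- they differ only by `w3`, which acts trivially here.
  have hw : (w4 k H) * (w1 k H)⁻¹ = (w2 k H)⁻¹ * (w0 k H)⁻¹ * w3 k H := by
    have := w_cocycle k H
    rw [mul_inv_eq_iff_eq_mul, mul_assoc, this]
    group
  have hL : canBy k H r (r.rTensor A ((TensorProduct.assoc k M A A).symm t)) =
      (r ∘ₗ (LinearMap.mul' k A).lTensor M).rTensor H (regroupFour k M A A H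
        (act (C := H ⊗[k] (H ⊗[k] (H ⊗[k] H))) (M ⊗[k] (A ⊗[k] (A ⊗[k] H)))
          ((w4 k H) * (w1 k H)⁻¹).val s)) := by
    -- On this side the action of `M` is rebracketed first (`w4`, from quasi-associativity of `r`),
    -- and `w1⁻¹` is the factor `ω⁻¹` of the Galois map read on the product degree of `ma`.
    have e1 : (betaCoact k H A).lTensor M ∘ₗ r.rTensor A ∘ₗ
        (TensorProduct.assoc k M A A).symm.toLinearMap =
        (r.rTensor (A ⊗[k] H) ∘ₗ (TensorProduct.assoc k M A (A ⊗[k] H)).symm.toLinearMap) ∘ₗ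
          ((betaCoact k H A).lTensor A).lTensor M := by
      ext; simp
    have e1t := LinearMap.congr_fun e1 t
    have e2 : r.rTensor H ∘ₗ (TensorProduct.assoc k M A H).symm.toLinearMap ∘ₗ
        r.rTensor (A ⊗[k] H) ∘ₗ (TensorProduct.assoc k M A (A ⊗[k] H)).symm.toLinearMap =
        (r ∘ₗ r.rTensor A ∘ₗ (TensorProduct.assoc k M A A).symm.toLinearMap).rTensor H ∘ₗ
          regroupFour k M A A H := by
      ext; simp [regroupFour]
    have e2s := fun s => LinearMap.congr_fun e2 s
    have h1 := ((hr.rTensor (E := H ⊗[k] H) (X := A ⊗[k] H)).comp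
      (IsColin.assoc_symm (k := k) (C := H) (D := H) (E := H ⊗[k] H)
        (V := M) (W := A) (X := A ⊗[k] H))).act_apply (omInv k H) s
    simp only [LinearMap.comp_apply, LinearEquiv.coe_coe] at e1t e2s h1
    simp only [canBy, actAssocInv, LinearMap.comp_apply, LinearEquiv.coe_coe]
    rw [e1t, h1, e2s, hassoc, ← LinearMap.comp_assoc, LinearMap.rTensor_comp,
      LinearMap.comp_apply, rTensor_act_regroupFour, act_w_inv]
    rfl
  have hR : actAssocInv k H r ((canBy k H (LinearMap.mul' k A)).lTensor M t) =
      (r ∘ₗ (LinearMap.mul' k A).lTensor M).rTensor H (regroupFour k M A A H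
        (act (C := H ⊗[k] (H ⊗[k] (H ⊗[k] H))) (M ⊗[k] (A ⊗[k] (A ⊗[k] H)))
          ((w2 k H)⁻¹ * (w0 k H)⁻¹).val s)) := by
    have e1 : r.rTensor H ∘ₗ (TensorProduct.assoc k M A H).symm.toLinearMap ∘ₗ
        (mulFst k A H).lTensor M = (r ∘ₗ (LinearMap.mul' k A).lTensor M).rTensor H ∘ₗ
          regroupFour k M A A H := by
      ext; simp [regroupFour, mulFst]
    have e1s := fun s => LinearMap.congr_fun e1 s
    have h1 := ((isColin_mulFst k H A H H).lTensor (E := H) (X := M)).act_apply (omInv k H)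
      ((act (A ⊗[k] (A ⊗[k] H)) (omInv k H)).lTensor M s)
    have h2 : (act (A ⊗[k] (A ⊗[k] H)) (omInv k H)).lTensor M s =
      act (C := H ⊗[k] (H ⊗[k] (H ⊗[k] H))) (M ⊗[k] (A ⊗[k] (A ⊗[k] H)))
        (pull (face0 k H) (omInv k H)) s := by
      rw [lTensor_act (C := H) (D := H ⊗[k] (H ⊗[k] H))]; rfl
    have e2 : canBy k H (LinearMap.mul' k A) = mulFst k A H ∘ₗ
      act (A ⊗[k] (A ⊗[k] H)) (omInv k H) ∘ₗ (betaCoact k H A).lTensor A := rfl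
    simp only [LinearMap.comp_apply, LinearEquiv.coe_coe] at e1s
    simp only [e2, LinearMap.lTensor_comp, actAssocInv, LinearMap.comp_apply, LinearEquiv.coe_coe]
    rw [h1, h2, act_w_inv, e1s]
    rfl
  rw [hL, hR, hw, Units.val_mul, ← act_w_inv, act_w3_betaCoact]

theorem actAssocInv_one (r : M ⊗[k] A →ₗ[k] M) (m : M) (h : H) :
    actAssocInv k H r (m ⊗ₜ ((1 : A) ⊗ₜ h)) = r (m ⊗ₜ 1) ⊗ₜ h := by
  have h1 := ((IsColin.mk_left (k := k) (D := H) (W := H)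
    (ComoduleAlgebra.coact_one (k := k) (H := H) (A := A))).lTensor (E := H) (X := M)).act_apply
      (omInv k H) (m ⊗ₜ h)
  rw [pull_omInv_eq_one k H ((isCoalgMap_one_left k H H).lTensor H) (pull_mid k H), act_one] at h1
  simp only [LinearMap.lTensor_tmul, TensorProduct.mk_apply, LinearMap.id_apply] at h1
  simp [actAssocInv, h1]

end GaloisMap

/-! ### Calculus of tensor products over a noncommutative ring -/

section BalancedTensor

variable {B : Type*} [Ring B] {N N' N'' X P : Type*} [AddCommGroup N] [Module Bᵐᵒᵖ N]
  [AddCommGroup N'] [Module Bᵐᵒᵖ N'] [AddCommGroup N''] [Module Bᵐᵒᵖ N'']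
  [AddCommGroup X] [Module B X] [AddCommGroup P]

variable (B) in
/-- The class `n ⊗_B x`. -/
def balTmul (n : N) (x : X) : BalTensor B N X := QuotientAddGroup.mk (n ⊗ₜ[ℤ] x)

theorem balTmul_add (n : N) (x y : X) : balTmul B n (x + y) = balTmul B n x + balTmul B n y :=
  congrArg QuotientAddGroup.mk (TensorProduct.tmul_add n x y)

theorem add_balTmul (n m : N) (x : X) : balTmul B (n + m) x = balTmul B n x + balTmul B m x :=
  congrArg QuotientAddGroup.mk (TensorProduct.add_tmul n m x)

theorem zero_balTmul (x : X) : balTmul B (0 : N) x = 0 :=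
  congrArg QuotientAddGroup.mk (TensorProduct.zero_tmul N x)

theorem balTmul_zero (n : N) : balTmul B n (0 : X) = 0 :=
  congrArg QuotientAddGroup.mk (TensorProduct.tmul_zero X n)

theorem smul_balTmul (n : N) (b : B) (x : X) :
    balTmul B (MulOpposite.op b • n) x = balTmul B n (b • x) := by
  refine (QuotientAddGroup.eq_iff_sub_mem).2 ?_
  exact AddSubgroup.subset_closure ⟨n, b, x, rfl⟩

theorem sum_balTmul {ι : Type*} (s : Finset ι) (f : ι → N) (x : X) :
    balTmul B (∑ i ∈ s, f i) x = ∑ i ∈ s, balTmul B (f i) x :=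
  map_sum (⟨⟨fun n => balTmul B n x, zero_balTmul x⟩, fun n m => add_balTmul n m x⟩ :
    N →+ BalTensor B N X) f s

@[elab_as_elim]
theorem BalTensor.induction {p : BalTensor B N X → Prop} (z : BalTensor B N X) (zero : p 0)
    (tmul : ∀ n x, p (balTmul B n x)) (add : ∀ y z, p y → p z → p (y + z)) : p z := by
  obtain ⟨z, rfl⟩ := QuotientAddGroup.mk_surjective z
  induction z with
  | zero => exact zero
  | add y z hy hz => exact add _ _ hy hz
  | tmul n x => exact tmul n x

theorem BalTensor.hom_ext {f g : BalTensor B N X →+ P}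
    (h : ∀ n x, f (balTmul B n x) = g (balTmul B n x)) : f = g := by
  refine DFunLike.ext _ _ fun z => ?_
  induction z using BalTensor.induction with
  | zero => simp
  | tmul n x => exact h n x
  | add y z hy hz => rw [map_add, map_add, hy, hz]

/-- The additive map on `N ⊗_B X` given by a balanced biadditive map. -/
def balLift (f : N →+ X →+ P) (hf : ∀ n (b : B) x, f (MulOpposite.op b • n) x = f n (b • x)) :
    BalTensor B N X →+ P :=
  QuotientAddGroup.lift _ (TensorProduct.liftAddHom f fun r n x => by simp) <| by
    rw [balancedRel, AddSubgroup.closure_le]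
    rintro _ ⟨n, b, x, rfl⟩
    rw [SetLike.mem_coe, AddMonoidHom.mem_ker, map_sub, sub_eq_zero]
    exact hf n b x

@[simp] theorem balMap_tmul (f : N →ₗ[Bᵐᵒᵖ] N') (n : N) (x : X) :
    balMap X f (balTmul B n x) = balTmul B (f n) x := rfl

theorem balMap_comp (g : N' →ₗ[Bᵐᵒᵖ] N'') (f : N →ₗ[Bᵐᵒᵖ] N') (z : BalTensor B N X) :
    balMap X g (balMap X f z) = balMap X (g ∘ₗ f) z :=
  DFunLike.congr_fun (BalTensor.hom_ext (f := (balMap X g).comp (balMap X f))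
    (g := balMap X (g ∘ₗ f)) fun _ _ => rfl) z

theorem balMap_zero (z : BalTensor B N X) : balMap X (0 : N →ₗ[Bᵐᵒᵖ] N') z = 0 :=
  DFunLike.congr_fun (BalTensor.hom_ext (f := balMap X (0 : N →ₗ[Bᵐᵒᵖ] N'))
    (g := 0) fun _ x => zero_balTmul x) z

/-- Tensoring commutes with direct sums: any element of `(⨁ N) ⊗_B X` involves only finitely many
summands and is the sum of its components. -/
theorem BalTensor.eq_zero_of_forall_apply {J : Type*} (z : BalTensor B (J →₀ N) X)
    (hz : ∀ j, balMap X (Finsupp.lapply j : (J →₀ N) →ₗ[Bᵐᵒᵖ] N) z = 0) : z = 0 := by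
  classical
  -- Allowing every larger finite set `E'` makes the statement additive: two summands are compared
  -- on the union of their supports.
  have h : ∀ z : BalTensor B (J →₀ N) X, ∃ E : Finset J, ∀ E' : Finset J, E ⊆ E' →
      z = ∑ j ∈ E', balMap X (Finsupp.lsingle j : N →ₗ[Bᵐᵒᵖ] (J →₀ N))
        (balMap X (Finsupp.lapply j : (J →₀ N) →ₗ[Bᵐᵒᵖ] N) z) := by
    intro z
    induction z using BalTensor.induction with
    | zero => exact ⟨∅, fun _ _ => by simp⟩
    | tmul n x =>
      refine ⟨n.support, fun E' hE => ?_⟩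
      simp only [balMap_tmul, ← sum_balTmul]
      congr 1
      conv_lhs => rw [← Finsupp.sum_single n, Finsupp.sum_of_support_subset n hE _ (by simp)]
      rfl
    | add y z hy hz =>
      obtain ⟨E₁, h₁⟩ := hy
      obtain ⟨E₂, h₂⟩ := hz
      refine ⟨E₁ ∪ E₂, fun E' hE => ?_⟩
      simp only [map_add, Finset.sum_add_distrib]
      rw [← h₁ E' (Finset.union_subset_left hE), ← h₂ E' (Finset.union_subset_right hE)]
  obtain ⟨E, hE⟩ := h z
  rw [hE E subset_rfl]
  exact Finset.sum_eq_zero fun j _ => by rw [hz, map_zero]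

end BalancedTensor

/-! ### Consequences of faithful flatness -/

section FaithfullyFlat

variable {B X : Type v} [Ring B] [AddCommGroup X] [Module B X] {N N' : Type v} [AddCommGroup N]
  [Module Bᵐᵒᵖ N] [AddCommGroup N'] [Module Bᵐᵒᵖ N']

/-- Exactness at the middle of `0 → N → N'`, with the zero module realised in the right universe. -/
theorem LeftFaithfullyFlat.injective_iff (h : LeftFaithfullyFlat B X) (f : N →ₗ[Bᵐᵒᵖ] N') :
    Function.Injective (balMap X f) ↔ Function.Injective f := by
  rw [← LinearMap.exact_zero_iff_injective PUnit.{v + 1}, h, injective_iff_map_eq_zero]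
  refine forall_congr' fun z => ?_
  constructor
  · intro hz
    refine ⟨fun h' => ⟨0, ?_⟩, ?_⟩
    · rw [map_zero, hz h']
    · rintro ⟨w, rfl⟩
      rw [balMap_zero, map_zero]
  · intro hz h'
    obtain ⟨w, rfl⟩ := hz.1 h'
    exact balMap_zero w

theorem LeftFaithfullyFlat.surjective_iff (h : LeftFaithfullyFlat B X) (f : N →ₗ[Bᵐᵒᵖ] N') :
    Function.Surjective (balMap X f) ↔ Function.Surjective f := by
  rw [← LinearMap.exact_zero_iff_surjective PUnit.{v + 1}, h]
  refine forall_congr' fun z => ?_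
  exact ⟨fun hz => ⟨fun _ => hz, fun _ => balMap_zero z⟩, fun hz => hz.1 (balMap_zero z)⟩

/-- A common kernel of a pointwise finite family of maps is preserved by tensoring with a
flat module. -/
theorem LeftFaithfullyFlat.mem_range_of_forall (h : LeftFaithfullyFlat B X) {I : Type*}
    (g : I → N →ₗ[Bᵐᵒᵖ] N) (hg : ∀ n, {i | g i n ≠ 0}.Finite) (f : N' →ₗ[Bᵐᵒᵖ] N)
    (hf : ∀ n, n ∈ Set.range f ↔ ∀ i, g i n = 0) (y : BalTensor B N X)
    (hy : ∀ i, balMap X (g i) y = 0) : y ∈ Set.range (balMap X f) := by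
  -- Flatness is tested only on modules in universe `v`, whereas `I` is arbitrary. Indices outside
  -- `S` give the zero map, and `S` is a union of finite sets indexed by `N`, hence small.
  let S : Set I := ⋃ n, {i | g i n ≠ 0}
  have _ : ∀ n, Small.{v} {i | g i n ≠ 0} := fun n =>
    have := (hg n).to_subtype
    inferInstance
  have hS : Small.{v} S := small_iUnion _
  let e : Shrink.{v} S ≃ S := (equivShrink S).symm
  -- Pointwise finiteness lets the family be assembled into one map to a direct sum rather than a
  -- product, and direct sums commute with `⊗_B X`.
  let G : N →ₗ[Bᵐᵒᵖ] (Shrink.{v} S →₀ N) :=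
    { toFun := fun n => Finsupp.ofSupportFinite (fun j => g (e j) n)
        ((hg n).preimage (f := fun j => (e j : I))
          (Subtype.val_injective.comp e.injective).injOn)
      map_add' := fun n m => by ext j; exact map_add (g (e j)) n m
      map_smul' := fun b n => by ext j; exact map_smul (g (e j)) b n }
  have hG : ∀ n j, G n j = g (e j) n := fun n j => rfl
  have hex : Function.Exact f G := by
    intro n
    rw [hf, DFunLike.ext_iff]
    refine ⟨fun h i => ?_, fun h j => ?_⟩
    · by_contra hi
      have hiS : i ∈ S := Set.mem_iUnion.2 ⟨n, hi⟩
      have := h (e.symm ⟨i, hiS⟩)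
      rw [hG, Equiv.apply_symm_apply] at this
      exact hi this
    · exact h _
  refine ((h N' N (Shrink.{v} S →₀ N) f G).1 hex y).1
    (BalTensor.eq_zero_of_forall_apply _ fun j => ?_)
  rw [balMap_comp]
  exact hy (e j)

end FaithfullyFlat

/-! ### Testing tensors and colinearity on linear functionals -/

section Functionals

variable {k : Type*} [Field k] {C D V W : Type*} [AddCommGroup C] [Module k C] [Coalgebra k C]
  [AddCommGroup D] [Module k D] [Coalgebra k D] [AddCommGroup V] [Module k V] [AddCommGroup W]
  [Module k W]

/-- Over a field, the coordinate functionals of a basis of `W` already separate points of `V ⊗ W`.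
-/
theorem tensor_ext_of_functionals {x y : V ⊗[k] W}
    (h : ∀ φ : W →ₗ[k] k, TensorProduct.rid k V (φ.lTensor V x) =
      TensorProduct.rid k V (φ.lTensor V y)) : x = y := by
  classical
  refine (TensorProduct.equivFinsuppOfBasisRight (M := V)
    (Module.Basis.ofVectorSpace k W)).injective (Finsupp.ext fun i => ?_)
  rw [TensorProduct.equivFinsuppOfBasisRight_apply, TensorProduct.equivFinsuppOfBasisRight_apply, h]

theorem isColin_of_act [RightComodule k C V] [RightComodule k D W] {j : C →ₗ[k] D} {g : V →ₗ[k] W}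
    (h : ∀ φ : CDual k D, act W φ ∘ₗ g = g ∘ₗ act V (pull j φ)) : IsColin j g := by
  refine LinearMap.ext fun v => tensor_ext_of_functionals fun φ => ?_
  refine (LinearMap.congr_fun (h (WithConv.toConv φ)) v).trans ?_
  simp only [act, LinearMap.comp_apply]
  induction coact k C V v with
  | zero => simp
  | add _ _ h₁ h₂ => simp only [map_add, h₁, h₂]
  | tmul v c => simp [pull]

end Functionals

/-! ### Hopf modules as right `B`-modules and the Galois map over `B` -/

section HopfModules

variable (k : Type*) [Field k]
variable (H : Type*) [NonAssocRing H] [Module k H] [SMulCommClass k H H] [IsScalarTower k H H]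
  [Coalgebra k H] [CoquasiHopfAlgebra k H]
variable (A : Type*) [NonAssocRing A] [Module k A] [SMulCommClass k A A]
  [IsScalarTower k A A] [RightComodule k H A] [ComoduleAlgebra k H A]
variable (M : Type*) [AddCommGroup M] [Module k M] [RightComodule k H M] [HopfBimodule k H A M]

attribute [local instance] trivialComodule antipodeComodule codiagonal

/-- The right action of `A` on a two-sided Hopf module. -/
abbrev rightAct : M ⊗[k] A →ₗ[k] M := HopfBimodule.ract (k := k) (H := H)

theorem isColin_rightAct : IsColin (LinearMap.mul' k H) (rightAct k H A M) :=
  HopfBimodule.coact_ract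

variable {A M}

/-- The reassociating factor is `ω(-, -, 1)`, which is trivial. With both elements in `B` this gives
a genuinely associative right `B`-action. -/
theorem rightAct_rightAct (m : M) (a : A) {b : A} (hb : b ∈ coinvariants k H A) :
    rightAct k H A M (rightAct k H A M (m ⊗ₜ a) ⊗ₜ b) = rightAct k H A M (m ⊗ₜ (a * b)) := by
  have h1 := ((IsColin.mk_right (k := k) (D := H) (W := A)
    ((mem_coinvariants k H).1 hb)).lTensor (E := H) (X := M)).act_apply (om k H) (m ⊗ₜ a)
  rw [pull_right, act_one] at h1
  have h2 := LinearMap.congr_fun (HopfBimodule.ract_assoc (k := k) (H := H) (A := A) (M := M))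
    (m ⊗ₜ (a ⊗ₜ b))
  simp only [LinearMap.lTensor_tmul, LinearMap.flip_apply, TensorProduct.mk_apply,
    LinearMap.id_apply] at h1
  simp only [LinearMap.comp_apply, h1] at h2
  simpa using h2

variable (A M)

/-- A two-sided Hopf module is a right module over the coinvariants of `A`. -/
@[reducible] def hopfRightModule : Module (coinvariants k H A)ᵐᵒᵖ M where
  smul b m := rightAct k H A M (m ⊗ₜ (b.unop : A))
  one_smul m := HopfBimodule.ract_one m
  mul_smul b c m := (rightAct_rightAct k H m (c.unop : A) b.unop.2).symm
  smul_zero b := by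
    change rightAct k H A M (0 ⊗ₜ _) = 0
    rw [TensorProduct.zero_tmul, map_zero]
  smul_add b x y := by
    change rightAct k H A M ((x + y) ⊗ₜ _) = _
    rw [TensorProduct.add_tmul, map_add]; rfl
  add_smul b c m := by
    change rightAct k H A M (m ⊗ₜ ((b.unop : A) + (c.unop : A))) = _
    rw [TensorProduct.tmul_add, map_add]; rfl
  zero_smul m := by
    change rightAct k H A M (m ⊗ₜ (0 : A)) = 0
    rw [TensorProduct.tmul_zero, map_zero]

attribute [local instance] hopfRightModule

variable {A M}

theorem hopfRight_smul (b : coinvariants k H A) (m : M) :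
    MulOpposite.op b • m = rightAct k H A M (m ⊗ₜ (b : A)) := rfl

theorem coinvLeft_smul (b : coinvariants k H A) (a : A) : b • a = b * a := rfl

/-- `a ↦ ma` as a map of right modules over the coinvariants. -/
def rightByLin (m : M) : A →ₗ[(coinvariants k H A)ᵐᵒᵖ] M where
  toFun a := rightAct k H A M (m ⊗ₜ a)
  map_add' a b := by rw [TensorProduct.tmul_add, map_add]
  map_smul' b a := (rightAct_rightAct k H m a b.unop.2).symm

/-- Scalars act on `A` by maps of right modules over the coinvariants. -/
def scalarLin (c : k) : A →ₗ[(coinvariants k H A)ᵐᵒᵖ] A where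
  toFun a := c • a
  map_add' a b := smul_add c a b
  map_smul' b a := smul_mul_assoc c a (b.unop : A) |>.symm

variable (A M)

/-- The quotient map `M ⊗ A → M ⊗_B A`. -/
def balMk : M ⊗[k] A →+ BalTensor (coinvariants k H A) M A :=
  TensorProduct.liftAddHom
    ⟨⟨fun m => ⟨⟨fun a => balTmul (coinvariants k H A) m a, balTmul_zero m⟩, balTmul_add m⟩,
      by ext a; exact zero_balTmul a⟩, fun m n => by ext a; exact add_balTmul m n a⟩ <| by
    intro c m a
    -- Scalars act through `B`, as multiples of `1`, so `B`-balanced implies `k`-balanced.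
    have h1 : c • m = MulOpposite.op (c • (1 : coinvariants k H A)) • m := by
      rw [hopfRight_smul]
      change _ = rightAct k H A M (m ⊗ₜ (c • (1 : A)))
      rw [TensorProduct.tmul_smul, map_smul, rightAct, HopfBimodule.ract_one]
    have h2 : c • a = (c • (1 : coinvariants k H A)) • a := by
      rw [coinvLeft_smul]
      change _ = (c • (1 : A)) * a
      rw [smul_mul_assoc, one_mul]
    change balTmul _ (c • m) a = balTmul _ m (c • a)
    rw [h1, h2, smul_balTmul]

theorem balMk_tmul (m : M) (a : A) : balMk k H A M (m ⊗ₜ a) =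
    balTmul (coinvariants k H A) m a := rfl

/-- By `canBy_act`, the left side is the rebracketing of `m · can(b ⊗ a)`, and for coinvariant `b`
one has `can(b ⊗ a) = betaCoact (ba)`. -/
theorem canBy_balanced (m : M) (a : A) {b : A} (hb : b ∈ coinvariants k H A) :
    canBy k H (rightAct k H A M) (rightAct k H A M (m ⊗ₜ b) ⊗ₜ a) =
      canBy k H (rightAct k H A M) (m ⊗ₜ (b * a)) := by
  have h1 := canBy_act k H (isColin_rightAct k H A M) HopfBimodule.ract_assoc (m ⊗ₜ (b ⊗ₜ a))
  have h2 := canBy_coinvariant k H (isColin_mul k H A) ((mem_coinvariants k H).1 hb) a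
  rw [LinearMap.mul'_apply] at h2
  rw [LinearMap.lTensor_tmul, h2] at h1
  simpa [canBy] using h1

/-- The Galois map `M ⊗_B A → M ⊗ H`. -/
def canBal : BalTensor (coinvariants k H A) M A →+ M ⊗[k] H :=
  balLift
    ⟨⟨fun m => ⟨⟨fun a => canBy k H (rightAct k H A M) (m ⊗ₜ a), by simp⟩,
      fun a b => by simp [TensorProduct.tmul_add]⟩,
      by ext a; simp⟩, fun m n => by ext a; simp [TensorProduct.add_tmul]⟩
    fun m b a => canBy_balanced k H A M m a b.2

theorem can_tmul (a b : A) : can k H A (balTmul (coinvariants k H A) a b) =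
    canLin k H A (a ⊗ₜ b) := rfl

variable {A}

theorem canLin_surjective (hgal : IsGaloisExtension k H A) :
    Function.Surjective (canLin k H A) := by
  intro z
  obtain ⟨t, rfl⟩ := hgal.2 z
  induction t using BalTensor.induction with
  | zero => exact ⟨0, by simp⟩
  | tmul a b => exact ⟨a ⊗ₜ b, rfl⟩
  | add y z hy hz =>
    obtain ⟨y', hy'⟩ := hy
    obtain ⟨z', hz'⟩ := hz
    exact ⟨y' + z', by rw [map_add, map_add, hy', hz']⟩

/-- Only additivity is built into `can`. Its `k`-linearity is needed so that `m ⊗ z ↦ m · can⁻¹(z)`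
is balanced over `k`. -/
theorem can_scalar (c : k) (t : BalTensor (coinvariants k H A) A A) :
    can k H A (balMap A (scalarLin k H c) t) = c • can k H A t := by
  induction t using BalTensor.induction with
  | zero => simp
  | tmul a b =>
    rw [balMap_tmul, can_tmul, can_tmul, ← map_smul]
    rfl
  | add y z hy hz => rw [map_add, map_add, map_add, hy, hz, smul_add]

/-- The inverse of the Galois map. -/
def canInv (hgal : IsGaloisExtension k H A) : A ⊗[k] H →+ BalTensor (coinvariants k H A) A A :=
  (AddEquiv.ofBijective (can k H A) hgal).symm.toAddMonoidHom

theorem canInv_can (hgal : IsGaloisExtension k H A) (t : BalTensor (coinvariants k H A) A A) :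
    canInv k H hgal (can k H A t) = t :=
  (AddEquiv.ofBijective (can k H A) hgal).symm_apply_apply t

theorem can_canInv (hgal : IsGaloisExtension k H A) (t : A ⊗[k] H) :
    can k H A (canInv k H hgal t) = t :=
  (AddEquiv.ofBijective (can k H A) hgal).apply_symm_apply t

/-- `m ⊗ z ↦ m · can⁻¹(z)`. -/
def translate (hgal : IsGaloisExtension k H A) :
    M ⊗[k] (A ⊗[k] H) →+ BalTensor (coinvariants k H A) M A :=
  TensorProduct.liftAddHom
    ⟨⟨fun m => (balMap A (rightByLin k H m)).comp (canInv k H hgal), by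
      refine DFunLike.ext _ _ fun z => ?_
      have : rightByLin k H (A := A) (0 : M) = 0 := by ext a; simp [rightByLin]
      change balMap A (rightByLin k H 0) _ = 0
      rw [this, balMap_zero]⟩, fun m n => by
      refine DFunLike.ext _ _ fun z => ?_
      change balMap A (rightByLin k H (m + n)) _ = balMap A (rightByLin k H m) _ +
        balMap A (rightByLin k H n) _
      induction canInv k H hgal z using BalTensor.induction with
      | zero => simp
      | tmul a b => simp [rightByLin, TensorProduct.add_tmul, add_balTmul]
      | add y z hy hz => simp only [map_add, hy, hz]; abel⟩ <| by
    intro c m z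
    have h1 : canInv k H hgal (c • z) = balMap A (scalarLin k H c) (canInv k H hgal z) := by
      rw [← canInv_can k H hgal (balMap A (scalarLin k H c) _), can_scalar, can_canInv]
    have h2 : rightByLin k H (A := A) (c • m) = rightByLin k H m ∘ₗ scalarLin k H c := by
      ext a
      simp [rightByLin, scalarLin, TensorProduct.smul_tmul]
    change balMap A (rightByLin k H (c • m)) _ = balMap A (rightByLin k H m) _
    rw [h1, balMap_comp, h2]

/-- On `z = can(a ⊗ b)` the translation `m · can⁻¹(z)` is `ma ⊗_B b`. Since `can` is surjective this
formula determines `translate`. -/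
theorem translate_canLin (hgal : IsGaloisExtension k H A) (t : M ⊗[k] (A ⊗[k] A)) :
    translate k H M hgal ((canLin k H A).lTensor M t) = balMk k H A M
      ((rightAct k H A M).rTensor A ((TensorProduct.assoc k M A A).symm t)) := by
  induction t with
  | zero => simp
  | add _ _ h₁ h₂ => simp only [map_add, h₁, h₂]
  | tmul m x =>
  induction x with
  | zero => simp
  | add _ _ h₁ h₂ => simp only [map_add, TensorProduct.tmul_add, h₁, h₂]
  | tmul a b =>
  change balMap A (rightByLin k H m) (canInv k H hgal (can k H A (balTmul _ a b))) = _
  rw [canInv_can]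
  rfl

end HopfModules

/-! ### Bijectivity of the Galois map for every two-sided Hopf module -/

section GaloisBijective

variable (k : Type*) [Field k]
variable (H : Type*) [NonAssocRing H] [Module k H] [SMulCommClass k H H] [IsScalarTower k H H]
  [Coalgebra k H] [CoquasiHopfAlgebra k H]
variable {A : Type*} [NonAssocRing A] [Module k A] [SMulCommClass k A A]
  [IsScalarTower k A A] [RightComodule k H A] [ComoduleAlgebra k H A]
variable (M : Type*) [AddCommGroup M] [Module k M] [RightComodule k H M] [HopfBimodule k H A M]

attribute [local instance] trivialComodule antipodeComodule codiagonal hopfRightModule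

/-- The case `M = A` of `act_canBy`: the second tensorand of `A ⊗ A` has the trivial coaction over
`k`. -/
theorem isColin_canLin : IsColin (TensorProduct.rid k H).toLinearMap (canLin k H A) := by
  refine isColin_of_act fun φ => ?_
  have h1 := (isColin_codiagonal k H A H).act_comp φ
  rw [LinearMap.id_comp, LinearMap.comp_id] at h1
  rw [h1, act_unit_right, ← canBy_mul, act_canBy k H (isColin_mul k H A)]

/-- Quasi-associativity of `translate`. Writing an element of `A ⊗ H` as `can(b ⊗ c)`, the two sides
become `(ma)b ⊗_B c` and the `ω`-twisted `m(ab) ⊗_B c`, equal by quasi-associativity of the right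
action on `M`. -/
theorem translate_rightAct (hgal : IsGaloisExtension k H A) (y : M ⊗[k] (A ⊗[k] (A ⊗[k] H))) :
    translate k H M hgal ((rightAct k H A M).rTensor (A ⊗[k] H)
      ((TensorProduct.assoc k M A (A ⊗[k] H)).symm y)) =
    translate k H M hgal ((actAssocInv k H (LinearMap.mul' k A)).lTensor M
      (act (M ⊗[k] (A ⊗[k] (A ⊗[k] H))) (om k H) y)) := by
  obtain ⟨x, rfl⟩ := LinearMap.lTensor_surjective M (LinearMap.lTensor_surjective A
    (canLin_surjective k H hgal)) y
  -- Colinearity of `can` moves the action of `ω` from `A ⊗ H` to `A ⊗ A`, where only the degree of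
  -- the first tensorand counts.
  have h1 := (((isColin_canLin k H (A := A)).lTensor (E := H) (X := A)).lTensor (E := H)
    (X := M)).act_apply (om k H) x
  set x' := act (M ⊗[k] (A ⊗[k] (A ⊗[k] A)))
    (pull (((TensorProduct.rid k H).toLinearMap.lTensor H).lTensor H) (om k H)) x with hx'
  have hL : (rightAct k H A M).rTensor (A ⊗[k] H) ((TensorProduct.assoc k M A (A ⊗[k] H)).symm
      (((canLin k H A).lTensor A).lTensor M x)) = (canLin k H A).lTensor M
        ((rightAct k H A M).rTensor (A ⊗[k] A) ((TensorProduct.assoc k M A (A ⊗[k] A)).symm x)) := by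
    have e : (rightAct k H A M).rTensor (A ⊗[k] H) ∘ₗ
        (TensorProduct.assoc k M A (A ⊗[k] H)).symm.toLinearMap ∘ₗ
        ((canLin k H A).lTensor A).lTensor M = (canLin k H A).lTensor M ∘ₗ
        (rightAct k H A M).rTensor (A ⊗[k] A) ∘ₗ
        (TensorProduct.assoc k M A (A ⊗[k] A)).symm.toLinearMap := by
      ext; simp
    exact LinearMap.congr_fun e x
  have hR : (actAssocInv k H (LinearMap.mul' k A)).lTensor M
      (((canLin k H A).lTensor A).lTensor M x') =
      (canLin k H A).lTensor M ((mulFst k A A).lTensor M x') := by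
    have e : actAssocInv k H (LinearMap.mul' k A) ∘ₗ (canLin k H A).lTensor A =
        canLin k H A ∘ₗ mulFst k A A := by
      refine LinearMap.ext fun t => ?_
      rw [← canBy_mul]
      exact (canBy_act k H (isColin_mul k H A) (ComoduleAlgebra.quasi_assoc (k := k) (H := H))
        t).symm
    have ex := LinearMap.congr_fun (congrArg (LinearMap.lTensor M) e) x'
    simpa only [LinearMap.lTensor_comp, LinearMap.comp_apply] using ex
  have hx2 : regroupFour k M A A A x' =
      (act (M ⊗[k] (A ⊗[k] A)) (om k H)).rTensor A (regroupFour k M A A A x) := by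
    have h : IsColin (regroupFour k H H H k) (regroupFour k M A A A) :=
      (IsColin.assoc_symm (k := k) (C := H) (D := H ⊗[k] H) (E := k)
        (V := M) (W := A ⊗[k] A) (X := A)).comp
        ((IsColin.assoc_symm (k := k) (C := H) (D := H) (E := k)
          (V := A) (W := A) (X := A)).lTensor (E := H) (X := M))
    rw [rTensor_act (C := H ⊗[k] (H ⊗[k] H)) (D := k), h.act_apply, pull_comp, hx']
    congr 4
    ext
    simp [regroupFour]
  have e1 : (rightAct k H A M).rTensor A ∘ₗ (TensorProduct.assoc k M A A).symm.toLinearMap ∘ₗ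
      (rightAct k H A M).rTensor (A ⊗[k] A) ∘ₗ
      (TensorProduct.assoc k M A (A ⊗[k] A)).symm.toLinearMap =
      (rightAct k H A M ∘ₗ (rightAct k H A M).rTensor A ∘ₗ
        (TensorProduct.assoc k M A A).symm.toLinearMap).rTensor A ∘ₗ regroupFour k M A A A := by
    ext; simp [regroupFour]
  have e2 : (rightAct k H A M).rTensor A ∘ₗ (TensorProduct.assoc k M A A).symm.toLinearMap ∘ₗ
      (mulFst k A A).lTensor M = (rightAct k H A M ∘ₗ (LinearMap.mul' k A).lTensor M).rTensor A ∘ₗ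
        regroupFour k M A A A := by
    ext; simp [regroupFour, mulFst]
  have e1x := LinearMap.congr_fun e1 x
  have e2x := LinearMap.congr_fun e2 x'
  simp only [LinearMap.comp_apply, LinearEquiv.coe_coe] at e1x e2x
  rw [hL, translate_canLin, h1, hR, translate_canLin, e1x, e2x, hx2, HopfBimodule.ract_assoc,
    ← LinearMap.comp_assoc, LinearMap.rTensor_comp]
  rfl

/-- `h ↦ 1 ⊗ h`, with values in `A ⊗ H`. -/
theorem isColin_one_left : IsColin (LinearMap.id : H →ₗ[k] H) (TensorProduct.mk k A H 1) := by
  have h1 := (isColin_codiagonal k H A H).comp (IsColin.mk_left (k := k) (D := H) (W := H)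
    (ComoduleAlgebra.coact_one (k := k) (H := H) (A := A)))
  have e : LinearMap.mul' k H ∘ₗ TensorProduct.mk k H H 1 = LinearMap.id := by ext; simp
  rwa [e, LinearMap.id_comp] at h1

/-- On `y = m ⊗ (a ⊗ h)` the left side translates `1 ⊗ h` by `ma`, with a factor `ω⁻¹`. Moving `a`
to the right by `translate_rightAct` produces `ω`, the two cancel, and the action of `a` on `1 ⊗ h`
is `a ⊗ h`. -/
theorem translate_actAssocInv (hgal : IsGaloisExtension k H A) (y : M ⊗[k] (A ⊗[k] H)) :
    translate k H M hgal ((TensorProduct.mk k A H 1).lTensor M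
      (actAssocInv k H (rightAct k H A M) y)) = translate k H M hgal y := by
  have h1 := (((isColin_one_left k H (A := A)).lTensor (E := H) (X := A)).lTensor (E := H)
    (X := M)).act_apply (om k H) (act (M ⊗[k] (A ⊗[k] H)) (omInv k H) y)
  simp only [LinearMap.lTensor_id] at h1
  have h0 : pull LinearMap.id (om k H) * omInv k H = 1 := om_mul_omInv k H
  rw [act_w_inv, h0, act_one, LinearMap.id_apply] at h1
  have e : (TensorProduct.mk k A H 1).lTensor M ∘ₗ (rightAct k H A M).rTensor H ∘ₗ
      (TensorProduct.assoc k M A H).symm.toLinearMap = (rightAct k H A M).rTensor (A ⊗[k] H) ∘ₗ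
      (TensorProduct.assoc k M A (A ⊗[k] H)).symm.toLinearMap ∘ₗ
      ((TensorProduct.mk k A H 1).lTensor A).lTensor M := by
    ext; simp
  have ey := LinearMap.congr_fun e (act (M ⊗[k] (A ⊗[k] H)) (omInv k H) y)
  simp only [LinearMap.comp_apply, LinearEquiv.coe_coe] at ey
  have e3 : actAssocInv k H (LinearMap.mul' k A) ∘ₗ (TensorProduct.mk k A H 1).lTensor A =
      LinearMap.id := by
    refine TensorProduct.ext' fun a h => ?_
    rw [LinearMap.comp_apply, LinearMap.lTensor_tmul, TensorProduct.mk_apply, actAssocInv_one]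
    simp
  simp only [actAssocInv, LinearMap.comp_apply, LinearEquiv.coe_coe]
  have e3y := LinearMap.congr_fun (congrArg (LinearMap.lTensor M) e3) y
  rw [LinearMap.lTensor_comp, LinearMap.lTensor_id, LinearMap.comp_apply,
    LinearMap.id_apply] at e3y
  rw [ey, translate_rightAct, h1, e3y]

/-- The Galois map of a two-sided Hopf module is bijective. -/
theorem canBal_bijective (hgal : IsGaloisExtension k H A) :
    Function.Bijective (canBal k H A M) := by
  constructor
  -- The inverse is `m ⊗ h ↦ m · can⁻¹(1 ⊗ h)`.
  · refine Function.LeftInverse.injective (g := fun y => translate k H M hgal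
      ((TensorProduct.mk k A H 1).lTensor M y)) fun t => ?_
    refine DFunLike.congr_fun (BalTensor.hom_ext (f := ((translate k H M hgal).comp
      ((TensorProduct.mk k A H 1).lTensor M).toAddMonoidHom).comp (canBal k H A M))
      (g := AddMonoidHom.id _) fun m a => ?_) t
    -- Writing `m` as `m1` expresses the Galois map of `M` through that of `A`, applied to `1 ⊗ a`.
    have h1 := canBy_act k H (isColin_rightAct k H A M) HopfBimodule.ract_assoc
      (m ⊗ₜ ((1 : A) ⊗ₜ a))
    have h2 : rightAct k H A M (m ⊗ₜ 1) = m := HopfBimodule.ract_one m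
    simp only [TensorProduct.assoc_symm_tmul, LinearMap.rTensor_tmul, h2] at h1
    change translate k H M hgal ((TensorProduct.mk k A H 1).lTensor M
      (canBy k H (rightAct k H A M) (m ⊗ₜ a))) = balTmul _ m a
    rw [h1, translate_actAssocInv, canBy_mul, translate_canLin]
    simp [balMk_tmul, h2]
  · intro y
    -- Left linearity of the Galois map again: applied to `m · can⁻¹(z)` it gives `m · z`
    -- rebracketed. At `z = 1 ⊗ h` the rebracketing is trivial.
    have h : ∀ t : M ⊗[k] (A ⊗[k] H), canBal k H A M (translate k H M hgal t) =
        actAssocInv k H (rightAct k H A M) t := by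
      intro t
      obtain ⟨x, rfl⟩ := LinearMap.lTensor_surjective M (canLin_surjective k H hgal) t
      rw [translate_canLin, ← canBy_mul, ← canBy_act k H (isColin_rightAct k H A M)
        HopfBimodule.ract_assoc]
      generalize (rightAct k H A M).rTensor A ((TensorProduct.assoc k M A A).symm x) = z
      induction z with
      | zero => simp
      | add _ _ h₁ h₂ => simp only [map_add, h₁, h₂]
      | tmul m a => rfl
    refine ⟨translate k H M hgal ((TensorProduct.mk k A H 1).lTensor M y), ?_⟩
    rw [h]
    induction y with
    | zero => simp
    | add _ _ h₁ h₂ => simp only [map_add, h₁, h₂]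
    | tmul m h =>
    rw [LinearMap.lTensor_tmul, TensorProduct.mk_apply, actAssocInv_one, rightAct,
      HopfBimodule.ract_one]

end GaloisBijective

/-! ### Coinvariants as `L`-modules and the map `M^{co H} ⊗_B A → M` -/

section CoinvariantModules

variable (k : Type*) [Field k]
variable (H : Type*) [NonAssocRing H] [Module k H] [SMulCommClass k H H] [IsScalarTower k H H]
  [Coalgebra k H] [CoquasiHopfAlgebra k H]
variable (A : Type*) [NonAssocRing A] [Module k A] [SMulCommClass k A A]
  [IsScalarTower k A A] [RightComodule k H A] [ComoduleAlgebra k H A]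
variable (M : Type*) [AddCommGroup M] [Module k M] [RightComodule k H M] [HopfBimodule k H A M]

attribute [local instance] antipodeComodule codiagonal freeBimodule hopfRightModule

variable {M} in
theorem sandwich_tmul (m : M) (a b : A) : sandwich k H A m (a ⊗ₜ b) =
    HopfBimodule.lact (k := k) (H := H) (a ⊗ₜ rightAct k H A M (m ⊗ₜ b)) := rfl

variable {M} in
theorem sandwich_one_tmul (m : M) (b : A) :
    sandwich k H A m (1 ⊗ₜ b) = rightAct k H A M (m ⊗ₜ b) := by
  rw [sandwich_tmul, HopfBimodule.one_lact]

variable {M} in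
theorem sandwich_add (m n : M) (x : A ⊗[k] A) :
    sandwich k H A (m + n) x = sandwich k H A m x + sandwich k H A n x := by
  induction x with
  | zero => simp
  | add _ _ h₁ h₂ => simp only [map_add, h₁, h₂]; abel
  | tmul a b => simp [sandwich_tmul, TensorProduct.add_tmul, TensorProduct.tmul_add]

variable {M} in
theorem sandwich_smul (c : k) (m : M) (x : A ⊗[k] A) :
    sandwich k H A (c • m) x = c • sandwich k H A m x := by
  induction x with
  | zero => simp
  | add _ _ h₁ h₂ => simp only [map_add, h₁, h₂, smul_add]
  | tmul a b => simp [sandwich_tmul, ← TensorProduct.smul_tmul']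

variable {M} in
theorem sandwich_zero (x : A ⊗[k] A) : sandwich k H A (0 : M) x = 0 := by
  simpa using sandwich_smul k H A 0 (0 : M) x

/-- The coinvariants of a two-sided Hopf module, as a left module over `L`. -/
def Coinv (_A M : Type*) [AddCommGroup M] [Module k M] [RightComodule k H M] : Type _ :=
  coinvariants k H M

instance : AddCommGroup (Coinv k H A M) := inferInstanceAs (AddCommGroup (coinvariants k H M))

/-- The action is `(a ⊗ b)m = a(mb)`. It is associative because `sandwich m` is a bimodule map, so
applying it after `sandwich y` is again a sandwich, by `sandwich m y`. -/
instance : Module (envCoinvariants k H A) (Coinv k H A M) where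
  smul l m := ⟨sandwich k H A m.1 l.1, sandwich_mem k H A m.2 l.1 l.2⟩
  one_smul m := Subtype.ext (sandwich_one k H A m.1)
  mul_smul x y m := Subtype.ext <| by
    change sandwich k H A m.1 (envMul k H A x y) = sandwich k H A (sandwich k H A m.1 y.1) x.1
    rw [envMul_eq, sandwich_sandwich k H A m.2]
  smul_zero l := Subtype.ext (sandwich_zero k H A l.1)
  smul_add l m n := Subtype.ext (sandwich_add k H A m.1 n.1 l.1)
  add_smul x y m := Subtype.ext (map_add (sandwich k H A m.1) x.1 y.1)
  zero_smul m := Subtype.ext (map_zero (sandwich k H A m.1))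

theorem free_one_tmul (b c : A) : freeR k H A ((1 ⊗ₜ c) ⊗ₜ b) = 1 ⊗ₜ (c * b) := by
  have h := (IsColin.mk_left (k := k) (D := H ⊗[k] H) (W := A ⊗[k] A)
    (ComoduleAlgebra.coact_one (k := k) (H := H) (A := A))).act_apply (om k H) (c ⊗ₜ b)
  rw [pull_left, act_one] at h
  simp only [TensorProduct.mk_apply, LinearMap.id_apply] at h
  simp [freeR, h]

theorem one_tmul_mem_env {b : A} (hb : b ∈ coinvariants k H A) :
    (1 : A) ⊗ₜ[k] b ∈ envCoinvariants k H A := by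
  refine (mem_coinvariants k H).2 ?_
  change (LinearMap.mul' k H).lTensor _ (coact k (H ⊗[k] H) (A ⊗[k] A) (1 ⊗ₜ b)) = _
  rw [coact_tmul, ComoduleAlgebra.coact_one, (mem_coinvariants k H).1 hb]
  simp

/-- The homomorphism `B^op → L`, `b ↦ 1 ⊗ b`. -/
def coinvToEnv : (coinvariants k H A)ᵐᵒᵖ →+* envCoinvariants k H A where
  toFun b := ⟨1 ⊗ₜ b.unop.1, one_tmul_mem_env k H A b.unop.2⟩
  map_one' := rfl
  map_mul' b c := Subtype.ext <| by
    change (1 : A) ⊗ₜ[k] (c.unop.1 * b.unop.1) = envMul k H A (1 ⊗ₜ b.unop.1) (1 ⊗ₜ c.unop.1)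
    rw [envMul_eq, sandwich_one_tmul]
    exact (free_one_tmul k H A b.unop.1 c.unop.1).symm
  map_zero' := Subtype.ext (TensorProduct.tmul_zero A (1 : A))
  map_add' b c := Subtype.ext (TensorProduct.tmul_add (1 : A) b.unop.1 c.unop.1)

/-- A left `L`-module is a right `B`-module. -/
@[reducible] def envRightModule (V : Type*) [AddCommGroup V] [Module (envCoinvariants k H A) V] :
    Module (coinvariants k H A)ᵐᵒᵖ V := Module.compHom V (coinvToEnv k H A)

attribute [local instance] envRightModule

-- The `B`-action obtained through `L` agrees with right multiplication, so `M^{co H}` is a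
-- `B`-submodule of `M`.
variable {A M} in
theorem Coinv.right_smul_val (b : (coinvariants k H A)ᵐᵒᵖ) (m : Coinv k H A M) :
    (b • m).1 = rightAct k H A M (m.1 ⊗ₜ b.unop.1) :=
  sandwich_one_tmul k H A m.1 b.unop.1

/-- The inclusion of the coinvariants as a map of right `B`-modules. -/
def coinvIncl : Coinv k H A M →ₗ[(coinvariants k H A)ᵐᵒᵖ] M where
  toFun m := m.1
  map_add' _ _ := rfl
  map_smul' b m := Coinv.right_smul_val k H b m

/-- `m ⊗_B a ↦ ma`. -/
def mulBal : BalTensor (coinvariants k H A) (Coinv k H A M) A →+ M :=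
  balLift
    ⟨⟨fun m => ⟨⟨fun a => rightAct k H A M (m.1 ⊗ₜ a), by simp⟩,
      fun a b => by simp [TensorProduct.tmul_add]⟩, by
        ext a
        change rightAct k H A M ((0 : M) ⊗ₜ a) = 0
        simp⟩, fun m n => by
        ext a
        change rightAct k H A M ((m.1 + n.1) ⊗ₜ a) = _
        simp [TensorProduct.add_tmul]⟩ <| by
    intro m b a
    -- For coinvariant `m` the reassociating factor is `ω(1, -, -)`, so `(mb)a = m(ba)`.
    have h := LinearMap.congr_fun (rightBy_mul k H A m.2) (b.1 ⊗ₜ a)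
    change rightAct k H A M ((MulOpposite.op b • m).1 ⊗ₜ a) = rightAct k H A M (m.1 ⊗ₜ (b.1 * a))
    rw [Coinv.right_smul_val]
    exact h.symm

variable {A M} in
theorem mulBal_tmul (m : Coinv k H A M) (a : A) :
    mulBal k H A M (balTmul (coinvariants k H A) m a) = rightAct k H A M (m.1 ⊗ₜ a) := rfl

/-- The commutative square on which descent rests: on `M^{co H} ⊗_B A` the bijective Galois map is
multiplication followed by the injective `betaCoact`. -/
theorem canBal_incl (t : BalTensor (coinvariants k H A) (Coinv k H A M) A) :
    canBal k H A M (balMap A (coinvIncl k H A M) t) = betaCoact k H M (mulBal k H A M t) := by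
  refine DFunLike.congr_fun (BalTensor.hom_ext
    (f := (canBal k H A M).comp (balMap A (coinvIncl k H A M)))
    (g := (betaCoact k H M).toAddMonoidHom.comp (mulBal k H A M)) fun m a => ?_) t
  exact canBy_coinvariant k H (isColin_rightAct k H A M) ((mem_coinvariants k H).1 m.2) a

variable {A M} in
theorem act_rightAct (φ : CDual k H) (m : M) {b : A} (hb : b ∈ coinvariants k H A) :
    act M φ (rightAct k H A M (m ⊗ₜ b)) = rightAct k H A M (act M φ m ⊗ₜ b) := by
  have h := ((isColin_rightAct k H A M).comp (IsColin.mk_right (k := k) (D := H) (W := M)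
    ((mem_coinvariants k H).1 hb))).act_apply φ m
  have e : LinearMap.mul' k H ∘ₗ (TensorProduct.mk k H H).flip 1 = LinearMap.id := by ext; simp
  rw [e] at h
  exact h

/-- `m ↦ m₀φ(m₁) - φ(1)m`. -/
def coinvDefect (φ : CDual k H) : M →ₗ[(coinvariants k H A)ᵐᵒᵖ] M where
  toFun m := act M φ m - φ.ofConv 1 • m
  map_add' m n := by simp only [map_add, smul_add]; abel
  map_smul' b m := by
    change act M φ (rightAct k H A M (m ⊗ₜ b.unop.1)) - φ.ofConv 1 •
      rightAct k H A M (m ⊗ₜ b.unop.1) =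
      rightAct k H A M ((act M φ m - φ.ofConv 1 • m) ⊗ₜ b.unop.1)
    rw [act_rightAct k H φ m b.unop.2, TensorProduct.sub_tmul, map_sub,
      ← TensorProduct.smul_tmul', map_smul]

/-- By `act_canBy`, failure of coinvariance in `M` corresponds under the Galois map to failure of
coinvariance in `M ⊗ H` for the codiagonal coaction. -/
theorem canBal_coinvDefect (φ : CDual k H) (t : BalTensor (coinvariants k H A) M A) :
    canBal k H A M (balMap A (coinvDefect k H A M φ) t) =
      act (C := H ⊗[k] H) (M ⊗[k] H) (pull (LinearMap.mul' k H) φ) (canBal k H A M t) -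
        φ.ofConv 1 • canBal k H A M t := by
  let f : M ⊗[k] H →ₗ[k] M ⊗[k] H :=
    act (C := H ⊗[k] H) (M ⊗[k] H) (pull (LinearMap.mul' k H) φ) - φ.ofConv 1 • LinearMap.id
  refine DFunLike.congr_fun (BalTensor.hom_ext
    (f := (canBal k H A M).comp (balMap A (coinvDefect k H A M φ)))
    (g := f.toAddMonoidHom.comp (canBal k H A M)) fun m a => ?_) t
  have h := LinearMap.congr_fun (act_canBy k H (isColin_rightAct k H A M) φ) (m ⊗ₜ a)
  change canBy k H (rightAct k H A M) ((act M φ m - φ.ofConv 1 • m) ⊗ₜ a) = _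
  rw [TensorProduct.sub_tmul, map_sub, ← TensorProduct.smul_tmul', map_smul]
  exact congrArg (· - _) h.symm

end CoinvariantModules

/-! ### The structure theorem, by descent -/

section StructureTheorem

variable (k : Type*) [Field k]
variable (H : Type*) [NonAssocRing H] [Module k H] [SMulCommClass k H H] [IsScalarTower k H H]
  [Coalgebra k H] [CoquasiHopfAlgebra k H]
variable {A : Type v} [NonAssocRing A] [Module k A] [SMulCommClass k A A]
  [IsScalarTower k A A] [RightComodule k H A] [ComoduleAlgebra k H A]
variable (M : Type v) [AddCommGroup M] [Module k M] [RightComodule k H M] [HopfBimodule k H A M]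

attribute [local instance] antipodeComodule codiagonal freeBimodule hopfRightModule envRightModule

/-- The structure theorem for two-sided Hopf modules: `M^{co H} ⊗_B A → M` is bijective. -/
theorem mulBal_bijective (hflat : LeftFaithfullyFlat (coinvariants k H A) A)
    (hgal : IsGaloisExtension k H A) : Function.Bijective (mulBal k H A M) := by
  classical
  constructor
  -- If multiplication kills `t`, then so does the Galois map composed with the inclusion of `M^{co
  -- H} ⊗_B A`, and both of these are injective, the inclusion by flatness.
  · refine (injective_iff_map_eq_zero _).2 fun t ht => ?_
    have h1 := canBal_incl k H A M t
    rw [ht, map_zero] at h1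
    have h2 := (injective_iff_map_eq_zero _).1 (canBal_bijective k H M hgal).1 _ h1
    exact (injective_iff_map_eq_zero _).1
      ((hflat.injective_iff (coinvIncl k H A M)).2 Subtype.val_injective) t h2
  · intro x
    -- It remains to show that `y` comes from `M^{co H} ⊗_B A`.
    obtain ⟨y, hy⟩ := (canBal_bijective k H (A := A) M hgal).2 (betaCoact k H M x)
    -- Testing coinvariance only on the coordinate functionals of a basis gives a family in which
    -- each `m` has finitely many nonzero defects, as the flatness argument requires.
    let b := Module.Basis.ofVectorSpace k H
    have hb : ∀ m i, coinvDefect k H A M (WithConv.toConv (b.coord i)) m =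
        TensorProduct.equivFinsuppOfBasisRight b (coact k H M m - m ⊗ₜ 1) i := by
      intro m i
      rw [TensorProduct.equivFinsuppOfBasisRight_apply, map_sub, map_sub, LinearMap.lTensor_tmul,
        TensorProduct.rid_tmul]
      rfl
    obtain ⟨t, ht⟩ := hflat.mem_range_of_forall
      (fun i => coinvDefect k H A M (WithConv.toConv (b.coord i)))
      (fun m => by
        simp only [hb]
        exact (TensorProduct.equivFinsuppOfBasisRight b
          (coact k H M m - m ⊗ₜ 1)).hasFiniteSupport)
      (coinvIncl k H A M)
      (fun m => by
        simp only [hb]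
        refine Iff.trans ?_ (Finsupp.ext_iff (f := TensorProduct.equivFinsuppOfBasisRight b
          (coact k H M m - m ⊗ₜ 1)) (g := 0))
        rw [EmbeddingLike.map_eq_zero_iff, sub_eq_zero, ← mem_coinvariants k H]
        exact ⟨fun ⟨z, hz⟩ => hz ▸ z.2, fun h => ⟨⟨m, h⟩, rfl⟩⟩) y
      (fun i => by
        -- The defects of `y` may be computed after the Galois map, where they vanish because
        -- `betaCoact x` is coinvariant.
        refine (injective_iff_map_eq_zero _).1 (canBal_bijective k H M hgal).1 _ ?_
        rw [canBal_coinvDefect, hy, sub_eq_zero]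
        have h1 := congrArg (fun z => TensorProduct.rid k _
          ((b.coord i).lTensor (M ⊗[k] H) z)) (mul_coact_betaCoact k H M x)
        simp only [LinearMap.lTensor_tmul, TensorProduct.rid_tmul] at h1
        rw [← LinearMap.comp_apply, ← LinearMap.lTensor_comp] at h1
        exact h1)
    refine ⟨t, ?_⟩
    have h1 := canBal_incl k H A M t
    rw [ht, hy] at h1
    -- The element `x` and the product of `t` have the same image under `betaCoact`, which has a
    -- left inverse.
    have h2 := congrArg (alphaContract k H M) h1
    rw [alphaContract_betaCoact, alphaContract_betaCoact] at h2
    exact h2.symm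

end StructureTheorem

/-! ### Structures determined by a jointly surjective family of linear maps -/

section JointlySurjective

variable {k : Type*} [Field k] {I : Type*} {X Z P : Type*} [AddCommGroup X] [Module k X]
  [AddCommGroup Z] [Module k Z] [AddCommGroup P] [Module k P]

/-- A family of linear maps with images spanning the target. -/
def JointlySurjective (f : I → X →ₗ[k] Z) : Prop := ⨆ i, LinearMap.range (f i) = ⊤

theorem JointlySurjective.ext {f : I → X →ₗ[k] Z} (hf : JointlySurjective f) {g g' : Z →ₗ[k] P}
    (h : ∀ i, g ∘ₗ f i = g' ∘ₗ f i) : g = g' := by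
  refine LinearMap.ext fun z => ?_
  have hz : z ∈ ⨆ i, LinearMap.range (f i) := hf ▸ Submodule.mem_top
  induction hz using Submodule.iSup_induction' with
  | mem i z hz =>
    obtain ⟨x, rfl⟩ := hz
    exact LinearMap.congr_fun (h i) x
  | zero => simp
  | add y z _ _ hy hz => rw [map_add, map_add, hy, hz]

theorem JointlySurjective.lTensor {f : I → X →ₗ[k] Z} (hf : JointlySurjective f) (W : Type*)
    [AddCommGroup W] [Module k W] : JointlySurjective fun i => (f i).lTensor W := by
  rw [JointlySurjective, Submodule.eq_top_iff']
  intro t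
  induction t with
  | zero => exact zero_mem _
  | add y z hy hz => exact add_mem hy hz
  | tmul w z =>
    have hz : z ∈ ⨆ i, LinearMap.range (f i) := hf ▸ Submodule.mem_top
    induction hz using Submodule.iSup_induction' with
    | mem i z hz =>
      obtain ⟨x, rfl⟩ := hz
      exact Submodule.mem_iSup_of_mem i ⟨w ⊗ₜ x, LinearMap.lTensor_tmul _ _ _ _⟩
    | zero => rw [TensorProduct.tmul_zero]; exact zero_mem _
    | add y z _ _ hy hz => rw [TensorProduct.tmul_add]; exact add_mem hy hz

theorem JointlySurjective.rTensor {f : I → X →ₗ[k] Z} (hf : JointlySurjective f) (W : Type*)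
    [AddCommGroup W] [Module k W] : JointlySurjective fun i => (f i).rTensor W := by
  rw [JointlySurjective, Submodule.eq_top_iff']
  intro t
  induction t with
  | zero => exact zero_mem _
  | add y z hy hz => exact add_mem hy hz
  | tmul z w =>
    have hz : z ∈ ⨆ i, LinearMap.range (f i) := hf ▸ Submodule.mem_top
    induction hz using Submodule.iSup_induction' with
    | mem i z hz =>
      obtain ⟨x, rfl⟩ := hz
      exact Submodule.mem_iSup_of_mem i ⟨x ⊗ₜ w, LinearMap.rTensor_tmul _ _ _ _⟩
    | zero => rw [TensorProduct.zero_tmul]; exact zero_mem _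
    | add y z _ _ hy hz => rw [TensorProduct.add_tmul]; exact add_mem hy hz

variable {C : Type*} [AddCommGroup C] [Module k C] [Coalgebra k C] [RightComodule k C X]

/-- A comodule structure induced by a jointly surjective family of maps from a comodule. -/
@[reducible] def JointlySurjective.comodule {f : I → X →ₗ[k] Z} (hf : JointlySurjective f)
    (ρ : Z →ₗ[k] Z ⊗[k] C) (hρ : ∀ i, ρ ∘ₗ f i = (f i).rTensor C ∘ₗ coact k C X) :
    RightComodule k C Z where
  coaction := ρ
  coaction_coassoc := hf.ext fun i => LinearMap.ext fun x => by
    have hρi := LinearMap.congr_fun (hρ i)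
    simp only [LinearMap.comp_apply] at hρi
    have h := congrArg ((f i).rTensor (C ⊗[k] C)) (coact_coassoc k C x)
    refine Eq.trans ?_ (h.trans ?_)
    · simp only [LinearMap.comp_apply, hρi, LinearEquiv.coe_coe]
      induction coact k C X x with
      | zero => simp
      | add _ _ h₁ h₂ => simp only [map_add, h₁, h₂]
      | tmul x c =>
      simp only [LinearMap.rTensor_tmul, hρi]
      induction coact k C X x with
      | zero => simp
      | add _ _ h₁ h₂ => simp only [map_add, TensorProduct.add_tmul, h₁, h₂]
      | tmul x c' => simp
    · simp only [LinearMap.comp_apply, hρi]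
      induction coact k C X x with
      | zero => simp
      | add _ _ h₁ h₂ => simp only [map_add, h₁, h₂]
      | tmul x c => simp
  coaction_counit := hf.ext fun i => LinearMap.ext fun x => by
    have hρi := LinearMap.congr_fun (hρ i)
    simp only [LinearMap.comp_apply] at hρi
    simp only [LinearMap.comp_apply, hρi, LinearEquiv.coe_coe, LinearMap.id_apply]
    conv_rhs => rw [← coact_counit k C x]
    induction coact k C X x with
    | zero => simp
    | add _ _ h₁ h₂ => simp only [map_add, h₁, h₂]
    | tmul x c => simp

end JointlySurjective

/-! ### Transfer of Hopf bimodule structures along such a family -/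

section BimoduleTransfer

variable {k : Type*} [Field k]
variable {H : Type*} [NonAssocRing H] [Module k H] [SMulCommClass k H H] [IsScalarTower k H H]
  [Coalgebra k H] [CoquasiBialgebra k H]
variable {A : Type*} [NonAssocRing A] [Module k A] [SMulCommClass k A A]
  [IsScalarTower k A A] [RightComodule k H A] [ComoduleAlgebra k H A]
variable {I X Z : Type*} [AddCommGroup X] [Module k X] [RightComodule k H X]
  [HopfBimodule k H A X] [AddCommGroup Z] [Module k Z] [RightComodule k H Z]

/-- A two-sided Hopf module structure induced by a jointly surjective family of colinear maps. -/
@[reducible] def JointlySurjective.hopfBimodule {f : I → X →ₗ[k] Z} (hf : JointlySurjective f)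
    (hρ : ∀ i, IsColin (LinearMap.id : H →ₗ[k] H) (f i))
    (l : A ⊗[k] Z →ₗ[k] Z) (r : Z ⊗[k] A →ₗ[k] Z)
    (hl : ∀ i, l ∘ₗ (f i).lTensor A = f i ∘ₗ HopfBimodule.lact (k := k) (H := H) (A := A))
    (hr : ∀ i, r ∘ₗ (f i).rTensor A = f i ∘ₗ HopfBimodule.ract (k := k) (H := H) (A := A)) :
    HopfBimodule k H A Z where
  lact := l
  ract := r
  -- Each axiom is an equality of linear maps out of a tensor product with `Z`. It suffices to check
  -- it after composing with `f i` in that factor, where compatibility of `f i` with coaction and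
  -- actions reduces it to the same axiom for `X`.
  coact_lact := (hf.lTensor A).ext fun i => by
    have h1 := IsColin.lTensor (k := k) (C := H) (D := H) (E := H) (V := X) (W := Z) (X := A) (hρ i)
    have h2 := hρ i
    simp only [IsColin, LinearMap.lTensor_id] at h1 h2
    rw [LinearMap.comp_assoc, hl, ← LinearMap.comp_assoc, h2, LinearMap.comp_assoc,
      HopfBimodule.coact_lact, LinearMap.comp_assoc, h1, ← LinearMap.comp_assoc,
      ← LinearMap.comp_assoc, ← TensorProduct.map_comp, ← TensorProduct.map_comp, hl]
    rfl
  coact_ract := (hf.rTensor A).ext fun i => by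
    have h1 := IsColin.rTensor (k := k) (C := H) (D := H) (E := H) (V := X) (W := Z) (X := A) (hρ i)
    have h2 := hρ i
    simp only [IsColin, LinearMap.rTensor_id] at h1 h2
    rw [LinearMap.comp_assoc, hr, ← LinearMap.comp_assoc, h2, LinearMap.comp_assoc,
      HopfBimodule.coact_ract, LinearMap.comp_assoc, h1, ← LinearMap.comp_assoc,
      ← LinearMap.comp_assoc, ← TensorProduct.map_comp, ← TensorProduct.map_comp, hr]
    rfl
  one_lact := LinearMap.congr_fun (f := l ∘ₗ TensorProduct.mk k A Z 1) (g := LinearMap.id) <|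
    hf.ext fun i => LinearMap.ext fun x =>
      (LinearMap.congr_fun (hl i) (1 ⊗ₜ x)).trans (congrArg (f i) (HopfBimodule.one_lact x))
  ract_one := LinearMap.congr_fun (f := r ∘ₗ (TensorProduct.mk k Z A).flip 1)
    (g := LinearMap.id) <| hf.ext fun i => LinearMap.ext fun x =>
      (LinearMap.congr_fun (hr i) (x ⊗ₜ 1)).trans (congrArg (f i) (HopfBimodule.ract_one x))
  lact_assoc := ((hf.lTensor A).lTensor A).ext fun i => by
    have h1 := ((((hρ i).lTensor (E := H) (X := A)).lTensor (E := H) (X := A))).act_comp (om k H)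
    simp only [LinearMap.lTensor_id] at h1
    have e : mulFst k A Z ∘ₗ ((f i).lTensor A).lTensor A =
        (f i).lTensor A ∘ₗ mulFst k A X := by
      ext; simp [mulFst]
    rw [LinearMap.comp_assoc, e, ← LinearMap.comp_assoc, hl, LinearMap.comp_assoc,
      HopfBimodule.lact_assoc, LinearMap.comp_assoc, LinearMap.comp_assoc, h1,
      ← LinearMap.comp_assoc _ _ (LinearMap.lTensor A l), ← LinearMap.lTensor_comp, hl,
      LinearMap.lTensor_comp, LinearMap.comp_assoc, ← LinearMap.comp_assoc _ _ l, hl]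
    rfl
  ract_assoc := (hf.rTensor (A ⊗[k] A)).ext fun i => by
    have h1 := ((hρ i).rTensor (E := H ⊗[k] H) (X := A ⊗[k] A)).act_comp (om k H)
    simp only [LinearMap.rTensor_id] at h1
    have e : (TensorProduct.assoc k Z A A).symm.toLinearMap ∘ₗ (f i).rTensor (A ⊗[k] A) =
        ((f i).rTensor A).rTensor A ∘ₗ (TensorProduct.assoc k X A A).symm.toLinearMap := by
      ext; simp
    have h2 := HopfBimodule.ract_assoc (k := k) (H := H) (A := A) (M := X)
    rw [LinearMap.comp_assoc, LinearMap.comp_assoc, e, LinearMap.comp_assoc, LinearMap.comp_assoc,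
      h1, ← LinearMap.comp_assoc _ _ (LinearMap.rTensor A r), ← LinearMap.rTensor_comp, hr,
      LinearMap.rTensor_comp, LinearMap.comp_assoc, ← LinearMap.comp_assoc _ _ r, hr,
      LinearMap.comp_assoc, h2,
      ← LinearMap.comp_assoc _ _ (LinearMap.lTensor Z _), LinearMap.lTensor_comp_rTensor,
      ← LinearMap.rTensor_comp_lTensor, LinearMap.comp_assoc, ← LinearMap.comp_assoc _ _ r, hr]
    rfl
  middle_assoc := ((hf.rTensor A).lTensor A).ext fun i => by
    have h0 := IsColin.rTensor (k := k) (C := H) (D := H) (E := H) (V := X) (W := Z) (X := A) (hρ i)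
    have h1 := (h0.lTensor (E := H) (X := A)).act_comp (om k H)
    simp only [LinearMap.rTensor_id, LinearMap.lTensor_id] at h1
    have e : (TensorProduct.assoc k A Z A).symm.toLinearMap ∘ₗ ((f i).rTensor A).lTensor A =
        ((f i).lTensor A).rTensor A ∘ₗ (TensorProduct.assoc k A X A).symm.toLinearMap := by
      ext; simp
    have h2 := HopfBimodule.middle_assoc (k := k) (H := H) (A := A) (M := X)
    rw [LinearMap.comp_assoc, LinearMap.comp_assoc, e, LinearMap.comp_assoc, LinearMap.comp_assoc,
      h1, ← LinearMap.comp_assoc _ _ (LinearMap.rTensor A l), ← LinearMap.rTensor_comp, hl,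
      LinearMap.rTensor_comp, LinearMap.comp_assoc, ← LinearMap.comp_assoc _ _ r, hr,
      LinearMap.comp_assoc, h2,
      ← LinearMap.comp_assoc _ _ (LinearMap.lTensor A r), ← LinearMap.lTensor_comp, hr,
      LinearMap.lTensor_comp, LinearMap.comp_assoc, ← LinearMap.comp_assoc _ _ l, hl]
    rfl

end BimoduleTransfer

/-! ### The induced Hopf module `(A ⊗ A) ⊗_L V` -/

section Induced

variable (k : Type*) [Field k]
variable (H : Type*) [NonAssocRing H] [Module k H] [SMulCommClass k H H] [IsScalarTower k H H]
  [Coalgebra k H] [CoquasiHopfAlgebra k H]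
variable (A : Type*) [NonAssocRing A] [Module k A] [SMulCommClass k A A]
  [IsScalarTower k A A] [RightComodule k H A] [ComoduleAlgebra k H A]

attribute [local instance] codiagonal freeBimodule hopfRightModule envRightModule

/-- `A ⊗ A` is a right `L`-module by multiplication. -/
@[reducible] def envFreeModule : Module (envCoinvariants k H A)ᵐᵒᵖ (A ⊗[k] A) where
  smul l x := sandwich k H A l.unop.1 x
  one_smul x := by
    change sandwich k H A ((1 : A) ⊗ₜ[k] (1 : A)) x = x
    rw [← envMul_eq, envMul_one]
  mul_smul l l' x := by
    change sandwich k H A (envMul k H A l'.unop.1 l.unop.1) x =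
      sandwich k H A l.unop.1 (sandwich k H A l'.unop.1 x)
    -- Only the element of `L` used as the outer sandwich has to be coinvariant, so associativity
    -- holds for an arbitrary `x` in `A ⊗ A`.
    rw [envMul_eq, sandwich_sandwich k H A l.unop.2]
  smul_zero l := map_zero (sandwich k H A l.unop.1)
  smul_add l := map_add (sandwich k H A l.unop.1)
  add_smul l l' x := sandwich_add k H A l.unop.1 l'.unop.1 x
  zero_smul x := sandwich_zero k H A x

attribute [local instance] envFreeModule

/-- Scalars act on `A ⊗ A` by maps of right `L`-modules. -/
def envScalarLin (c : k) : A ⊗[k] A →ₗ[(envCoinvariants k H A)ᵐᵒᵖ] A ⊗[k] A where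
  toFun x := c • x
  map_add' x y := smul_add c x y
  map_smul' l x := (map_smul (sandwich k H A l.unop.1) c x).symm

variable (V : Type*) [AddCommGroup V] [Module (envCoinvariants k H A) V]

/-- The induced module `(A ⊗ A) ⊗_L V`. -/
def Induced : Type _ := BalTensor (envCoinvariants k H A) (A ⊗[k] A) V

instance : AddCommGroup (Induced k H A V) :=
  inferInstanceAs (AddCommGroup (BalTensor (envCoinvariants k H A) (A ⊗[k] A) V))

variable {V} in
/-- The class of `x ⊗ v`. -/
def Induced.tmul (x : A ⊗[k] A) (v : V) : Induced k H A V :=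
  balTmul (envCoinvariants k H A) x v

variable {V} in
@[elab_as_elim]
theorem Induced.induction {p : Induced k H A V → Prop} (z : Induced k H A V) (zero : p 0)
    (tmul : ∀ x v, p (Induced.tmul k H A x v)) (add : ∀ y z, p y → p z → p (y + z)) : p z :=
  BalTensor.induction z zero tmul add

variable {V} in
theorem Induced.smul_tmul (l : envCoinvariants k H A) (x : A ⊗[k] A) (v : V) :
    Induced.tmul k H A (sandwich k H A l.1 x) v = Induced.tmul k H A x (l • v) :=
  smul_balTmul x l v

variable {V} in
/-- Multiplication by a scalar. -/
def Induced.scale (c : k) : Induced k H A V →+ Induced k H A V :=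
  balMap V (envScalarLin k H A c)

variable {V} in
theorem Induced.scale_tmul (c : k) (x : A ⊗[k] A) (v : V) :
    Induced.scale k H A c (Induced.tmul k H A x v) = Induced.tmul k H A (c • x) v := rfl

instance : Module k (Induced k H A V) where
  smul c z := Induced.scale k H A c z
  one_smul z := by
    change Induced.scale k H A 1 z = z
    induction z using Induced.induction with
    | zero => exact map_zero _
    | tmul x v => rw [Induced.scale_tmul, one_smul]
    | add y z hy hz => rw [map_add, hy, hz]
  mul_smul c d z := by
    change Induced.scale k H A (c * d) z = Induced.scale k H A c (Induced.scale k H A d z)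
    induction z using Induced.induction with
    | zero => simp only [map_zero]
    | tmul x v => simp only [Induced.scale_tmul, mul_smul]
    | add y z hy hz => simp only [map_add, hy, hz]
  smul_zero c := map_zero (Induced.scale k H A c)
  smul_add c := map_add (Induced.scale k H A c)
  add_smul c d z := by
    change Induced.scale k H A (c + d) z = Induced.scale k H A c z + Induced.scale k H A d z
    induction z using Induced.induction with
    | zero => simp only [map_zero, add_zero]
    | tmul x v => rw [Induced.scale_tmul, add_smul]; exact add_balTmul _ _ v
    | add y z hy hz => simp only [map_add, hy, hz]; abel
  zero_smul z := by
    change Induced.scale k H A 0 z = 0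
    induction z using Induced.induction with
    | zero => exact map_zero _
    | tmul x v => rw [Induced.scale_tmul, zero_smul]; exact zero_balTmul v
    | add y z hy hz => rw [map_add, hy, hz, add_zero]

variable {V} in
/-- `x ↦ x ⊗ v`. -/
def Induced.mk (v : V) : A ⊗[k] A →ₗ[k] Induced k H A V where
  toFun x := Induced.tmul k H A x v
  map_add' x y := add_balTmul x y v
  map_smul' c x := (Induced.scale_tmul k H A c x v).symm

variable {V} in
theorem Induced.mk_smul (l : envCoinvariants k H A) (v : V) :
    Induced.mk k H A (l • v) = Induced.mk k H A v ∘ₗ sandwich k H A l.1 :=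
  LinearMap.ext fun x => (Induced.smul_tmul k H A l x v).symm

theorem Induced.mk_zero : Induced.mk k H A (0 : V) = 0 :=
  LinearMap.ext fun x => balTmul_zero x

variable {V} in
theorem Induced.mk_add (v w : V) :
    Induced.mk k H A (v + w) = Induced.mk k H A v + Induced.mk k H A w :=
  LinearMap.ext fun x => balTmul_add x v w

theorem Induced.jointlySurjective :
    JointlySurjective (fun v : V => Induced.mk k H A v) := by
  rw [JointlySurjective, Submodule.eq_top_iff']
  intro z
  induction z using Induced.induction with
  | zero => exact zero_mem _
  | tmul x v => exact Submodule.mem_iSup_of_mem v ⟨x, rfl⟩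
  | add y z hy hz => exact add_mem hy hz

variable {V} in
/-- The linear map on `(A ⊗ A) ⊗_L V` given by a balanced map. -/
def Induced.lift {P : Type*} [AddCommGroup P] [Module k P] (f : V →+ (A ⊗[k] A →ₗ[k] P))
    (hf : ∀ (l : envCoinvariants k H A) v, f (l • v) = f v ∘ₗ sandwich k H A l.1) :
    Induced k H A V →ₗ[k] P :=
  let g : Induced k H A V →+ P := balLift
    ⟨⟨fun x => ⟨⟨fun v => f v x, by simp⟩, fun v w => by simp⟩, by ext v; simp⟩,
      fun x y => by ext v; simp⟩
    fun x l v => (LinearMap.congr_fun (hf l v) x).symm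
  { g with
    map_smul' := fun c z => by
      change g (Induced.scale k H A c z) = c • g z
      induction z using Induced.induction with
      | zero => simp only [map_zero, smul_zero]
      | tmul x v => exact map_smul (f v) c x
      | add y z hy hz => simp only [map_add, smul_add, hy, hz] }

/-- Right multiplication by a coinvariant and the left action are both colinear. With
`sandwich_freeL` and `sandwich_freeR` this makes `sandwich m : A ⊗ A → M` a morphism of Hopf
modules; for `M = A ⊗ A` it says that right multiplication by `L` is by such morphisms, so the
structure of `A ⊗ A` descends to the induced module. -/
theorem isColin_sandwich {M : Type*} [AddCommGroup M] [Module k M] [RightComodule k H M]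
    [HopfBimodule k H A M] {m : M} (hm : m ∈ coinvariants k H M) :
    IsColin (LinearMap.id : H →ₗ[k] H) (sandwich k H A m) := by
  have hf := (isColin_rightBy k H A hm).lTensor (E := H) (X := A)
  have hl : IsColin (LinearMap.mul' k H) (HopfBimodule.lact (k := k) (H := H) (A := A) (M := M)) :=
    HopfBimodule.coact_lact
  have h := hl.comp hf
  rw [LinearMap.lTensor_id, LinearMap.comp_id] at h
  refine LinearMap.ext fun x => (LinearMap.congr_fun h x).trans ?_
  change _ = TensorProduct.map (sandwich k H A m) LinearMap.id
    ((LinearMap.mul' k H).lTensor (A ⊗[k] A) (coact k (H ⊗[k] H) (A ⊗[k] A) x))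
  rw [LinearMap.comp_apply]
  generalize coact k (H ⊗[k] H) (A ⊗[k] A) x = p
  induction p with
  | zero => simp
  | add _ _ h₁ h₂ => simp only [map_add, h₁, h₂]
  | tmul x y => rfl

/-- The coaction of the induced module. -/
def Induced.coaction : Induced k H A V →ₗ[k] Induced k H A V ⊗[k] H :=
  Induced.lift k H A ⟨⟨fun v => (Induced.mk k H A v).rTensor H ∘ₗ coact k H (A ⊗[k] A), by
    rw [Induced.mk_zero, LinearMap.rTensor_zero, LinearMap.zero_comp]⟩, fun v w => by
    change (Induced.mk k H A (v + w)).rTensor H ∘ₗ _ = _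
    rw [Induced.mk_add, LinearMap.rTensor_add, LinearMap.add_comp]⟩ <| by
    -- Balancedness over `L` is colinearity of right multiplication by `l`.
    intro l v
    change (Induced.mk k H A (l • v)).rTensor H ∘ₗ _ =
      ((Induced.mk k H A v).rTensor H ∘ₗ _) ∘ₗ sandwich k H A l.1
    rw [Induced.mk_smul, LinearMap.rTensor_comp, LinearMap.comp_assoc, LinearMap.comp_assoc,
      isColin_sandwich k H A (M := A ⊗[k] A) l.2]
    rfl

instance : RightComodule k H (Induced k H A V) :=
  (Induced.jointlySurjective k H A V).comodule (Induced.coaction k H A V) fun _ => rfl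

variable {V} in
theorem Induced.isColin_mk (v : V) : IsColin (LinearMap.id : H →ₗ[k] H) (Induced.mk k H A v) := rfl

-- Right multiplication by `l` commutes with the left action of `A`; this is what makes the left
-- action on the induced module well defined.
variable {V} in
theorem Induced.mk_smul_freeL (l : envCoinvariants k H A) (v : V) (a : A) (x : A ⊗[k] A) :
    Induced.mk k H A (l • v) (freeL k H A (a ⊗ₜ x)) =
      Induced.mk k H A v (freeL k H A (a ⊗ₜ sandwich k H A l.1 x)) := by
  rw [Induced.mk_smul, LinearMap.comp_apply]
  exact congrArg (Induced.mk k H A v) (sandwich_freeL k H A (M := A ⊗[k] A) l.2 (a ⊗ₜ x))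

variable {V} in
theorem Induced.mk_smul_freeR (l : envCoinvariants k H A) (v : V) (x : A ⊗[k] A) (a : A) :
    Induced.mk k H A (l • v) (freeR k H A (x ⊗ₜ a)) =
      Induced.mk k H A v (freeR k H A (sandwich k H A l.1 x ⊗ₜ a)) := by
  rw [Induced.mk_smul, LinearMap.comp_apply]
  exact congrArg (Induced.mk k H A v) (sandwich_freeR k H A (M := A ⊗[k] A) l.2 (x ⊗ₜ a))

/-- `v ↦ (x ↦ a ↦ ax ⊗ v)`. -/
def Induced.lactAux : V →+ (A ⊗[k] A →ₗ[k] A →ₗ[k] Induced k H A V) where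
  toFun v := (TensorProduct.curry (Induced.mk k H A v ∘ₗ freeL k H A)).flip
  map_zero' := LinearMap.ext fun x => LinearMap.ext fun a =>
    LinearMap.congr_fun (Induced.mk_zero k H A V) (freeL k H A (a ⊗ₜ x))
  map_add' v w := LinearMap.ext fun x => LinearMap.ext fun a =>
    LinearMap.congr_fun (Induced.mk_add k H A v w) (freeL k H A (a ⊗ₜ x))

/-- `v ↦ (x ↦ a ↦ xa ⊗ v)`. -/
def Induced.ractAux : V →+ (A ⊗[k] A →ₗ[k] A →ₗ[k] Induced k H A V) where
  toFun v := TensorProduct.curry (Induced.mk k H A v ∘ₗ freeR k H A)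
  map_zero' := LinearMap.ext fun x => LinearMap.ext fun a =>
    LinearMap.congr_fun (Induced.mk_zero k H A V) (freeR k H A (x ⊗ₜ a))
  map_add' v w := LinearMap.ext fun x => LinearMap.ext fun a =>
    LinearMap.congr_fun (Induced.mk_add k H A v w) (freeR k H A (x ⊗ₜ a))

/-- The left action on the induced module. -/
def Induced.lact : A ⊗[k] Induced k H A V →ₗ[k] Induced k H A V :=
  TensorProduct.lift <| LinearMap.flip <| Induced.lift k H A (Induced.lactAux k H A V)
    fun l v => LinearMap.ext fun x => LinearMap.ext fun a => Induced.mk_smul_freeL k H A l v a x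

/-- The right action on the induced module. -/
def Induced.ract : Induced k H A V ⊗[k] A →ₗ[k] Induced k H A V :=
  TensorProduct.lift <| Induced.lift k H A (Induced.ractAux k H A V)
    fun l v => LinearMap.ext fun x => LinearMap.ext fun a => Induced.mk_smul_freeR k H A l v x a

/-- The maps `x ↦ x ⊗ v` jointly span the induced module and respect both actions by construction,
so all axioms are inherited from `A ⊗ A`. -/
instance : HopfBimodule k H A (Induced k H A V) :=
  (Induced.jointlySurjective k H A V).hopfBimodule (Induced.isColin_mk k H A)
    (Induced.lact k H A V) (Induced.ract k H A V)
    (fun _ => TensorProduct.ext' fun _ _ => rfl) (fun _ => TensorProduct.ext' fun _ _ => rfl)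

variable {V} in
theorem Induced.ract_mk (v : V) (a : A) (x : A ⊗[k] A) :
    HopfBimodule.ract (k := k) (H := H) (Induced.mk k H A v x ⊗ₜ a) =
      Induced.mk k H A v (freeR k H A (x ⊗ₜ a)) := rfl

-- The map `x ↦ x ⊗ v` is a bimodule map, hence commutes with the operation `a(-)b`.
variable {V} in
theorem Induced.sandwich_mk (v : V) (x y : A ⊗[k] A) :
    sandwich k H A (Induced.mk k H A v x) y = Induced.mk k H A v (sandwich k H A x y) := by
  induction y with
  | zero => simp
  | add _ _ h₁ h₂ => simp only [map_add, h₁, h₂]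
  | tmul a b => rfl

/-- The unit `v ↦ (1 ⊗ 1) ⊗ v`. -/
def Induced.unit : V →ₗ[envCoinvariants k H A] Coinv k H A (Induced k H A V) where
  toFun v := ⟨Induced.mk k H A v (1 ⊗ₜ 1), (mem_coinvariants k H).2 <| by
    refine (LinearMap.congr_fun (Induced.isColin_mk k H A v) _).trans ?_
    have h := (mem_coinvariants k H).1 (one_mem_env k H A)
    rw [LinearMap.comp_apply, h]
    rfl⟩
  map_add' v w := Subtype.ext <| LinearMap.congr_fun (Induced.mk_add k H A v w) _
  map_smul' l v := Subtype.ext <| by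
    -- Both sides equal `l ⊗ v`: on the left `l` moves across `⊗_L`, on the right it multiplies `1 ⊗
    -- 1`.
    change Induced.mk k H A (l • v) (1 ⊗ₜ 1) =
      sandwich k H A (Induced.mk k H A v (1 ⊗ₜ 1)) l.1
    rw [Induced.sandwich_mk, ← envMul_eq, envMul_one, Induced.mk_smul, LinearMap.comp_apply,
      sandwich_one]

theorem sandwich_one_one (x : A ⊗[k] A) : sandwich k H A ((1 : A) ⊗ₜ[k] (1 : A)) x = x := by
  rw [← envMul_eq, envMul_one]

/-- The unit as a map of right `B`-modules. -/
def Induced.unitRight : V →ₗ[(coinvariants k H A)ᵐᵒᵖ] Coinv k H A (Induced k H A V) :=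
  { Induced.unit k H A V with
      map_smul' := fun b v => map_smul (Induced.unit k H A V) (coinvToEnv k H A b) v }

/-- `v ⊗_B a ↦ (1 ⊗ a) ⊗ v`. -/
def Induced.ofBal : BalTensor (coinvariants k H A) V A →+ Induced k H A V :=
  (mulBal k H A (Induced k H A V)).comp (balMap A (Induced.unitRight k H A V))

end Induced

/-! ### Bijectivity of the unit `V → ((A ⊗ A) ⊗_L V)^{co H}` -/

section Unit

variable (k : Type*) [Field k]
variable (H : Type*) [NonAssocRing H] [Module k H] [SMulCommClass k H H] [IsScalarTower k H H]
  [Coalgebra k H] [CoquasiHopfAlgebra k H]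
variable (A : Type v) [NonAssocRing A] [Module k A] [SMulCommClass k A A]
  [IsScalarTower k A A] [RightComodule k H A] [ComoduleAlgebra k H A]

attribute [local instance] codiagonal freeBimodule hopfRightModule envRightModule envFreeModule

/-- The coinvariants of `A ⊗ A` are the algebra `L`. -/
def Coinv.toEnv (l : Coinv k H A (A ⊗[k] A)) : envCoinvariants k H A := l

/-- The elements of the algebra `L` are the coinvariants of `A ⊗ A`. -/
def Coinv.ofEnv (l : envCoinvariants k H A) : Coinv k H A (A ⊗[k] A) := l

/-- For `M = A ⊗ A` the structure map `L ⊗_B A → A ⊗ A` is `l ⊗ a ↦ (1 ⊗ a)l`. In this form its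
compatibility with right multiplication by `L` is visible. -/
theorem mulBal_free_tmul (l : Coinv k H A (A ⊗[k] A)) (a : A) :
    mulBal k H A (A ⊗[k] A) (balTmul (coinvariants k H A) l a) =
      sandwich k H A l.1 (1 ⊗ₜ a) :=
  (sandwich_one_tmul k H A l.1 a).symm

section

variable {V : Type*} [AddCommGroup V] [Module (envCoinvariants k H A) V]

theorem Induced.ofBal_tmul (v : V) (a : A) :
    Induced.ofBal k H A V (balTmul (coinvariants k H A) v a) = Induced.mk k H A v (1 ⊗ₜ a) := by
  change HopfBimodule.ract (k := k) (H := H) (Induced.mk k H A v (1 ⊗ₜ 1) ⊗ₜ a) = _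
  rw [Induced.ract_mk, free_one_tmul, one_mul]

/-- `l ↦ lv`, a map of right `B`-modules. -/
def coinvSMul (v : V) : Coinv k H A (A ⊗[k] A) →ₗ[(coinvariants k H A)ᵐᵒᵖ] V where
  toFun l := Coinv.toEnv k H A l • v
  map_add' l l' := add_smul (Coinv.toEnv k H A l) (Coinv.toEnv k H A l') v
  map_smul' b l := by
    change (⟨sandwich k H A l.1 (coinvToEnv k H A b).1, _⟩ : envCoinvariants k H A) • v =
      coinvToEnv k H A b • Coinv.toEnv k H A l • v
    rw [smul_smul]
    congr 1
    -- Right multiplication of `l` by `b` is the product `(1 ⊗ b)l` in `L`, since the product of `L`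
    -- is a sandwich.
    exact Subtype.ext (envMul_eq k H A _ _).symm

/-- Both sides send `l ⊗ a` to `(1 ⊗ a)l ⊗ v = (1 ⊗ a) ⊗ lv`. As every element of `A ⊗ A` is the
image of some `t`, this shows that `ofBal` is surjective and suggests its inverse. -/
theorem Induced.ofBal_coinvSMul (v : V) (t : BalTensor (coinvariants k H A)
    (Coinv k H A (A ⊗[k] A)) A) :
    Induced.ofBal k H A V (balMap A (coinvSMul k H A v) t) =
      Induced.mk k H A v (mulBal k H A (A ⊗[k] A) t) := by
  induction t using BalTensor.induction with
  | zero => simp only [map_zero]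
  | add y z hy hz => simp only [map_add, hy, hz]
  | tmul l a =>
    rw [balMap_tmul, Induced.ofBal_tmul, mulBal_free_tmul]
    exact LinearMap.congr_fun (Induced.mk_smul k H A l v) (1 ⊗ₜ a)

end

variable (V : Type v) [AddCommGroup V] [Module (envCoinvariants k H A) V]

variable (hflat : LeftFaithfullyFlat (coinvariants k H A) A) (hgal : IsGaloisExtension k H A)

/-- The isomorphism `M^{co H} ⊗_B A ≃ M`. -/
def mulBalEquiv (M : Type v) [AddCommGroup M] [Module k M] [RightComodule k H M]
    [HopfBimodule k H A M] : BalTensor (coinvariants k H A) (Coinv k H A M) A ≃+ M :=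
  AddEquiv.ofBijective _ (mulBal_bijective k H M hflat hgal)

-- Balancedness over `L` of the inverse map. On `x ⊗ a`, multiplication by `l` gives `(1 ⊗ a)(xl)`,
-- again in the standard form with `xl` in `L`, and `(xl)v = x(lv)`.
variable {V} in
theorem balMap_coinvSMul (l : envCoinvariants k H A) (v : V)
    (t : BalTensor (coinvariants k H A) (Coinv k H A (A ⊗[k] A)) A) :
    balMap A (coinvSMul k H A v) ((mulBalEquiv k H A hflat hgal (A ⊗[k] A)).symm
      (sandwich k H A l.1 (mulBal k H A (A ⊗[k] A) t))) =
      balMap A (coinvSMul k H A (l • v)) t := by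
  induction t using BalTensor.induction with
  | zero => simp only [map_zero]
  | add y z hy hz => simp only [map_add, hy, hz]
  | tmul x a =>
    have h : sandwich k H A l.1 (mulBal k H A (A ⊗[k] A) (balTmul (coinvariants k H A) x a)) =
        mulBalEquiv k H A hflat hgal (A ⊗[k] A) (balTmul (coinvariants k H A)
          (Coinv.ofEnv k H A (Coinv.toEnv k H A x * l)) a) := by
      refine (congrArg (sandwich k H A l.1) (mulBal_free_tmul k H A x a)).trans ?_
      refine (sandwich_sandwich k H A (M := A ⊗[k] A) l.2 (1 ⊗ₜ a) x.1).trans ?_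
      refine Eq.trans ?_ (mulBal_free_tmul k H A (Coinv.ofEnv k H A _) a).symm
      exact congrArg (fun y => sandwich k H A y (1 ⊗ₜ a)) (envMul_eq k H A x.1 l.1).symm
    rw [h, AddEquiv.symm_apply_apply]
    exact congrArg (fun w => balTmul (coinvariants k H A) w a)
      (mul_smul (Coinv.toEnv k H A x) l v)

/-- The inverse of `v ⊗_B a ↦ (1 ⊗ a) ⊗ v`. -/
def Induced.toBal : Induced k H A V →+ BalTensor (coinvariants k H A) V A :=
  balLift (B := envCoinvariants k H A)
    ((AddMonoidHom.flip
      ⟨⟨fun v => (balMap A (coinvSMul k H A v)).comp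
        (mulBalEquiv k H A hflat hgal (A ⊗[k] A)).symm.toAddMonoidHom, by
          refine DFunLike.ext _ _ fun x => ?_
          change balMap A (coinvSMul k H A (0 : V)) (AddEquiv.symm _ x) = 0
          rw [show coinvSMul k H A (0 : V) = 0 from LinearMap.ext fun l => smul_zero _]
          exact balMap_zero _⟩, fun v w => by
        refine DFunLike.ext _ _ fun x => ?_
        change balMap A (coinvSMul k H A (v + w)) (AddEquiv.symm _ x) =
          balMap A (coinvSMul k H A v) (AddEquiv.symm _ x) +
            balMap A (coinvSMul k H A w) (AddEquiv.symm _ x)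
        generalize (mulBalEquiv k H A hflat hgal (A ⊗[k] A)).symm x = t
        induction t using BalTensor.induction with
        | zero => simp only [map_zero, add_zero]
        | add y z hy hz => simp only [map_add, hy, hz]; abel
        | tmul l a =>
          simp only [balMap_tmul, ← add_balTmul]
          congr 1
          exact smul_add (Coinv.toEnv k H A l) v w⟩))
    fun x l v => by
      obtain ⟨t, rfl⟩ := (mulBal_bijective k H (A ⊗[k] A) hflat hgal).2 x
      refine (balMap_coinvSMul k H A hflat hgal l v t).trans ?_
      exact congrArg (balMap A (coinvSMul k H A (l • v)))
        ((mulBalEquiv k H A hflat hgal (A ⊗[k] A)).symm_apply_apply t).symm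

variable {V} in
theorem Induced.toBal_mk (v : V)
    (t : BalTensor (coinvariants k H A) (Coinv k H A (A ⊗[k] A)) A) :
    Induced.toBal k H A V hflat hgal (Induced.mk k H A v (mulBal k H A (A ⊗[k] A) t)) =
      balMap A (coinvSMul k H A v) t :=
  congrArg (balMap A (coinvSMul k H A v))
    ((mulBalEquiv k H A hflat hgal (A ⊗[k] A)).symm_apply_apply t)

/-- The structure theorem for `A ⊗ A` identifies it with `L ⊗_B A`, compatibly with right
multiplication by `L`. Hence `(A ⊗ A) ⊗_L V` collapses to `V ⊗_B A`, the left factor `L` being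
absorbed by its action on `V`. -/
theorem Induced.ofBal_bijective (hflat : LeftFaithfullyFlat (coinvariants k H A) A)
    (hgal : IsGaloisExtension k H A) : Function.Bijective (Induced.ofBal k H A V) := by
  constructor
  · refine Function.LeftInverse.injective (g := Induced.toBal k H A V hflat hgal) fun z => ?_
    refine DFunLike.congr_fun (BalTensor.hom_ext
      (f := (Induced.toBal k H A V hflat hgal).comp (Induced.ofBal k H A V))
      (g := AddMonoidHom.id (BalTensor (coinvariants k H A) V A)) fun v a => ?_) z
    -- The tensor `1 ⊗ a` is the image of `1_L ⊗_B a`, so the inverse returns `1_L v ⊗_B a`.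
    have h := mulBal_free_tmul k H A (Coinv.ofEnv k H A 1) a
    have h' := h.trans (sandwich_one_one k H A (1 ⊗ₜ a))
    rw [AddMonoidHom.comp_apply, Induced.ofBal_tmul, ← h', Induced.toBal_mk, balMap_tmul]
    exact congrArg (fun w => balTmul (coinvariants k H A) w a)
      (one_smul (envCoinvariants k H A) v)
  · intro z
    induction z using Induced.induction with
    | zero => exact ⟨0, map_zero _⟩
    | add y z hy hz =>
      obtain ⟨s, rfl⟩ := hy
      obtain ⟨t, rfl⟩ := hz
      exact ⟨s + t, map_add _ s t⟩
    | tmul x v =>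
      obtain ⟨t, rfl⟩ := (mulBal_bijective k H (A ⊗[k] A) hflat hgal).2 x
      exact ⟨_, Induced.ofBal_coinvSMul k H A v t⟩

/-- After `⊗_B A` the unit, followed by the structure isomorphism of the induced module, is `ofBal`.
It is therefore bijective after `⊗_B A`, and faithful flatness reflects injectivity and
surjectivity. -/
theorem Induced.unit_bijective (hflat : LeftFaithfullyFlat (coinvariants k H A) A)
    (hgal : IsGaloisExtension k H A) : Function.Bijective (Induced.unit k H A V) := by
  have h1 := mulBal_bijective k H (Induced k H A V) hflat hgal
  have h2 : Function.Bijective ((mulBal k H A (Induced k H A V)) ∘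
    (balMap A (Induced.unitRight k H A V))) := Induced.ofBal_bijective k H A V hflat hgal
  have h3 := (Function.Bijective.of_comp_iff' h1 _).1 h2
  exact ⟨(hflat.injective_iff (Induced.unitRight k H A V)).1 h3.1,
    (hflat.surjective_iff (Induced.unitRight k H A V)).1 h3.2⟩

end Unit

/-! ### The coinvariants functor is fully faithful and essentially surjective -/

section Equivalence

variable (k : Type*) [Field k]
variable (H : Type*) [NonAssocRing H] [Module k H] [SMulCommClass k H H] [IsScalarTower k H H]
  [Coalgebra k H] [CoquasiHopfAlgebra k H]
variable (A : Type v) [NonAssocRing A] [Module k A] [SMulCommClass k A A]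
  [IsScalarTower k A A] [RightComodule k H A] [ComoduleAlgebra k H A]

attribute [local instance] codiagonal freeBimodule hopfRightModule envRightModule

section Morphisms

variable {k H A}
variable {M N : HopfBimod.{w} k H A}

theorem HopfBimod.Hom.toLin_sandwich (f : HopfBimod.Hom M N) (m : M.carrier) (x : A ⊗[k] A) :
    f.toLin (sandwich k H A m x) = sandwich k H A (f.toLin m) x := by
  induction x with
  | zero => simp only [map_zero]
  | add _ _ h₁ h₂ => simp only [map_add, h₁, h₂]
  | tmul a b =>
    have h1 := LinearMap.congr_fun f.map_lact (a ⊗ₜ rightAct k H A M.carrier (m ⊗ₜ b))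
    have h2 := LinearMap.congr_fun f.map_ract (m ⊗ₜ b)
    rw [sandwich_tmul, sandwich_tmul]
    refine h1.trans ?_
    exact congrArg (fun y => HopfBimodule.lact (k := k) (H := H) (a ⊗ₜ[k] y)) h2

/-- A morphism of two-sided Hopf modules restricts to the coinvariants. -/
def HopfBimod.Hom.coinv (f : HopfBimod.Hom M N) :
    Coinv k H A M.carrier →ₗ[envCoinvariants k H A] Coinv k H A N.carrier where
  toFun m := ⟨f.toLin m.1, (mem_coinvariants k H).2 <| by
    refine (LinearMap.congr_fun f.colinear m.1).trans ?_
    rw [LinearMap.comp_apply, (mem_coinvariants k H).1 m.2]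
    rfl⟩
  map_add' m n := Subtype.ext (map_add f.toLin m.1 n.1)
  map_smul' l m := Subtype.ext (f.toLin_sandwich m.1 l.1)

theorem HopfBimod.Hom.toLin_mulBal_tmul (f : HopfBimod.Hom M N) (m : Coinv k H A M.carrier)
    (a : A) : f.toLin (mulBal k H A M.carrier (balTmul (coinvariants k H A) m a)) =
      mulBal k H A N.carrier (balTmul (coinvariants k H A) (f.coinv m) a) :=
  LinearMap.congr_fun f.map_ract (m.1 ⊗ₜ a)

end Morphisms

/-- The functor `M ↦ M^{co H}` from two-sided Hopf modules to `L`-modules. -/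
def coinvFunctor : HopfBimod.{w} k H A ⥤ ModuleCat.{w} (envCoinvariants k H A) where
  obj M := ModuleCat.of _ (Coinv k H A M.carrier)
  map f := ModuleCat.ofHom (HopfBimod.Hom.coinv f)
  map_id _ := rfl
  map_comp _ _ := rfl

variable {k H A}
variable (hflat : LeftFaithfullyFlat (coinvariants k H A) A) (hgal : IsGaloisExtension k H A)

section Extend

variable {M N : Type v} [AddCommGroup M] [Module k M] [RightComodule k H M] [HopfBimodule k H A M]
  [AddCommGroup N] [Module k N] [RightComodule k H N] [HopfBimodule k H A N]
  (h : Coinv k H A M →ₗ[envCoinvariants k H A] Coinv k H A N)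

/-- An `L`-linear map between coinvariants as a map of right `B`-modules. -/
def coinvRight : Coinv k H A M →ₗ[(coinvariants k H A)ᵐᵒᵖ] Coinv k H A N :=
  { h with map_smul' := fun b m => map_smul h (coinvToEnv k H A b) m }

/-- The additive extension of an `L`-linear map between coinvariants. -/
def extendAdd : M →+ N :=
  ((mulBal k H A N).comp (balMap A (coinvRight h))).comp
    (mulBalEquiv k H A hflat hgal M).symm.toAddMonoidHom

/-- The extension is built from right `B`-linearity alone, and knows only about products `ma`. Here
`L`-linearity enters: the structure theorem for `A ⊗ A` lets `x` be taken as `la` with `l` in `L`,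
so that sandwiching `m` by `x` gives `(lm)a`, and `h(lm) = l h(m)`. -/
theorem extendAdd_sandwich (m : Coinv k H A M) (x : A ⊗[k] A) :
    extendAdd hflat hgal h (sandwich k H A m.1 x) = sandwich k H A (h m).1 x := by
  obtain ⟨t, rfl⟩ := (mulBal_bijective k H (A ⊗[k] A) hflat hgal).2 x
  induction t using BalTensor.induction with
  | zero => simp only [map_zero]
  | add y z hy hz => simp only [map_add, hy, hz]
  | tmul l a =>
    have key : ∀ {P : Type v} [AddCommGroup P] [Module k P] [RightComodule k H P]
        [HopfBimodule k H A P] (p : Coinv k H A P),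
        sandwich k H A p.1 (mulBal k H A (A ⊗[k] A) (balTmul (coinvariants k H A) l a)) =
          mulBal k H A P (balTmul (coinvariants k H A) (Coinv.toEnv k H A l • p) a) :=
      fun p => sandwich_freeR k H A p.2 (l.1 ⊗ₜ a)
    rw [key, key, ← map_smul h]
    exact congrArg (fun t => mulBal k H A N (balMap A (coinvRight h) t))
      ((mulBalEquiv k H A hflat hgal M).symm_apply_apply
        (balTmul (coinvariants k H A) (Coinv.toEnv k H A l • m) a))

/-- `M` is spanned by the elements `amb` with `m` coinvariant. -/
theorem sandwich_induction (hflat : LeftFaithfullyFlat (coinvariants k H A) A)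
    (hgal : IsGaloisExtension k H A) {p : M → Prop} (z : M) (zero : p 0)
    (sandwich : ∀ (m : Coinv k H A M) x, p (sandwich k H A m.1 x))
    (add : ∀ y z, p y → p z → p (y + z)) : p z := by
  obtain ⟨t, rfl⟩ := (mulBal_bijective k H M hflat hgal).2 z
  induction t using BalTensor.induction with
  | zero => rw [map_zero]; exact zero
  | add y z hy hz => rw [map_add]; exact add _ _ hy hz
  | tmul m a =>
    rw [mulBal_tmul, ← sandwich_one_tmul]
    exact sandwich m _

/-- The linear extension of an `L`-linear map between coinvariants. -/
def extendLin : M →ₗ[k] N where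
  toFun := extendAdd hflat hgal h
  map_add' := map_add (extendAdd hflat hgal h)
  map_smul' c z := by
    -- On elements `a(mb)` the scalar can be absorbed into `a ⊗ b`, on which both sandwich maps are
    -- `k`-linear.
    refine sandwich_induction (k := k) (H := H) (A := A) (p := fun z =>
      extendAdd hflat hgal h (c • z) = c • extendAdd hflat hgal h z) hflat hgal z ?_
      (fun m x => ?_) fun y z hy hz => ?_
    · simp only [map_zero, smul_zero]
    · rw [← map_smul, extendAdd_sandwich, extendAdd_sandwich, map_smul]
    · simp only [map_add, smul_add, hy, hz]

theorem extendLin_sandwich (m : Coinv k H A M) :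
    extendLin hflat hgal h ∘ₗ sandwich k H A m.1 = sandwich k H A (h m).1 :=
  LinearMap.ext fun x => extendAdd_sandwich hflat hgal h m x

theorem jointlySurjective_sandwich (hflat : LeftFaithfullyFlat (coinvariants k H A) A)
    (hgal : IsGaloisExtension k H A) :
    JointlySurjective (fun m : Coinv k H A M => sandwich k H A m.1) := by
  rw [JointlySurjective, Submodule.eq_top_iff']
  intro z
  refine sandwich_induction hflat hgal z (zero_mem _) (fun m x => ?_) fun _ _ => add_mem
  exact Submodule.mem_iSup_of_mem m ⟨x, rfl⟩

theorem coact_extendLin : coact k H N ∘ₗ extendLin hflat hgal h =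
    (extendLin hflat hgal h).rTensor H ∘ₗ coact k H M := by
  refine (jointlySurjective_sandwich hflat hgal).ext fun m => ?_
  have h1 : coact k H M ∘ₗ sandwich k H A m.1 =
    (sandwich k H A m.1).rTensor H ∘ₗ coact k H (A ⊗[k] A) := isColin_sandwich k H A m.2
  have h2 : coact k H N ∘ₗ sandwich k H A (h m).1 =
    (sandwich k H A (h m).1).rTensor H ∘ₗ coact k H (A ⊗[k] A) := isColin_sandwich k H A (h m).2
  rw [LinearMap.comp_assoc, LinearMap.comp_assoc, extendLin_sandwich, h1, h2,
    ← LinearMap.comp_assoc, ← LinearMap.rTensor_comp, extendLin_sandwich]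

/-- The maps `sandwich m` span `M` and are left `A`-linear, as are the maps `sandwich (h m)` into
`N`; the extension carries the former to the latter. The same argument gives colinearity and right
linearity. -/
theorem extendLin_lact : extendLin hflat hgal h ∘ₗ
    HopfBimodule.lact (k := k) (H := H) (A := A) =
      HopfBimodule.lact (k := k) (H := H) (A := A) ∘ₗ (extendLin hflat hgal h).lTensor A := by
  refine ((jointlySurjective_sandwich hflat hgal).lTensor A).ext fun m => ?_
  refine LinearMap.ext fun t => ?_
  have h1 := sandwich_freeL k H A m.2 t
  have h2 := sandwich_freeL k H A (h m).2 t
  have h3 := LinearMap.congr_fun (extendLin_sandwich hflat hgal h m) (freeL k H A t)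
  rw [LinearMap.comp_assoc, LinearMap.comp_assoc, ← LinearMap.lTensor_comp, extendLin_sandwich]
  refine Eq.trans ?_ (h3.trans h2)
  exact congrArg (extendLin hflat hgal h) h1.symm

theorem extendLin_ract : extendLin hflat hgal h ∘ₗ
    HopfBimodule.ract (k := k) (H := H) (A := A) =
      HopfBimodule.ract (k := k) (H := H) (A := A) ∘ₗ (extendLin hflat hgal h).rTensor A := by
  refine ((jointlySurjective_sandwich hflat hgal).rTensor A).ext fun m => ?_
  refine LinearMap.ext fun t => ?_
  have h1 := sandwich_freeR k H A m.2 t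
  have h2 := sandwich_freeR k H A (h m).2 t
  have h3 := LinearMap.congr_fun (extendLin_sandwich hflat hgal h m) (freeR k H A t)
  rw [LinearMap.comp_assoc, LinearMap.comp_assoc, ← LinearMap.rTensor_comp, extendLin_sandwich]
  refine Eq.trans ?_ (h3.trans h2)
  exact congrArg (extendLin hflat hgal h) h1.symm

end Extend

theorem coinvFunctor_faithful (hflat : LeftFaithfullyFlat (coinvariants k H A) A)
    (hgal : IsGaloisExtension k H A) : (coinvFunctor k H A : HopfBimod.{v} k H A ⥤ _).Faithful where
  map_injective {M N} f g hfg := by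
    refine HopfBimod.Hom.ext (LinearMap.ext fun z => ?_)
    -- As `M` is generated by its coinvariants under right multiplication by `A`, a morphism is
    -- determined by its restriction to them.
    obtain ⟨t, rfl⟩ := (mulBal_bijective k H M.carrier hflat hgal).2 z
    have h : f.coinv = g.coinv := congrArg ModuleCat.Hom.hom hfg
    induction t using BalTensor.induction with
    | zero => simp only [map_zero]
    | add y z hy hz => simp only [map_add, hy, hz]
    | tmul m a => rw [f.toLin_mulBal_tmul, g.toLin_mulBal_tmul, h]

theorem coinvFunctor_full (hflat : LeftFaithfullyFlat (coinvariants k H A) A)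
    (hgal : IsGaloisExtension k H A) : (coinvFunctor k H A : HopfBimod.{v} k H A ⥤ _).Full where
  map_surjective {M N} h := by
    let h' : Coinv k H A M.carrier →ₗ[envCoinvariants k H A] Coinv k H A N.carrier := h.hom
    refine ⟨(⟨extendLin hflat hgal h', coact_extendLin hflat hgal h',
      extendLin_lact hflat hgal h', extendLin_ract hflat hgal h'⟩ : HopfBimod.Hom M N), ?_⟩
    refine ModuleCat.hom_ext (LinearMap.ext fun m => Subtype.ext ?_)
    -- Sandwiching by `1 ⊗ 1` is the identity, so the extension restricts to the given map.
    have h1 := LinearMap.congr_fun (extendLin_sandwich hflat hgal h' m) (1 ⊗ₜ 1)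
    rw [LinearMap.comp_apply, sandwich_one, sandwich_one] at h1
    exact h1

theorem coinvFunctor_essSurj (hflat : LeftFaithfullyFlat (coinvariants k H A) A)
    (hgal : IsGaloisExtension k H A) : (coinvFunctor k H A : HopfBimod.{v} k H A ⥤ _).EssSurj where
  mem_essImage V :=
    ⟨⟨Induced k H A V⟩, ⟨(LinearEquiv.ofBijective (Induced.unit k H A V)
      (Induced.unit_bijective k H A V hflat hgal)).symm.toModuleIso⟩⟩

/-- The coinvariants functor is an equivalence. -/
theorem coinvFunctor_isEquivalence (hflat : LeftFaithfullyFlat (coinvariants k H A) A)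
    (hgal : IsGaloisExtension k H A) : (coinvFunctor k H A : HopfBimod.{v} k H A ⥤ _).IsEquivalence where
  faithful := coinvFunctor_faithful hflat hgal
  full := coinvFunctor_full hflat hgal
  essSurj := coinvFunctor_essSurj hflat hgal

end Equivalence

end

end Coquasi

theorem mainTheorem5 {k : Type u₁} {H : Type u₂} {A : Type v} [Field k]
    [NonAssocRing H] [Module k H] [SMulCommClass k H H] [IsScalarTower k H H] [Coalgebra k H]
    [Coquasi.CoquasiHopfAlgebra k H]
    (hS : Function.Bijective (Coquasi.antipode k H))
    [NonAssocRing A] [Module k A] [SMulCommClass k A A] [IsScalarTower k A A]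
    [Coquasi.RightComodule k H A] [Coquasi.ComoduleAlgebra k H A]
    (hflat : Coquasi.LeftFaithfullyFlat (Coquasi.coinvariants k H A) A)
    (hgal : Coquasi.IsGaloisExtension k H A) :
    Nonempty (ModuleCat.{v} (Coquasi.envCoinvariants k H A) ≌
      Coquasi.HopfBimod.{v} k H A) :=
  have := Coquasi.coinvFunctor_isEquivalence hflat hgal
  ⟨(Coquasi.coinvFunctor k H A).asEquivalence.symm⟩
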